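/- **Theorem (worst-case error bound for digital nets).** Let $s,\alpha,m\ge 1$ be integers with $\alpha>1$, let $b$ be prime, let $1\le q,r,r'\le\infty$ with $1/r+1/r'=1$, and let $\gamma=(\gamma_u)_{u\subseteq\{1,\dots,s\}}$ be nonnegative real weights. *Function space.* For $F:[0,1]^s\to\mathbb R$ with (weak) mixed partial derivatives $\partial^\nu F\in L_1([0,1]^s)$ for all $\nu\in\{0,\dots,\alpha\}^s$, let $$\|F\|_{s,\alpha,\gamma,q,r}=\Bigg(\sum_{u\subseteq\{1,\dots,s\}}\Bigg(\gamma_u^{-q}\sum_{v\subseteq u}\ \sum_{\tau\in\{1,\dots,\alpha\}^{u\setminus v}}\int_{[0,1]^{v}}\bigg|\int_{[0,1]^{s-|v|}}\partial^{(\alpha_v,\tau_{u\setminus v},0)}F(y)\,dy_{\{1,\dots,s\}\setminus v}\bigg|^q dy_v\Bigg)^{r/q}\Bigg)^{1/r},$$ with the usual modifications for $q=\infty$ or $r=\infty$; here $(\alpha_v,\tau_{u\setminus v},0)$ has entries $\alpha$ on $v$, $\tau_j$ for $j\in u\setminus v$, and $0$ outside $u$. If $\gamma_u=0$, the term of $u$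 is $0$ when all its integrals vanish and $\infty$ otherwise. Let $\mathcal W_{s,\alpha,\gamma,q,r}$ be the space of all such $F$, represented by continuous functions on $[0,1]^s$, with finite norm. *Digital net.* Let $C_1,\dots,C_s\in\mathbb Z_b^{\alpha m\times m}$. For $0\le n<b^m$ with $n=\eta_0+\eta_1b+\dots+\eta_{m-1}b^{m-1}$, $\eta_i\in\{0,\dots,b-1\}$, put $(\zeta_1,\dots,\zeta_{\alpha m})^\top=C_j(\eta_0,\dots,\eta_{m-1})^\top$, let $y^{(n)}_j=\sum_{i=1}^{\alpha m}\zeta_i b^{-i}$ (with $\zeta_i$ read in $\{0,\dots,b-1\}$), and $y_n=(y^{(n)}_1,\dots,y^{(n)}_s)$. *Error criterion.* For $k=\varkappa_0+\varkappa_1b+\cdots$ with $\varkappa_i\in\{0,\dots,b-1\}$ let $\mathrm{tr}_{\alpha m}(k)=(\varkappa_0,\dots,\varkappa_{\alpha m-1})^\top$. For $\emptyset\ne u\subseteq\{1,\dots,s\}$ let $$D_u^*=\Big\{k\in\mathbb N^{u}:\ \textstyle\sum_{j\in u}C_j^\top\,\mathrm{tr}_{\alpha m}(k_j)=0\in\mathbb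 Z_b^m\Big\},\qquad \mathbb N=\{1,2,\dots\}.$$ For $k=\kappa_1b^{a_1-1}+\dots+\kappa_\rho b^{a_\rho-1}$ with $\kappa_i\in\{1,\dots,b-1\}$ and $a_1>\dots>a_\rho>0$ let $\mu_\alpha(k)=a_1+\dots+a_{\min(\alpha,\rho)}$, let $\mu_\alpha(0)=0$, and for $k\in\mathbb N^u$ let $\mu_\alpha(k)=\sum_{j\in u}\mu_\alpha(k_j)$. Let $$C_{\alpha,b}=\max\!\Big(\tfrac{2}{(2\sin\frac\pi b)^{\alpha}},\max_{1\le z\le\alpha-1}\tfrac1{(2\sin\frac\pi b)^z}\Big)\Big(1+\tfrac1b+\tfrac1{b(b+1)}\Big)^{\alpha-2}\Big(3+\tfrac2b+\tfrac{2b+1}{b-1}\Big),$$ $$e_{s,\alpha,\gamma,r'}=\Bigg(\sum_{\emptyset\ne u\subseteq\{1,\dots,s\}}\Big(C_{\alpha,b}^{|u|}\,\gamma_u\sum_{k\in D_u^*}b^{-\mu_\alpha(k)}\Big)^{r'}\Bigg)^{1/r'}$$ (a maximum over $u$ if $r'=\infty$). *Conclusion.* Then $e_{s,\alpha,\gamma,r'}<\infty$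 and $$\sup_{F\in\mathcal W_{s,\alpha,\gamma,q,r},\ \|F\|_{s,\alpha,\gamma,q,r}\le1}\bigg|\frac1{b^m}\sum_{n=0}^{b^m-1}F(y_n)-\int_{[0,1]^s}F(y)\,dy\bigg|\le e_{s,\alpha,\gamma,r'}.$$ Moreover, for every $\sigma\in[0,1)^s$ the same bound holds with $y_n$ replaced by the digitally shifted point $y_n\oplus\sigma$, where $\oplus$ is componentwise digit-wise addition modulo $b$ of base-$b$ expansions (those with infinitely many digits different from $b-1$). -/

import Mathlib

open scoped ENNReal NNReal ContDiff Matrix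
open MeasureTheory

noncomputable section

namespace QMC

/-- The closed unit cube `[0,1]^s`. -/
def cube (s : ℕ) : Set (Fin s → ℝ) := Set.Icc 0 1

/-- The `ℓ_p` combination `(∑_{i ∈ S} a_i ^ p) ^ (1/p)` of nonnegative extended reals,
read as `max_{i ∈ S} a_i` for `p = ∞`. -/
def lpSum {ι : Type*} (p : ℝ≥0∞) (S : Finset ι) (a : ι → ℝ≥0∞) : ℝ≥0∞ :=
  if p = ⊤ then S.sup a else (∑ i ∈ S, a i ^ p.toReal) ^ (1 / p.toReal)

/-! ### The weighted unanchored Sobolev space -/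

/-- `g` is the weak partial derivative of `f` in the `j`-th coordinate on the open unit cube
(tested against smooth functions with compact support in the open cube). -/
def IsWeakPartial {s : ℕ} (j : Fin s) (f g : (Fin s → ℝ) → ℝ) : Prop :=
  ∀ φ : (Fin s → ℝ) → ℝ, ContDiff ℝ ∞ φ → HasCompactSupport φ →
    (tsupport φ ⊆ Set.univ.pi fun _ => Set.Ioo (0 : ℝ) 1) →
    ∫ x in cube s, f x * fderiv ℝ φ x (Pi.single j 1) = - ∫ x in cube s, g x * φ x

/-- `D ν`, for the multi-indices `ν ∈ {0,…,α}^s`, are the mixed partial derivatives `∂^ν F` on the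
unit cube: all of them are integrable and each is obtained from the ones of lower order by
weak differentiation, starting from `D 0 = F`. -/
structure IsMixedDerivFamily {s : ℕ} (α : ℕ) (F : (Fin s → ℝ) → ℝ)
    (D : (Fin s → ℕ) → (Fin s → ℝ) → ℝ) : Prop where
  zero : D 0 = F
  integrable : ∀ ν : Fin s → ℕ, (∀ j, ν j ≤ α) → IntegrableOn (D ν) (cube s)
  weakPartial : ∀ ν : Fin s → ℕ, (∀ j, ν j ≤ α) → ∀ j, ν j < α →
    IsWeakPartial j (D ν) (D (ν + Pi.single j 1))

/-- The function `y ↦ ∫ g(y) dy_{-v}`, obtained by integrating out the coordinates outside `v`.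
It depends on the coordinates `y_j`, `j ∈ v`, only (the coordinates `z_j`, `j ∈ v`, of the
integration variable do not enter, and run over a set of measure one). -/
def integrateOut {s : ℕ} (v : Finset (Fin s)) (g : (Fin s → ℝ) → ℝ) (y : Fin s → ℝ) : ℝ :=
  ∫ z in cube s, g (v.piecewise y z)

/-- The pairs `(v, τ)` with `v ⊆ u` and `τ ∈ {1,…,α}^{u \ v}`, where `τ` is extended by `0`
outside `u \ v`. -/
def derivIndices {s : ℕ} (α : ℕ) (u : Finset (Fin s)) :
    Finset (Σ _ : Finset (Fin s), Fin s → ℕ) :=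
  u.powerset.sigma fun v =>
    Fintype.piFinset fun j => if j ∈ u \ v then Finset.Icc 1 α else {0}

/-- The multi-index `(α_v, τ_{u \ v}, 0)`. -/
def multiIndex {s : ℕ} (α : ℕ) (v : Finset (Fin s)) (τ : Fin s → ℕ) : Fin s → ℕ :=
  fun j => if j ∈ v then α else τ j

/-- The value of the norm, computed from the mixed derivatives `D ν = ∂^ν F`:
the `ℓ_r` combination over `u ⊆ {1,…,s}` of `γ_u⁻¹` times the `ℓ_q` combination over the pairs
`(v, τ)` of the `L_q([0,1]^v)` norms of `∫ ∂^{(α_v, τ_{u \ v}, 0)} F(y) dy_{-v}`.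
As the inner function does not depend on the coordinates outside `v`, its `L_q` norm is taken
over `[0,1]^s`. In `ℝ≥0∞` a weight `γ_u = 0` means that the corresponding
term is `0` if all its derivative integrals vanish, and `∞` otherwise. -/
def familyNorm {s : ℕ} (α : ℕ) (γ : Finset (Fin s) → ℝ≥0) (q r : ℝ≥0∞)
    (D : (Fin s → ℕ) → (Fin s → ℝ) → ℝ) : ℝ≥0∞ :=
  lpSum r Finset.univ fun u : Finset (Fin s) =>
    (γ u : ℝ≥0∞)⁻¹ * lpSum q (derivIndices α u) fun p =>
      eLpNorm (integrateOut p.1 (D (multiIndex α p.1 p.2))) q (volume.restrict (cube s))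

/-- The norm `‖F‖_{s,α,γ,q,r}`. Weak derivatives are unique almost everywhere, so all families
of mixed derivatives of `F` give the same value, and the infimum only serves to select it;
the norm is `∞` if `F` does not have all its mixed derivatives. -/
def sobolevNorm {s : ℕ} (α : ℕ) (γ : Finset (Fin s) → ℝ≥0) (q r : ℝ≥0∞)
    (F : (Fin s → ℝ) → ℝ) : ℝ≥0∞ :=
  ⨅ (D : (Fin s → ℕ) → (Fin s → ℝ) → ℝ) (_ : IsMixedDerivFamily α F D), familyNorm α γ q r D

/-- The space `W_{s,α,γ,q,r}` of functions on the unit cube (values outside the cube are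
irrelevant): each function is represented by its continuous version, so that point values
are meaningful. -/
def sobolevSpace {s : ℕ} (α : ℕ) (γ : Finset (Fin s) → ℝ≥0) (q r : ℝ≥0∞) :
    Set ((Fin s → ℝ) → ℝ) :=
  {F | ContinuousOn F (cube s) ∧ sobolevNorm α γ q r F < ⊤}

/-- The error of the equal-weight quadrature rule with the points `y 0, …, y (N-1)`. -/
def quadratureError {s : ℕ} (N : ℕ) (y : ℕ → Fin s → ℝ) (F : (Fin s → ℝ) → ℝ) : ℝ :=
  |1 / (N : ℝ) * ∑ n ∈ Finset.range N, F (y n) - ∫ x in cube s, F x|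

/-- The worst-case error over the unit ball of `W_{s,α,γ,q,r}`. -/
def worstCaseError {s : ℕ} (α : ℕ) (γ : Finset (Fin s) → ℝ≥0) (q r : ℝ≥0∞)
    (N : ℕ) (y : ℕ → Fin s → ℝ) : ℝ≥0∞ :=
  ⨆ F ∈ {F ∈ sobolevSpace α γ q r | sobolevNorm α γ q r F ≤ 1},
    ENNReal.ofReal (quadratureError N y F)

/-! ### Digital nets and digital shifts -/

/-- The digit `ϰ_i` of `k = ϰ_0 + ϰ_1 b + ϰ_2 b² + ⋯`. -/
def natDigit (b k i : ℕ) : ℕ := k / b ^ i % b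

/-- The first `l` base-`b` digits of `k`, as a vector over `ℤ_b`. -/
def digitVec (b l k : ℕ) : Fin l → ZMod b := fun i => (natDigit b k i : ZMod b)

/-- The `n`-th point of the digital net with generating matrices `C_1, …, C_s`. -/
def digitalNet {s : ℕ} (b α m : ℕ) (C : Fin s → Matrix (Fin (α * m)) (Fin m) (ZMod b))
    (n : ℕ) : Fin s → ℝ :=
  fun j => ∑ i : Fin (α * m),
    (((C j *ᵥ digitVec b m n) i).val : ℝ) / (b : ℝ) ^ ((i : ℕ) + 1)

/-- The digital shift `y ⊕ σ` of points of `[0,1)^s`: digit-wise addition modulo `b` of the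
base-`b` expansions with infinitely many digits different from `b - 1`
(addition in `Fin b` is modulo `b`). -/
def digitalShift {s : ℕ} (b : ℕ) [NeZero b] (y σ : Fin s → ℝ) : Fin s → ℝ :=
  fun j => Real.ofDigits fun i => Real.digits (y j) b i + Real.digits (σ j) b i

/-! ### The error criterion -/

/-- The positions `a ≥ 1` of the nonzero digits of `k`, i.e. the exponents in
`k = κ_1 b^{a_1 - 1} + ⋯ + κ_ρ b^{a_ρ - 1}` with `κ_i ∈ {1,…,b-1}`
(for `b ≥ 2` they are at most `k`). -/
def digitPositions (b k : ℕ) : Finset ℕ :=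
  (Finset.Icc 1 k).filter fun a => natDigit b k (a - 1) ≠ 0

/-- `μ_α(k) = a_1 + ⋯ + a_{min(α,ρ)}`, where `a_1 > ⋯ > a_ρ` are the positions of the nonzero
digits of `k`; `μ_α(0) = 0`. -/
def mu (α b k : ℕ) : ℕ := (((digitPositions b k).sort (· ≥ ·)).take α).sum

/-- The constant `C_{α,b}`. -/
def walshConst (α b : ℕ) : ℝ :=
  (Finset.Icc 1 (α - 1)).fold max (2 / (2 * Real.sin (Real.pi / b)) ^ α)
      (fun z => 1 / (2 * Real.sin (Real.pi / b)) ^ z)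
    * (1 + 1 / (b : ℝ) + 1 / ((b : ℝ) * ((b : ℝ) + 1))) ^ (α - 2)
    * (3 + 2 / (b : ℝ) + (2 * (b : ℝ) + 1) / ((b : ℝ) - 1))

/-- The dual net without zero components, projected to the components in `u`. -/
def dualNet {s : ℕ} (b α m : ℕ) (C : Fin s → Matrix (Fin (α * m)) (Fin m) (ZMod b))
    (u : Finset (Fin s)) : Set (u → ℕ) :=
  {k | (∀ j, 1 ≤ k j) ∧ ∑ j : u, (C j)ᵀ *ᵥ digitVec b (α * m) (k j) = 0}

/-- The error criterion `e_{s,α,γ,r'}` of the digital net with generating matrices `C`. -/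
def errorCriterion {s : ℕ} (b α m : ℕ) (γ : Finset (Fin s) → ℝ≥0) (r' : ℝ≥0∞)
    (C : Fin s → Matrix (Fin (α * m)) (Fin m) (ZMod b)) : ℝ≥0∞ :=
  lpSum r' (Finset.univ.filter fun u : Finset (Fin s) => u.Nonempty) fun u =>
    ENNReal.ofReal (walshConst α b) ^ u.card * (γ u : ℝ≥0∞) *
      ∑' k : dualNet b α m C u, ((b : ℝ≥0∞)⁻¹) ^ (∑ j : u, mu α b ((k : u → ℕ) j))

end QMC

end

open scoped ENNReal NNReal ContDiff Matrix
open MeasureTheory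

noncomputable section

namespace QMC

/-! ### Integrals of step functions times periodic functions -/

/-! The error is a character sum over the net, so it sees only the Walsh coefficients of `F` on the
dual net. The analytic core is that the coefficient at `k` with support `u` is at most
`C_{α,b}^{|u|} b^{-μ_α(k)}` times the part of the norm of `F` belonging to `u`
(`norm_pairing_walsh_le`).

In one variable, let `k = κ b^a + K'` with leading digit `κ`. The oscillation of that digit gives
`wal_k` mean zero on every `b`-adic interval of length `b^{-a}`. Its primitive is therefore
`wal_{K'}` times a `b^{-a}`-periodic factor of size about `b^{-(a+1)}`. Integrating again removes
the next digit in the same way, so `α` integrations by parts yield `b^{-μ_α(k)}`. Control of the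
constant needs only the mean and the distance from the mean of the periodic factor, both updated by
`peel`. Once the digits are exhausted, further primitives cost nothing (`chain_of_periodic`).

A primitive has no boundary terms only if its integrand has mean zero. So before each later
integration a constant is split off. The constant leaves an integral of a lower derivative over the
whole coordinate, and the last remainder leaves an `α`-th derivative against a bounded function.
These are exactly the terms `τ_j` and `α_v` of the norm. `Chain` records such a decomposition, and
`norm_pairing_multiIndex_le` runs it through all coordinates of `u`. As derivatives are weak, the
test functions are limits of smooth ones (`pairing_ibp`).

To pass from coefficients to point values, the Walsh kernel of level `l` is `b^l` times the
indicator of a common `b`-adic interval. Partial sums of a continuous `F` thus converge at every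
point of `[0,1)^s`, with no absolute convergence required (`tendsto_partialSum`,
`quadratureError_le`). A digital shift multiplies each character by a factor of modulus one.
Grouping `k` by support and applying Hölder over `u` after inserting `γ_u γ_u⁻¹` gives the bound.
Finiteness of the criterion for `α ≥ 2` is the recursion `muSum_succ`. -/

/-- Bounded measurable functions. -/
def IsBddMeas (f : ℝ → ℂ) : Prop := Measurable f ∧ ∃ C : ℝ, ∀ x, ‖f x‖ ≤ C

lemma IsBddMeas.intervalIntegrable {f : ℝ → ℂ} (hf : IsBddMeas f) (a b : ℝ) :
    IntervalIntegrable f volume a b := by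
  obtain ⟨hm, C, hC⟩ := hf
  refine (intervalIntegrable_const (c := C) (μ := volume) (a := a) (b := b)).mono_fun
    hm.aestronglyMeasurable ?_
  filter_upwards with x
  exact (hC x).trans (le_abs_self C)

lemma IsBddMeas.mul {f g : ℝ → ℂ} (hf : IsBddMeas f) (hg : IsBddMeas g) :
    IsBddMeas fun x => f x * g x := by
  obtain ⟨hfm, C, hC⟩ := hf
  obtain ⟨hgm, D, hD⟩ := hg
  refine ⟨hfm.mul hgm, C * D, fun x => ?_⟩
  rw [norm_mul]
  exact mul_le_mul (hC x) (hD x) (norm_nonneg _) ((norm_nonneg _).trans (hC x))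

lemma isBddMeas_const (c : ℂ) : IsBddMeas fun _ => c :=
  ⟨measurable_const, ‖c‖, fun _ => le_rfl⟩

lemma IsBddMeas.sub_const {f : ℝ → ℂ} (hf : IsBddMeas f) (c : ℂ) :
    IsBddMeas fun x => f x - c := by
  obtain ⟨hfm, C, hC⟩ := hf
  exact ⟨hfm.sub_const c, C + ‖c‖, fun x => (norm_sub_le _ _).trans (by gcongr; exact hC x)⟩

/-- The primitive vanishing at `0`. -/
def prim (f : ℝ → ℂ) (x : ℝ) : ℂ := ∫ t in (0 : ℝ)..x, f t

lemma IsBddMeas.continuous_prim {f : ℝ → ℂ} (hf : IsBddMeas f) : Continuous (prim f) :=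
  intervalIntegral.continuous_primitive (fun a b => hf.intervalIntegrable a b) 0

lemma prim_zero (f : ℝ → ℂ) : prim f 0 = 0 := by simp [prim]

lemma norm_prim_sub_le {f : ℝ → ℂ} (hf : IsBddMeas f) {N : ℝ} (hN : ∀ x, ‖f x‖ ≤ N) (x y : ℝ) :
    ‖prim f y - prim f x‖ ≤ N * |y - x| := by
  unfold prim
  rw [intervalIntegral.integral_interval_sub_left (hf.intervalIntegrable _ _)
    (hf.intervalIntegrable _ _)]
  exact intervalIntegral.norm_integral_le_of_norm_le_const fun t _ => hN t

lemma prim_periodic {f : ℝ → ℂ} (hf : IsBddMeas f) {ℓ : ℝ} (hp : Function.Periodic f ℓ)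
    (h0 : prim f ℓ = 0) : Function.Periodic (prim f) ℓ := by
  intro x
  have h := hp.intervalIntegral_add_eq x 0
  have h2 : prim f (x + ℓ) - prim f x = 0 := by
    unfold prim
    rw [intervalIntegral.integral_interval_sub_left (hf.intervalIntegrable _ _)
      (hf.intervalIntegrable _ _), h]
    simpa [prim] using h0
  exact sub_eq_zero.mp h2

/-- A function of period `ℓ` with mean zero, bounded by `N`, has a primitive oscillating by at most
`ℓ N / 2`. -/
lemma norm_prim_sub_le_of_periodic {f : ℝ → ℂ} (hf : IsBddMeas f) {ℓ : ℝ} (hℓ : 0 < ℓ)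
    (hp : Function.Periodic f ℓ) (h0 : prim f ℓ = 0) {N : ℝ} (hN : ∀ x, ‖f x‖ ≤ N) (x y : ℝ) :
    ‖prim f y - prim f x‖ ≤ ℓ * N / 2 := by
  have hN0 : 0 ≤ N := (norm_nonneg _).trans (hN 0)
  have hP := prim_periodic hf hp h0
  obtain ⟨y', hy', hyy⟩ := hP.exists_mem_Ico hℓ y x
  rw [hyy]
  rcases le_total (y' - x) (ℓ / 2) with h | h
  · refine (norm_prim_sub_le hf hN x y').trans ?_
    rw [abs_of_nonneg (by linarith [hy'.1])]
    nlinarith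
  -- In the second half of the period the nearer reference point is `x + ℓ`, where the primitive
  -- takes the same value as at `x`. This is the source of the factor 1/2.
  · rw [← hP x]
    refine (norm_prim_sub_le hf hN (x + ℓ) y').trans ?_
    rw [abs_of_nonpos (by linarith [hy'.2])]
    nlinarith

lemma isBddMeas_prim {f : ℝ → ℂ} (hf : IsBddMeas f) {ℓ : ℝ} (hℓ : 0 < ℓ)
    (hp : Function.Periodic f ℓ) (h0 : prim f ℓ = 0) : IsBddMeas (prim f) := by
  obtain ⟨N, hN⟩ := hf.2
  refine ⟨hf.continuous_prim.measurable, ℓ * N / 2, fun x => ?_⟩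
  simpa [prim_zero] using norm_prim_sub_le_of_periodic hf hℓ hp h0 hN 0 x

lemma periodic_int_mul {p : ℝ → ℂ} {ℓ : ℝ} (hp : Function.Periodic p ℓ) (n : ℤ) :
    Function.Periodic p (n * ℓ) := hp.int_mul n

lemma floor_mul_eq_of_mem {M : ℝ} (hM : 0 < M) {n : ℤ} {x t : ℝ} (hx : x < (n + 1) * (1 / M))
    (ht : t ∈ Set.Ioc (n * (1 / M)) x) : ⌊t * M⌋ = n := by
  rw [Int.floor_eq_iff]
  have h1 : (n : ℝ) * (1 / M) * M = n := by field_simp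
  have h2 : ((n : ℝ) + 1) * (1 / M) * M = n + 1 := by field_simp
  constructor
  · rw [← h1]; exact (mul_le_mul_of_nonneg_right ht.1.le hM.le)
  · rw [← h2]; exact (mul_lt_mul_of_pos_right (ht.2.trans_lt hx) hM)

lemma measurable_step (s : ℤ → ℂ) (M : ℝ) : Measurable fun t : ℝ => s ⌊t * M⌋ :=
  (measurable_from_top (f := s)).comp (Int.measurable_floor.comp (measurable_id.mul_const M))

/-- Within a cell, a step function factors out of the integral. -/
lemma integral_step_cell {M : ℝ} (hM : 0 < M) (s : ℤ → ℂ) {p : ℝ → ℂ}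
    (hp : Function.Periodic p (1 / M)) (n : ℤ) {x : ℝ} (hx0 : n * (1 / M) ≤ x)
    (hx : x ≤ (n + 1) * (1 / M)) :
    ∫ t in (n * (1 / M))..x, s ⌊t * M⌋ * p t = s n * prim p (x - n * (1 / M)) := by
  have h1 : ∫ t in (n * (1 / M))..x, s ⌊t * M⌋ * p t = ∫ t in (n * (1 / M))..x, s n * p t := by
    apply intervalIntegral.integral_congr_ae
    have : ∀ᵐ t : ℝ, t ≠ (n + 1) * (1 / M) := by simp [ae_iff, measure_singleton]
    filter_upwards [this] with t ht hmem
    rw [Set.uIoc_of_le hx0] at hmem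
    rw [floor_mul_eq_of_mem hM (n := n) (x := t) (lt_of_le_of_ne (hmem.2.trans hx) ht)
      ⟨hmem.1, le_rfl⟩]
  rw [h1, intervalIntegral.integral_const_mul, prim]
  congr 1
  have h2 := intervalIntegral.integral_comp_add_right (a := 0) (b := x - n * (1 / M)) p (n * (1 / M))
  rw [zero_add, sub_add_cancel] at h2
  rw [← h2]
  refine intervalIntegral.integral_congr fun t _ => ?_
  exact (periodic_int_mul hp n) t

/-- Over whole cells, the integral of a step function times a periodic function is a sum. -/
lemma integral_step_whole {M : ℝ} (hM : 0 < M) {s : ℤ → ℂ} {p : ℝ → ℂ}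
    (hs : ∃ C : ℝ, ∀ n, ‖s n‖ ≤ C) (hp : Function.Periodic p (1 / M)) (hpm : IsBddMeas p)
    {S : ℤ → ℂ} (hS0 : S 0 = 0) (hS : ∀ n, S (n + 1) = S n + s n * prim p (1 / M)) (n : ℤ) :
    prim (fun t => s ⌊t * M⌋ * p t) (n * (1 / M)) = S n := by
  have hb : IsBddMeas fun t => s ⌊t * M⌋ * p t :=
    IsBddMeas.mul ⟨measurable_step s M, hs.choose, fun t => hs.choose_spec _⟩ hpm
  have step : ∀ n : ℤ, prim (fun t => s ⌊t * M⌋ * p t) ((n + 1 : ℤ) * (1 / M))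
      = prim (fun t => s ⌊t * M⌋ * p t) (n * (1 / M)) + s n * prim p (1 / M) := by
    intro n
    have h := integral_step_cell hM s hp n (x := (n + 1) * (1 / M)) (by
      have : 0 < 1 / M := by positivity
      nlinarith) le_rfl
    have e : ((n : ℝ) + 1) * (1 / M) - n * (1 / M) = 1 / M := by ring
    rw [e] at h
    rw [← h, prim, prim, intervalIntegral.integral_add_adjacent_intervals
      (hb.intervalIntegrable _ _) (hb.intervalIntegrable _ _)]
    push_cast; rfl
  induction n using Int.induction_on with
  | zero => simp [prim_zero, hS0]
  | succ i ih => rw [step, hS, ih]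
  | pred i ih =>
    have h1 := step (-(i : ℤ) - 1)
    have h2 := hS (-(i : ℤ) - 1)
    rw [sub_add_cancel] at h1 h2
    rw [ih, h2] at h1
    exact (add_right_cancel h1).symm

lemma prim_step {M : ℝ} (hM : 0 < M) {s : ℤ → ℂ} {p : ℝ → ℂ}
    (hs : ∃ C : ℝ, ∀ n, ‖s n‖ ≤ C) (hp : Function.Periodic p (1 / M)) (hpm : IsBddMeas p)
    {S : ℤ → ℂ} (hS0 : S 0 = 0) (hS : ∀ n, S (n + 1) = S n + s n * prim p (1 / M)) (x : ℝ) :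
    prim (fun t => s ⌊t * M⌋ * p t) x
      = S ⌊x * M⌋ + s ⌊x * M⌋ * prim p (x - ⌊x * M⌋ * (1 / M)) := by
  have hb : IsBddMeas fun t => s ⌊t * M⌋ * p t :=
    IsBddMeas.mul ⟨measurable_step s M, hs.choose, fun t => hs.choose_spec _⟩ hpm
  rw [← integral_step_whole hM hs hp hpm hS0 hS ⌊x * M⌋, ← integral_step_cell hM s hp ⌊x * M⌋,
    prim, prim, intervalIntegral.integral_add_adjacent_intervals
      (hb.intervalIntegrable _ _) (hb.intervalIntegrable _ _)]
  · rw [mul_one_div, div_le_iff₀ hM]; exact Int.floor_le _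
  · rw [mul_one_div, le_div_iff₀ hM]; exact (Int.lt_floor_add_one _).le

/-- The step function factors out if the periodic function has mean zero. -/
lemma prim_step_of_mean_zero {M : ℝ} (hM : 0 < M) {s : ℤ → ℂ} {p : ℝ → ℂ}
    (hs : ∃ C : ℝ, ∀ n, ‖s n‖ ≤ C) (hp : Function.Periodic p (1 / M)) (hpm : IsBddMeas p)
    (h0 : prim p (1 / M) = 0) (x : ℝ) :
    prim (fun t => s ⌊t * M⌋ * p t) x = s ⌊x * M⌋ * prim p x := by
  rw [prim_step hM hs hp hpm (S := fun _ => 0) rfl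
    (fun n => by rw [h0, mul_zero, add_zero]), zero_add]
  congr 1
  exact (periodic_int_mul (prim_periodic hpm hp h0) ⌊x * M⌋).sub_eq x

/-! ### The character and the constant `1 / (2 sin (π / b))` -/

/-- The constant `1 / (2 sin (π / b))`. -/
def sinConst (b : ℕ) : ℝ := 1 / (2 * Real.sin (Real.pi / b))

/-- The reflection `k ↦ b - k` reduces to angles in `[0, π/2]`, where sine increases. -/
lemma sin_pi_div_le {b k : ℕ} (hk : 1 ≤ k) (hkb : k < b) :
    Real.sin (Real.pi / b) ≤ Real.sin (Real.pi * k / b) := by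
  have hb : (0 : ℝ) < b := by exact_mod_cast (by omega : 0 < b)
  have hπ := Real.pi_pos
  have hk' : (1 : ℝ) ≤ k := by exact_mod_cast hk
  have hkb' : (k : ℝ) + 1 ≤ b := by exact_mod_cast hkb
  rcases le_total (2 * (k : ℝ)) b with h | h
  · apply Real.sin_le_sin_of_le_of_le_pi_div_two
    · have : 0 < Real.pi / b := by positivity
      linarith
    · rw [div_le_div_iff₀ hb two_pos]; nlinarith
    · gcongr; nlinarith
  · rw [← Real.sin_pi_sub (Real.pi * k / b)]
    have e : Real.pi - Real.pi * k / b = Real.pi * (b - k) / b := by field_simp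
    rw [e]
    apply Real.sin_le_sin_of_le_of_le_pi_div_two
    · have : 0 < Real.pi / b := by positivity
      linarith
    · rw [div_le_div_iff₀ hb two_pos]; nlinarith
    · gcongr; nlinarith

lemma sin_pi_div_pos {b : ℕ} (hb : 2 ≤ b) : 0 < Real.sin (Real.pi / b) := by
  have hb' : (2 : ℝ) ≤ b := by exact_mod_cast hb
  apply Real.sin_pos_of_pos_of_lt_pi
  · have := Real.pi_pos; positivity
  · rw [div_lt_iff₀ (by positivity)]; nlinarith [Real.pi_pos]

lemma sinConst_pos {b : ℕ} (hb : 2 ≤ b) : 0 < sinConst b := by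
  have := sin_pi_div_pos hb
  unfold sinConst; positivity

/-- The expression is a convex combination of `1` and `z`. -/
lemma norm_one_add_le {z : ℂ} (hz : ‖z‖ = 1) {t : ℝ} (h0 : 0 ≤ t) (h1 : t ≤ 1) :
    ‖1 + (z - 1) * t‖ ≤ 1 := by
  have e : 1 + (z - 1) * t = ((1 - t : ℝ) : ℂ) + z * (t : ℂ) := by push_cast; ring
  rw [e]
  refine (norm_add_le _ _).trans ?_
  rw [norm_mul, hz, Complex.norm_real, Complex.norm_real, Real.norm_of_nonneg h0,
    Real.norm_of_nonneg (by linarith)]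
  linarith

/-- The additive character `x ↦ exp (2 π i x / b)` of `ℤ_b`. -/
def chi {b : ℕ} [NeZero b] (x : ZMod b) : ℂ := ZMod.stdAddChar x

section chi
variable {b : ℕ} [NeZero b]

@[simp] lemma chi_zero : chi (0 : ZMod b) = 1 := by simp [chi]

lemma chi_add (x y : ZMod b) : chi (x + y) = chi x * chi y := by
  simp [chi, AddChar.map_add_eq_mul]

lemma chi_sum {ι : Type*} (S : Finset ι) (f : ι → ZMod b) :
    chi (∑ i ∈ S, f i) = ∏ i ∈ S, chi (f i) := by
  classical
  induction S using Finset.induction_on with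
  | empty => simp
  | insert i S hi ih => rw [Finset.sum_insert hi, Finset.prod_insert hi, chi_add, ih]

@[simp] lemma norm_chi (x : ZMod b) : ‖chi x‖ = 1 := by
  rw [chi, ZMod.stdAddChar_apply]; exact Circle.norm_coe _

lemma conj_chi (x : ZMod b) : (starRingEnd ℂ) (chi x) = chi (-x) := by
  have h : chi x * chi (-x) = 1 := by rw [← chi_add]; simp
  rw [eq_comm, ← Complex.inv_eq_conj (norm_chi x)]
  exact eq_inv_of_mul_eq_one_right h

lemma chi_ne_one {x : ZMod b} (hx : x ≠ 0) : chi x ≠ 1 := by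
  intro h
  apply hx
  apply ZMod.injective_stdAddChar
  rw [← chi, h]; simp

lemma norm_inv_chi_sub_one_le (hb : 2 ≤ b) {x : ZMod b} (hx : x ≠ 0) :
    ‖(chi x - 1)⁻¹‖ ≤ sinConst b := by
  have hval : x.val ≠ 0 := by rwa [Ne, ZMod.val_eq_zero]
  have h1 : chi x = Complex.exp (Complex.I * ((2 * (Real.pi * x.val / b) : ℝ) : ℂ)) := by
    have h := ZMod.stdAddChar_coe (N := b) (x.val : ℤ)
    rw [Int.cast_natCast, ZMod.natCast_val, ZMod.cast_id', id] at h
    rw [chi, h]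
    congr 1
    push_cast
    ring
  have hs := sin_pi_div_le (b := b) (k := x.val) (by omega) (ZMod.val_lt x)
  have hp := sin_pi_div_pos (b := b) hb
  rw [norm_inv, h1, Complex.norm_exp_I_mul_ofReal_sub_one, mul_div_cancel_left₀ _ two_ne_zero,
    sinConst, one_div]
  apply inv_anti₀ (by positivity)
  rw [Real.norm_eq_abs]
  exact (mul_le_mul_of_nonneg_left hs zero_le_two).trans (le_abs_self _)

/-! ### Removing the leading digit -/

variable {κ : ZMod b} {a : ℕ} {Φ : ℝ → ℂ} {m : ℂ} {N : ℝ}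

lemma exists_bound_chi (κ : ZMod b) : ∃ C : ℝ, ∀ n : ℤ, ‖chi (κ * (n : ZMod b))‖ ≤ C :=
  ⟨1, fun _ => (norm_chi _).le⟩

/-- The geometric sum serves as the discrete antiderivative `S` that `integral_step_whole` and
`prim_step` require when the step function is a character. -/
lemma chi_geom (hκ : κ ≠ 0) (I : ℂ) (n : ℤ) :
    I * ((chi (κ * ((n + 1 : ℤ) : ZMod b)) - 1) * (chi κ - 1)⁻¹)
      = I * ((chi (κ * (n : ZMod b)) - 1) * (chi κ - 1)⁻¹) + chi (κ * (n : ZMod b)) * I := by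
  have h : chi κ - 1 ≠ 0 := sub_ne_zero.mpr (chi_ne_one hκ)
  have e : chi (κ * ((n + 1 : ℤ) : ZMod b)) = chi (κ * (n : ZMod b)) * chi κ := by
    rw [← chi_add]; congr 1; push_cast; ring
  rw [e]
  field_simp
  ring

/-- The integrand after splitting off the lower digits of a Walsh function. -/
def digitMul (κ : ZMod b) (a : ℕ) (Φ : ℝ → ℂ) (t : ℝ) : ℂ :=
  chi (κ * ((⌊t * (b : ℝ) ^ (a + 1)⌋ : ℤ) : ZMod b)) * Φ t

lemma pow_cast_pos (a : ℕ) : (0 : ℝ) < (b : ℝ) ^ a := by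
  have := NeZero.pos b
  positivity

lemma isBddMeas_digitMul (hm : IsBddMeas Φ) : IsBddMeas (digitMul κ a Φ) :=
  IsBddMeas.mul ⟨measurable_step (fun n => chi (κ * (n : ZMod b))) _, 1, fun _ => (norm_chi _).le⟩ hm

lemma floor_add_cell (x : ℝ) :
    ⌊(x + 1 / (b : ℝ) ^ a) * (b : ℝ) ^ (a + 1)⌋ = ⌊x * (b : ℝ) ^ (a + 1)⌋ + b := by
  have := pow_cast_pos (b := b) a
  have e : (x + 1 / (b : ℝ) ^ a) * (b : ℝ) ^ (a + 1) = x * (b : ℝ) ^ (a + 1) + (b : ℤ) := by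
    push_cast; rw [pow_succ]; field_simp
  rw [e, Int.floor_add_intCast]

lemma cell_eq : (1 : ℝ) / (b : ℝ) ^ a = ((b : ℕ) : ℤ) * (1 / (b : ℝ) ^ (a + 1)) := by
  have := pow_cast_pos (b := b) a
  have : (b : ℝ) ≠ 0 := by exact_mod_cast NeZero.ne b
  push_cast; rw [pow_succ]; field_simp

lemma periodic_digitMul (hp : Function.Periodic Φ (1 / (b : ℝ) ^ (a + 1))) :
    Function.Periodic (digitMul κ a Φ) (1 / (b : ℝ) ^ a) := by
  intro x
  have h : Φ (x + 1 / (b : ℝ) ^ a) = Φ x := by rw [cell_eq]; exact hp.int_mul _ x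
  simp only [digitMul]
  rw [h, floor_add_cell]
  simp

/-- All `b` values of the digit occur once in a cell of length `b^{-a}` and carry the same integral
of `Φ`, so nontrivial roots of unity cancel. This lets the lower-order Walsh factor pass outside the
primitive. -/
lemma prim_digitMul_cell (hκ : κ ≠ 0) (hm : IsBddMeas Φ)
    (hp : Function.Periodic Φ (1 / (b : ℝ) ^ (a + 1))) :
    prim (digitMul κ a Φ) (1 / (b : ℝ) ^ a) = 0 := by
  rw [cell_eq]
  have h := integral_step_whole (pow_cast_pos (b := b) (a + 1)) (exists_bound_chi κ) hp hm
    (S := fun n => prim Φ (1 / (b : ℝ) ^ (a + 1)) *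
      ((chi (κ * (n : ZMod b)) - 1) * (chi κ - 1)⁻¹)) (by simp) (chi_geom hκ _) (b : ℤ)
  unfold digitMul
  rw [h]
  simp

/-- Bounds for the periodic factor of the primitive of a Walsh function. -/
lemma peel (hb : 2 ≤ b) (hκ : κ ≠ 0) (hm : IsBddMeas Φ)
    (hp : Function.Periodic Φ (1 / (b : ℝ) ^ (a + 1)))
    (hmean : prim Φ (1 / (b : ℝ) ^ (a + 1)) = m * ((1 / (b : ℝ) ^ (a + 1) : ℝ) : ℂ))
    (hN : ∀ x, ‖Φ x - m‖ ≤ N) :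
    ∃ m' : ℂ, ‖m'‖ ≤ 1 / (b : ℝ) ^ (a + 1) * (sinConst b * ‖m‖) ∧
      (∀ x, ‖prim (digitMul κ a Φ) x - m'‖
        ≤ 1 / (b : ℝ) ^ (a + 1) * (sinConst b * ‖m‖ + N / 2)) ∧
      prim (prim (digitMul κ a Φ)) (1 / (b : ℝ) ^ a) = m' * ((1 / (b : ℝ) ^ a : ℝ) : ℂ) := by
  set M : ℝ := (b : ℝ) ^ (a + 1) with hM
  have hM0 : 0 < M := pow_cast_pos (a + 1)
  have hω := sub_ne_zero.mpr (chi_ne_one hκ)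
  have hinv := norm_inv_chi_sub_one_le hb hκ
  have hN0 : 0 ≤ N := (norm_nonneg _).trans (hN 0)
  -- On cell `n` the geometric sum is `A χ(κ n) - A`, so the primitive equals `-A + χ(κ n) r(x)`
  -- with `r` of period `1 / M`. The second term has mean zero over a full set of digits, which
  -- makes `-A` the new mean.
  set A : ℂ := m * ((1 / M : ℝ) : ℂ) * (chi κ - 1)⁻¹ with hA
  have hAn : ‖A‖ ≤ 1 / M * (sinConst b * ‖m‖) := by
    rw [hA, norm_mul, norm_mul, Complex.norm_real, Real.norm_of_nonneg (by positivity)]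
    calc ‖m‖ * (1 / M) * ‖(chi κ - 1)⁻¹‖ ≤ ‖m‖ * (1 / M) * sinConst b := by gcongr
      _ = _ := by ring
  set r : ℝ → ℂ := fun x => A + prim Φ (x - ⌊x * M⌋ * (1 / M)) with hr
  have hform : ∀ x, prim (digitMul κ a Φ) x - (-A) = chi (κ * ((⌊x * M⌋ : ℤ) : ZMod b)) * r x := by
    intro x
    have h := prim_step hM0 (exists_bound_chi κ) hp hm
      (S := fun n => prim Φ (1 / M) * ((chi (κ * (n : ZMod b)) - 1) * (chi κ - 1)⁻¹))
      (by simp) (chi_geom hκ _) x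
    unfold digitMul
    rw [h, hr, hmean, hA]
    ring
  have hdiff : IsBddMeas fun x => Φ x - m := hm.sub_const m
  have hdp : Function.Periodic (fun x => Φ x - m) (1 / M) := fun x => by simp only; rw [hp x]
  have hprimsub : ∀ y : ℝ, prim Φ y = m * (y : ℂ) + prim (fun x => Φ x - m) y := by
    intro y
    unfold prim
    rw [intervalIntegral.integral_sub (hm.intervalIntegrable _ _) (by simp)]
    simp [mul_comm]
  have hd0 : prim (fun x => Φ x - m) (1 / M) = 0 := by
    have := hprimsub (1 / M)
    rw [hmean] at this
    exact left_eq_add.mp this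
  have hrn : ∀ x, ‖r x‖ ≤ 1 / M * (sinConst b * ‖m‖ + N / 2) := by
    intro x
    set y : ℝ := x - ⌊x * M⌋ * (1 / M) with hy
    have hyM : y * M = Int.fract (x * M) := by
      rw [hy, sub_mul, Int.fract]; congr 1; field_simp
    -- Splitting `Φ` into mean and remainder: the mean part interpolates linearly between `A` and `A
    -- χ(κ)`, hence never exceeds `‖A‖`. The rest costs half a period times `N`.
    have e : r x = A * (1 + (chi κ - 1) * ((y * M : ℝ) : ℂ)) + prim (fun x => Φ x - m) y := by
      have hMc : (M : ℂ) ≠ 0 := by exact_mod_cast hM0.ne'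
      simp only [hr]
      rw [hprimsub y, hA]
      push_cast
      field_simp
      ring
    rw [e]
    refine (norm_add_le _ _).trans ?_
    rw [norm_mul, mul_add]
    refine add_le_add ?_ ?_
    · refine (mul_le_of_le_one_right (norm_nonneg _) ?_).trans hAn
      rw [hyM]
      exact norm_one_add_le (norm_chi _) (Int.fract_nonneg _) (Int.fract_lt_one _).le
    · have := norm_prim_sub_le_of_periodic hdiff (by positivity) hdp hd0 hN 0 y
      rw [prim_zero, sub_zero] at this
      linarith
  have hrm : IsBddMeas r := by
    refine ⟨?_, _, hrn⟩
    refine measurable_const.add (hm.continuous_prim.measurable.comp ?_)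
    exact measurable_id.sub ((measurable_from_top.comp
      (Int.measurable_floor.comp (measurable_id.mul_const M))).mul_const _)
  have hrp : Function.Periodic r (1 / M) := by
    intro x
    have e : (x + 1 / M) * M = x * M + 1 := by field_simp
    simp only [hr, e, Int.floor_add_one]
    congr 2
    push_cast; ring
  refine ⟨-A, by rwa [norm_neg], fun x => ?_, ?_⟩
  · rw [hform, norm_mul, norm_chi, one_mul]; exact hrn x
  · have h := integral_step_whole hM0 (exists_bound_chi κ) hrp hrm
      (S := fun n => prim r (1 / M) * ((chi (κ * (n : ZMod b)) - 1) * (chi κ - 1)⁻¹))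
      (by simp) (chi_geom hκ _) (b : ℤ)
    rw [← cell_eq] at h
    have h2 : prim (fun t => chi (κ * ((⌊t * M⌋ : ℤ) : ZMod b)) * r t) (1 / (b : ℝ) ^ a) = 0 := by
      rw [h]; simp
    simp only [← hform] at h2
    have hg : Continuous (prim (digitMul κ a Φ)) := (isBddMeas_digitMul hm).continuous_prim
    rw [prim, intervalIntegral.integral_sub (hg.intervalIntegrable _ _) (by simp)] at h2
    rw [prim, sub_eq_zero.mp h2]
    simp [mul_comm]

end chi

/-! ### Walsh functions -/

section walsh
variable {b : ℕ} [NeZero b]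

/-- The `k`-th Walsh function in base `b`, extended periodically to the real line. -/
def walsh (b : ℕ) [NeZero b] (k : ℕ) (x : ℝ) : ℂ :=
  chi (∑ i ∈ Finset.range k,
    (natDigit b k i : ZMod b) * ((⌊x * (b : ℝ) ^ (i + 1)⌋ : ℤ) : ZMod b))

lemma natDigit_of_lt {b k i : ℕ} (h : k < b ^ i) : natDigit b k i = 0 := by
  simp [natDigit, Nat.div_eq_of_lt h]

omit [NeZero b] in
lemma sum_natDigit_mul (hb : 2 ≤ b) {k l : ℕ} (h : k < b ^ l) (f : ℕ → ZMod b) :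
    ∑ i ∈ Finset.range k, (natDigit b k i : ZMod b) * f i
      = ∑ i ∈ Finset.range l, (natDigit b k i : ZMod b) * f i := by
  have key : ∀ n n' : ℕ, n ≤ n' → k < b ^ n →
      ∑ i ∈ Finset.range n, (natDigit b k i : ZMod b) * f i
        = ∑ i ∈ Finset.range n', (natDigit b k i : ZMod b) * f i := by
    intro n n' hn hk
    apply Finset.sum_subset (Finset.range_mono hn)
    intro i _ hi
    rw [natDigit_of_lt (hk.trans_le (Nat.pow_le_pow_right (by omega) (by simpa using hi)))]
    simp
  have hk : k < b ^ k := Nat.lt_pow_self (by omega)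
  rcases le_total k l with h' | h'
  · exact key k l h' hk
  · exact (key l k h' h).symm

lemma walsh_eq (hb : 2 ≤ b) {k l : ℕ} (h : k < b ^ l) (x : ℝ) :
    walsh b k x = chi (∑ i ∈ Finset.range l,
      (natDigit b k i : ZMod b) * ((⌊x * (b : ℝ) ^ (i + 1)⌋ : ℤ) : ZMod b)) := by
  rw [walsh, sum_natDigit_mul hb h (fun i => ((⌊x * (b : ℝ) ^ (i + 1)⌋ : ℤ) : ZMod b))]

lemma walsh_zero (x : ℝ) : walsh b 0 x = 1 := by simp [walsh]

lemma norm_walsh (k : ℕ) (x : ℝ) : ‖walsh b k x‖ = 1 := norm_chi _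

lemma natDigit_peel_lt {κ K a i : ℕ} (hi : i < a) :
    natDigit b (κ * b ^ a + K) i = natDigit b K i := by
  obtain ⟨d, rfl⟩ := Nat.exists_eq_add_of_lt hi
  have hpos : 0 < b ^ i := pow_pos (NeZero.pos b) i
  have e : κ * b ^ (i + d + 1) + K = K + b ^ i * (b * (κ * b ^ d)) := by ring
  rw [natDigit, natDigit, e, Nat.add_mul_div_left _ _ hpos, Nat.add_mul_mod_self_left]

lemma natDigit_peel_eq {κ K a : ℕ} (hκ : κ < b) (hK : K < b ^ a) :
    natDigit b (κ * b ^ a + K) a = κ := by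
  have hpos : 0 < b ^ a := pow_pos (NeZero.pos b) a
  rw [natDigit, add_comm, Nat.add_mul_div_right _ _ hpos, Nat.div_eq_of_lt hK, zero_add,
    Nat.mod_eq_of_lt hκ]

omit [NeZero b] in
lemma peel_lt {κ K a : ℕ} (hκ : κ < b) (hK : K < b ^ a) : κ * b ^ a + K < b ^ (a + 1) := by
  have : (κ + 1) * b ^ a ≤ b * b ^ a := Nat.mul_le_mul_right _ hκ
  rw [pow_succ']
  linarith [add_mul κ 1 (b ^ a)]

lemma walsh_peel (hb : 2 ≤ b) {κ K a : ℕ} (hκ : κ < b) (hK : K < b ^ a) (x : ℝ) :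
    walsh b (κ * b ^ a + K) x
      = walsh b K x * chi ((κ : ZMod b) * ((⌊x * (b : ℝ) ^ (a + 1)⌋ : ℤ) : ZMod b)) := by
  rw [walsh_eq hb (peel_lt hκ hK), walsh_eq hb hK, Finset.sum_range_succ, natDigit_peel_eq hκ hK,
    chi_add]
  congr 2
  refine Finset.sum_congr rfl fun i hi => ?_
  rw [natDigit_peel_lt (Finset.mem_range.mp hi)]

/-- Only the first `a` digits of `x` enter, and these are recovered from `⌊x b^a⌋` by integer
division. -/
lemma walsh_step (hb : 2 ≤ b) {K a : ℕ} (hK : K < b ^ a) :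
    ∃ s : ℤ → ℂ, (∀ n, ‖s n‖ ≤ 1) ∧ ∀ x, walsh b K x = s ⌊x * (b : ℝ) ^ a⌋ := by
  refine ⟨fun n => chi (∑ i ∈ Finset.range a,
    (natDigit b K i : ZMod b) * ((n / ((b ^ (a - 1 - i) : ℕ) : ℤ) : ℤ) : ZMod b)),
    fun n => (norm_chi _).le, fun x => ?_⟩
  rw [walsh_eq hb hK]
  congr 1
  refine Finset.sum_congr rfl fun i hi => ?_
  have hi' := Finset.mem_range.mp hi
  rw [← Int.floor_div_natCast]
  congr 2
  have hb0 : (b : ℝ) ≠ 0 := by exact_mod_cast NeZero.ne b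
  obtain ⟨d, rfl⟩ := Nat.exists_eq_add_of_lt hi'
  rw [show i + d + 1 - 1 - i = d by omega, Nat.cast_pow]
  congr 1
  rw [eq_div_iff (pow_ne_zero _ hb0)]
  ring

lemma isBddMeas_walsh (hb : 2 ≤ b) (K : ℕ) : IsBddMeas (walsh b K) := by
  obtain ⟨s, -, hs⟩ := walsh_step hb (K := K) (a := K) (Nat.lt_pow_self (by omega))
  refine ⟨?_, 1, fun x => (norm_walsh K x).le⟩
  rw [funext hs]
  exact measurable_step s _

/-! ### The leading digit and `μ_α` -/

omit [NeZero b] in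
lemma exists_peel (hb : 2 ≤ b) {K : ℕ} (hK : K ≠ 0) :
    ∃ κ K' a : ℕ, 0 < κ ∧ κ < b ∧ K' < b ^ a ∧ K = κ * b ^ a + K' := by
  refine ⟨K / b ^ Nat.log b K, K % b ^ Nat.log b K, Nat.log b K, ?_, ?_, ?_, ?_⟩
  · exact Nat.div_pos (Nat.pow_log_le_self b hK) (pow_pos (by omega) _)
  · rw [Nat.div_lt_iff_lt_mul (pow_pos (by omega) _), ← pow_succ']
    exact Nat.lt_pow_succ_log_self (by omega) K
  · exact Nat.mod_lt _ (pow_pos (by omega) _)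
  · exact (Nat.div_add_mod' K _).symm

omit [NeZero b] in
lemma lt_of_mem_digitPositions {K a p : ℕ} (hb : 2 ≤ b) (hK : K < b ^ a)
    (hp : p ∈ digitPositions b K) : p ≤ a := by
  rw [digitPositions, Finset.mem_filter, Finset.mem_Icc] at hp
  by_contra h
  exact hp.2 (natDigit_of_lt (hK.trans_le (Nat.pow_le_pow_right (by omega) (by omega))))

lemma digitPositions_peel (hb : 2 ≤ b) {κ K a : ℕ} (hκ0 : 0 < κ) (hκ : κ < b) (hK : K < b ^ a) :
    digitPositions b (κ * b ^ a + K) = insert (a + 1) (digitPositions b K) := by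
  have hself : ∀ k i : ℕ, natDigit b k i ≠ 0 → i < k := by
    intro k i h
    by_contra h'
    exact h (natDigit_of_lt ((Nat.lt_pow_self (by omega : 1 < b)).trans_le
      (Nat.pow_le_pow_right (by omega) (not_lt.mp h'))))
  have mem : ∀ k p : ℕ, p ∈ digitPositions b k ↔ 1 ≤ p ∧ natDigit b k (p - 1) ≠ 0 := by
    intro k p
    rw [digitPositions, Finset.mem_filter, Finset.mem_Icc]
    constructor
    · rintro ⟨⟨h1, h2⟩, h3⟩; exact ⟨h1, h3⟩
    · rintro ⟨h1, h3⟩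
      have := hself _ _ h3
      exact ⟨⟨h1, by omega⟩, h3⟩
  ext p
  rw [Finset.mem_insert, mem, mem]
  rcases lt_trichotomy (p - 1) a with h | h | h
  · rw [natDigit_peel_lt h]
    constructor
    · exact fun h' => Or.inr h'
    · rintro (rfl | h')
      · simp at h
      · exact h'
  · rcases Nat.eq_zero_or_pos p with rfl | hp
    · simp
    · rw [h, natDigit_peel_eq hκ hK]
      constructor
      · intro _; left; omega
      · intro _; exact ⟨hp, hκ0.ne'⟩
  · rw [natDigit_of_lt ((peel_lt hκ hK).trans_le (Nat.pow_le_pow_right (by omega) h)),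
      natDigit_of_lt (hK.trans_le (Nat.pow_le_pow_right (by omega) h.le))]
    constructor
    · rintro ⟨_, h'⟩; exact absurd rfl h'
    · rintro (rfl | ⟨_, h'⟩)
      · simp at h
      · exact absurd rfl h'

omit [NeZero b] in
lemma succ_notMem_digitPositions (hb : 2 ≤ b) {K a : ℕ} (hK : K < b ^ a) :
    a + 1 ∉ digitPositions b K := fun h => by
  have := lt_of_mem_digitPositions hb hK h
  omega

/-- The leading position `a + 1` heads the decreasing list and uses up one of the `n + 1` entries
kept. This matches one primitive removing one digit. -/
lemma mu_peel (hb : 2 ≤ b) {κ K a : ℕ} (hκ0 : 0 < κ) (hκ : κ < b) (hK : K < b ^ a) (n : ℕ) :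
    mu (n + 1) b (κ * b ^ a + K) = (a + 1) + mu n b K := by
  rw [mu, digitPositions_peel hb hκ0 hκ hK, Finset.sort_insert, List.take_succ_cons, List.sum_cons,
    mu]
  · intro p hp
    have := lt_of_mem_digitPositions hb hK hp
    omega
  · exact succ_notMem_digitPositions hb hK

lemma card_digitPositions_peel (hb : 2 ≤ b) {κ K a : ℕ} (hκ0 : 0 < κ) (hκ : κ < b)
    (hK : K < b ^ a) :
    (digitPositions b (κ * b ^ a + K)).card = (digitPositions b K).card + 1 := by
  rw [digitPositions_peel hb hκ0 hκ hK, Finset.card_insert_of_notMem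
    (succ_notMem_digitPositions hb hK)]

omit [NeZero b] in
@[simp] lemma mu_zero_left (k : ℕ) : mu 0 b k = 0 := by simp [mu]

omit [NeZero b] in
@[simp] lemma digitPositions_zero : digitPositions b 0 = ∅ := by simp [digitPositions]

omit [NeZero b] in
@[simp] lemma mu_zero_right (n : ℕ) : mu n b 0 = 0 := by simp [mu]

/-! ### Iterated primitives -/

/-- `Chain n f B`: splitting off constants and taking primitives `n` times, starting with `f`, the
absolute values of the constants and a bound for the last remainder add up to at most `B`. -/
inductive Chain : ℕ → (ℝ → ℂ) → ℝ → Prop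
  | zero (f w : ℝ → ℂ) (c : ℂ) (d B : ℝ) (hf : ∀ x, f x = c + w x) (hw : Measurable w)
      (hd : ∀ x, ‖w x‖ ≤ d) (hB : ‖c‖ + d ≤ B) : Chain 0 f B
  | succ (n : ℕ) (f w : ℝ → ℂ) (c : ℂ) (B' B : ℝ) (hf : ∀ x, f x = c + w x) (hw : IsBddMeas w)
      (h0 : prim w 1 = 0) (hc : Chain n (prim w) B') (hB : ‖c‖ + B' ≤ B) : Chain (n + 1) f B

lemma Chain.mono {n : ℕ} {f : ℝ → ℂ} {B B' : ℝ} (h : Chain n f B) (hB : B ≤ B') :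
    Chain n f B' := by
  cases h with
  | zero _ w c d _ hf hw hd h => exact .zero f w c d B' hf hw hd (h.trans hB)
  | succ n _ w c B₁ _ hf hw h0 hc h => exact .succ n f w c B₁ B' hf hw h0 hc (h.trans hB)

lemma Chain.const_add {n : ℕ} {f : ℝ → ℂ} {B : ℝ} (h : Chain n f B) (e : ℂ) :
    Chain n (fun x => e + f x) (‖e‖ + B) := by
  cases h with
  | zero _ w c d _ hf hw hd h =>
    refine .zero _ w (e + c) d _ (fun x => by rw [hf, add_assoc]) hw hd ?_
    linarith [norm_add_le e c]
  | succ n _ w c B₁ _ hf hw h0 hc h =>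
    refine .succ n _ w (e + c) B₁ _ (fun x => by rw [hf, add_assoc]) hw h0 hc ?_
    linarith [norm_add_le e c]

/-- The primitive oscillates by at most `N / 2`, so both its mean and its distance from the mean are
at most `N / 2`. Inductively the constant and the remaining chain share the budget `N`, which
therefore does not grow with `n`. -/
lemma chain_of_periodic (n : ℕ) {w : ℝ → ℂ} {N : ℝ} (hw : IsBddMeas w)
    (hp : Function.Periodic w 1) (h0 : prim w 1 = 0) (hN : ∀ x, ‖w x‖ ≤ N) : Chain n w N := by
  induction n generalizing w N with
  | zero => exact .zero w w 0 N N (fun x => by simp) hw.1 hN (by simp)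
  | succ n ih =>
    have hosc : ∀ x y, ‖prim w y - prim w x‖ ≤ N / 2 := fun x y => by
      simpa using norm_prim_sub_le_of_periodic hw one_pos hp h0 hN x y
    have hP : IsBddMeas (prim w) := isBddMeas_prim hw one_pos hp h0
    set c : ℂ := prim (prim w) 1 with hc
    have hc' : ‖c‖ ≤ N / 2 := by
      rw [hc, prim]
      refine (intervalIntegral.norm_integral_le_of_norm_le_const (C := N / 2)
        fun t _ => ?_).trans (by simp)
      simpa [prim_zero] using hosc 0 t
    have hw' : IsBddMeas fun x => prim w x - c := hP.sub_const c
    refine .succ n w w 0 N N (fun x => by simp) hw h0 ?_ (by simp)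
    have h := (ih hw' (fun x => by
      show prim w (x + 1) - c = prim w x - c
      rw [prim_periodic hw hp h0 x]) (by
      rw [prim, intervalIntegral.integral_sub (hP.intervalIntegrable _ _) (by simp)]
      simp [hc, prim]) (N := N / 2) (fun x => by
      have e : prim w x - c = ∫ t in (0 : ℝ)..1, (prim w x - prim w t) := by
        rw [intervalIntegral.integral_sub (by simp) (hP.intervalIntegrable _ _)]
        simp [hc, prim]
      rw [e]
      exact (intervalIntegral.norm_integral_le_of_norm_le_const (C := N / 2)
        fun t _ => hosc t x).trans (by simp))).const_add c
    simp only [add_sub_cancel] at h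
    exact h.mono (by linarith)

/-! ### Iterated primitives of Walsh functions -/

/-- The accumulated bound for the oscillation after removing `ρ` digits. -/
def oscBound (b : ℕ) : ℕ → ℝ
  | 0 => 0
  | ρ + 1 => sinConst b * oscBound b ρ + sinConst b / 2 ^ ρ

omit [NeZero b] in
lemma oscBound_nonneg (hb : 2 ≤ b) (ρ : ℕ) : 0 ≤ oscBound b ρ := by
  have := sinConst_pos hb
  induction ρ with
  | zero => exact le_rfl
  | succ ρ ih => rw [oscBound]; positivity

/-- The total weight for a Walsh function with `ρ` digits times a function with mean `m` and
oscillation `N`. -/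
def chainBound (b ρ : ℕ) (m N : ℝ) : ℝ := (sinConst b ^ ρ + oscBound b ρ) * m + N / 2 ^ ρ

omit [NeZero b] in
-- `chainBound` is built to be consistent with the updates of mean and oscillation in `peel`; `q`
-- stands for the gained factor `b^{-(a+1)}`.
lemma chainBound_succ (ρ : ℕ) (q m N : ℝ) :
    chainBound b ρ (q * (sinConst b * m)) (q * (sinConst b * m + N / 2))
      = q * chainBound b (ρ + 1) m N := by
  unfold chainBound
  rw [oscBound, pow_succ, pow_succ]
  field_simp
  ring

omit [NeZero b] in
lemma one_div_pow_mul_chainBound (a l ρ : ℕ) (m N : ℝ) :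
    (1 / (b : ℝ)) ^ l * chainBound b ρ (1 / (b : ℝ) ^ (a + 1) * (sinConst b * m))
        (1 / (b : ℝ) ^ (a + 1) * (sinConst b * m + N / 2))
      = (1 / (b : ℝ)) ^ (a + 1 + l) * chainBound b (ρ + 1) m N := by
  rw [chainBound_succ, pow_add _ (a + 1) l, one_div_pow (b : ℝ) (a + 1)]
  ring

omit [NeZero b] in
lemma chainBound_mono (hb : 2 ≤ b) {m m' : ℝ} (h : m ≤ m') (ρ : ℕ) (N : ℝ) :
    chainBound b ρ m N ≤ chainBound b ρ m' N := by
  have hS := sinConst_pos hb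
  have hO := oscBound_nonneg hb ρ
  unfold chainBound
  gcongr

lemma prim_periodic_nat_mul {p : ℝ → ℂ} {ℓ : ℝ} {m : ℂ} (hℓ : 0 < ℓ) (hp : Function.Periodic p ℓ)
    (hpm : IsBddMeas p) (h : prim p ℓ = m * (ℓ : ℂ)) (n : ℕ) :
    prim p (n * ℓ) = m * ((n * ℓ : ℝ) : ℂ) := by
  have h' := integral_step_whole (M := 1 / ℓ) (by positivity) (s := fun _ => 1)
    ⟨1, fun _ => by simp⟩ (p := p) (by simpa using hp) hpm (S := fun n => n * (m * ℓ)) (by simp)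
    (fun n => by rw [one_div_one_div, h]; push_cast; ring) n
  simp only [one_mul, one_div_one_div, Int.cast_natCast] at h'
  rw [show prim p (n * ℓ) = prim (fun t => p t) (n * ℓ) from rfl, h']
  push_cast; ring

lemma periodic_of_le {a a' : ℕ} (h : a' ≤ a) :
    (1 : ℝ) / (b : ℝ) ^ a' = ((b ^ (a - a') : ℕ) : ℝ) * (1 / (b : ℝ) ^ a) := by
  have hb0 : (b : ℝ) ≠ 0 := by exact_mod_cast NeZero.ne b
  obtain ⟨d, rfl⟩ := Nat.exists_eq_add_of_le h
  rw [add_tsub_cancel_left, pow_add]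
  push_cast
  field_simp

/-- The factor `wal_K` is constant on cells of length `b^{-a}`, and the remaining factor is periodic
with mean zero on them. Taking a primitive thus preserves the form "Walsh function times periodic
function" with one digit fewer. -/
lemma prim_walsh_mul (hb : 2 ≤ b) {κ K a : ℕ} (hκ0 : 0 < κ) (hκ : κ < b) (hK : K < b ^ a)
    {Φ : ℝ → ℂ} (hm : IsBddMeas Φ) (hp : Function.Periodic Φ (1 / (b : ℝ) ^ (a + 1))) (x : ℝ) :
    prim (fun t => walsh b (κ * b ^ a + K) t * Φ t) x
      = walsh b K x * prim (digitMul (κ : ZMod b) a Φ) x := by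
  have hκ' : (κ : ZMod b) ≠ 0 := by
    rw [Ne, ZMod.natCast_eq_zero_iff]
    exact Nat.not_dvd_of_pos_of_lt hκ0 hκ
  obtain ⟨s, hs1, hs⟩ := walsh_step hb hK
  have e : (fun t => walsh b (κ * b ^ a + K) t * Φ t)
      = fun t => s ⌊t * (b : ℝ) ^ a⌋ * digitMul (κ : ZMod b) a Φ t := by
    funext t
    rw [walsh_peel hb hκ hK, hs, digitMul, mul_assoc]
  rw [e, prim_step_of_mean_zero (pow_cast_pos a) ⟨1, hs1⟩ (periodic_digitMul hp)
    (isBddMeas_digitMul hm) (prim_digitMul_cell hκ' hm hp), hs]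

lemma prim_walsh_mul_one (hb : 2 ≤ b) {κ K a : ℕ} (hκ0 : 0 < κ) (hκ : κ < b) (hK : K < b ^ a)
    {Φ : ℝ → ℂ} (hm : IsBddMeas Φ) (hp : Function.Periodic Φ (1 / (b : ℝ) ^ (a + 1))) :
    prim (fun t => walsh b (κ * b ^ a + K) t * Φ t) 1 = 0 := by
  have hκ' : (κ : ZMod b) ≠ 0 := by
    rw [Ne, ZMod.natCast_eq_zero_iff]
    exact Nat.not_dvd_of_pos_of_lt hκ0 hκ
  have hP := prim_periodic (isBddMeas_digitMul (κ := (κ : ZMod b)) hm) (periodic_digitMul hp)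
    (prim_digitMul_cell hκ' hm hp)
  have h1 := hP.nat_mul_eq (b ^ a)
  have e : ((b ^ a : ℕ) : ℝ) * (1 / (b : ℝ) ^ a) = 1 := by
    have := pow_cast_pos (b := b) a
    push_cast; field_simp
  rw [prim_walsh_mul hb hκ0 hκ hK hm hp]
  rw [e, prim_zero] at h1
  rw [h1, mul_zero]

/-- Each step strips the leading digit of `K` and replaces `Φ` by its peeled primitive. At `K = 0`
only `Φ` is left, and its mean and mean-zero part are handled by `chain_of_periodic`. -/
lemma chain_walsh_mul (hb : 2 ≤ b) (n : ℕ) {K a : ℕ} (hK : K < b ^ a) {Φ : ℝ → ℂ} {m : ℂ} {N : ℝ}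
    (hm : IsBddMeas Φ) (hp : Function.Periodic Φ (1 / (b : ℝ) ^ a))
    (hmean : prim Φ (1 / (b : ℝ) ^ a) = m * ((1 / (b : ℝ) ^ a : ℝ) : ℂ))
    (hN : ∀ x, ‖Φ x - m‖ ≤ N) :
    Chain n (fun x => walsh b K x * Φ x)
      ((1 / (b : ℝ)) ^ mu n b K * chainBound b (min n (digitPositions b K).card) ‖m‖ N) := by
  have hpos : ∀ j : ℕ, 0 < 1 / (b : ℝ) ^ j := fun j => one_div_pos.mpr (pow_cast_pos j)
  induction n generalizing K a Φ m N with
  | zero =>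
    refine .zero _ (fun x => walsh b K x * Φ x) 0 (‖m‖ + N) _ (fun x => by simp)
      ((isBddMeas_walsh hb K).mul hm).1 (fun x => ?_) ?_
    · rw [norm_mul, norm_walsh, one_mul, ← add_sub_cancel m (Φ x)]
      exact (norm_add_le _ _).trans (by gcongr; simpa using hN x)
    · simp [chainBound, oscBound]
  | succ n ih =>
    rcases eq_or_ne K 0 with rfl | hK0
    · have h1 := prim_periodic_nat_mul (hpos a) hp hm hmean (b ^ a)
      have hp1 := hp.nat_mul (b ^ a)
      have e : ((b ^ a : ℕ) : ℝ) * (1 / (b : ℝ) ^ a) = 1 := by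
        have := pow_cast_pos (b := b) a
        push_cast; field_simp
      rw [e] at h1 hp1
      have h := (chain_of_periodic (n + 1) (hm.sub_const m) (fun x => by
        show Φ (x + 1) - m = Φ x - m
        rw [hp1 x])
        (by
          rw [prim, intervalIntegral.integral_sub (hm.intervalIntegrable _ _) (by simp)]
          rw [prim] at h1
          simp [h1]) hN).const_add m
      simp only [add_sub_cancel] at h
      simpa [walsh_zero, chainBound, oscBound] using h
    · obtain ⟨κ, K', a', hκ0, hκ, hK', rfl⟩ := exists_peel hb hK0
      -- The leading digit may sit below position `a`. The period of `Φ` is then coarsened to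
      -- `b^{-(a'+1)}`, so that the gain matches the true position.
      have haa : a' + 1 ≤ a := by
        have : b ^ a' < b ^ a := by
          refine lt_of_le_of_lt ?_ hK
          nlinarith [pow_pos (NeZero.pos b) a']
        exact (Nat.pow_lt_pow_iff_right (by omega)).mp this
      have hp' : Function.Periodic Φ (1 / (b : ℝ) ^ (a' + 1)) := by
        rw [periodic_of_le haa]; exact hp.nat_mul _
      have hmean' : prim Φ (1 / (b : ℝ) ^ (a' + 1)) = m * ((1 / (b : ℝ) ^ (a' + 1) : ℝ) : ℂ) := by
        rw [periodic_of_le haa]; exact prim_periodic_nat_mul (hpos a) hp hm hmean _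
      have hκ' : (κ : ZMod b) ≠ 0 := by
        rw [Ne, ZMod.natCast_eq_zero_iff]
        exact Nat.not_dvd_of_pos_of_lt hκ0 hκ
      obtain ⟨m', hm', hN', hmm⟩ := peel hb hκ' hm hp' hmean' hN
      have hdm : IsBddMeas (digitMul (κ : ZMod b) a' Φ) := isBddMeas_digitMul hm
      have hdp := periodic_digitMul (κ := (κ : ZMod b)) hp'
      have hd0 := prim_digitMul_cell hκ' hm hp'
      have hc := ih hK' (isBddMeas_prim hdm (hpos a') hdp hd0) (prim_periodic hdm hdp hd0) hmm hN'
      rw [← funext (prim_walsh_mul hb hκ0 hκ hK' hm hp')] at hc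
      -- As long as a digit is left the product already has mean zero, so the constant split off is
      -- `0`.
      refine .succ n _ (fun x => walsh b (κ * b ^ a' + K') x * Φ x) 0 _ _ (fun x => by simp)
        ((isBddMeas_walsh hb _).mul hm) (prim_walsh_mul_one hb hκ0 hκ hK' hm hp') hc ?_
      rw [norm_zero, zero_add, mu_peel hb hκ0 hκ hK', card_digitPositions_peel hb hκ0 hκ hK',
        Nat.add_min_add_right, ← one_div_pow_mul_chainBound]
      gcongr
      exact chainBound_mono hb hm' _ _

lemma prim_walsh (hb : 2 ≤ b) {k : ℕ} (hk : k ≠ 0) : prim (walsh b k) 1 = 0 := by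
  obtain ⟨κ, K', a, hκ0, hκ, hK', rfl⟩ := exists_peel hb hk
  simpa using prim_walsh_mul_one hb hκ0 hκ hK' (isBddMeas_const 1) (fun _ => rfl)

/-- The first primitive is taken outside the chain, starting from `Φ = 1` with mean `1` and
oscillation `0`. Hence `n` further primitives go with `μ_{n+1}`. -/
lemma chain_prim_walsh (hb : 2 ≤ b) {k : ℕ} (hk : k ≠ 0) (n : ℕ) :
    Chain n (prim (walsh b k)) ((1 / (b : ℝ)) ^ mu (n + 1) b k *
      chainBound b (min (n + 1) (digitPositions b k).card) 1 0) := by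
  obtain ⟨κ, K', a', hκ0, hκ, hK', rfl⟩ := exists_peel hb hk
  have hκ' : (κ : ZMod b) ≠ 0 := by
    rw [Ne, ZMod.natCast_eq_zero_iff]
    exact Nat.not_dvd_of_pos_of_lt hκ0 hκ
  have hm : IsBddMeas fun _ : ℝ => (1 : ℂ) := isBddMeas_const 1
  have hp' : Function.Periodic (fun _ : ℝ => (1 : ℂ)) (1 / (b : ℝ) ^ (a' + 1)) := fun _ => rfl
  obtain ⟨m', hm', hN', hmm⟩ := peel (m := 1) (N := 0) hb hκ' hm hp' (by simp [prim]) (by simp)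
  have hdm : IsBddMeas (digitMul (κ : ZMod b) a' fun _ => 1) := isBddMeas_digitMul hm
  have hdp := periodic_digitMul (κ := (κ : ZMod b)) hp'
  have hd0 := prim_digitMul_cell hκ' hm hp'
  have hc := chain_walsh_mul hb n hK' (isBddMeas_prim hdm (one_div_pos.mpr (pow_cast_pos a')) hdp hd0)
    (prim_periodic hdm hdp hd0) hmm hN'
  rw [← funext (prim_walsh_mul hb hκ0 hκ hK' hm hp')] at hc
  simp only [mul_one] at hc
  refine hc.mono ?_
  rw [mu_peel hb hκ0 hκ hK', card_digitPositions_peel hb hκ0 hκ hK',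
    Nat.add_min_add_right, ← one_div_pow_mul_chainBound]
  rw [norm_one] at hm' ⊢
  gcongr
  exact chainBound_mono hb hm' _ _

end walsh

/-! ### Comparison with the constant `C_{α,b}` -/

/-- Solves the recursion using `1 / 2 = sinConst b * sin (π / b)`, so that each halving turns into a
power of the sine. -/
lemma oscBound_eq {b : ℕ} (hb : 2 ≤ b) (ρ : ℕ) :
    oscBound b ρ = sinConst b ^ ρ * ∑ j ∈ Finset.range ρ, Real.sin (Real.pi / b) ^ j := by
  have hs := sin_pi_div_pos hb
  have h : sinConst b * (2 * Real.sin (Real.pi / b)) = 1 := by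
    unfold sinConst; field_simp
  induction ρ with
  | zero => simp [oscBound]
  | succ ρ ih =>
    rw [oscBound, ih, Finset.sum_range_succ, pow_succ, mul_add, mul_assoc, mul_assoc,
      mul_left_comm (sinConst b ^ ρ)]
    congr 1
    have h2 : sinConst b ^ ρ * Real.sin (Real.pi / b) ^ ρ = 1 / 2 ^ ρ := by
      rw [← mul_pow, ← one_div_pow]
      congr 1
      linarith
    rw [mul_left_comm, h2]
    ring

lemma le_fold_max {α ρ : ℕ} (hρ : 1 ≤ ρ) (hρα : ρ ≤ α) {t : ℝ} (ht : 0 < t) :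
    (1 / t) ^ ρ ≤ (Finset.Icc 1 (α - 1)).fold max (2 / t ^ α) (fun z => 1 / t ^ z) := by
  rw [Finset.le_fold_max, one_div_pow]
  rcases hρα.eq_or_lt with rfl | h
  · left
    gcongr
    norm_num
  · right
    exact ⟨ρ, Finset.mem_Icc.mpr ⟨hρ, by omega⟩, le_rfl⟩

/-- The last factor of `C_{α,b}` is at least `5`, and Bernoulli bounds the power below by `1 + (α -
2) / b`. -/
lemma one_add_sum_sin_pow_le {α b ρ : ℕ} (hb : 2 ≤ b) (hα : 2 ≤ α) (hρα : ρ ≤ α) :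
    1 + ∑ j ∈ Finset.range ρ, Real.sin (Real.pi / b) ^ j
      ≤ (1 + 1 / (b : ℝ) + 1 / ((b : ℝ) * ((b : ℝ) + 1))) ^ (α - 2)
        * (3 + 2 / (b : ℝ) + (2 * (b : ℝ) + 1) / ((b : ℝ) - 1)) := by
  have hs := sin_pi_div_pos hb
  have hb' : (2 : ℝ) ≤ b := by exact_mod_cast hb
  have h5 : (5 : ℝ) ≤ 3 + 2 / (b : ℝ) + (2 * (b : ℝ) + 1) / ((b : ℝ) - 1) := by
    have h1 : 0 ≤ 2 / (b : ℝ) := by positivity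
    have h2 : 2 ≤ (2 * (b : ℝ) + 1) / ((b : ℝ) - 1) := by
      rw [le_div_iff₀ (by linarith)]; linarith
    linarith
  have hge : 1 + 1 / (b : ℝ) ≤ 1 + 1 / (b : ℝ) + 1 / ((b : ℝ) * ((b : ℝ) + 1)) := by
    have : 0 ≤ 1 / ((b : ℝ) * ((b : ℝ) + 1)) := by positivity
    linarith
  have hbern : 1 + ((α - 2 : ℕ) : ℝ) * (1 / (b : ℝ))
      ≤ (1 + 1 / (b : ℝ) + 1 / ((b : ℝ) * ((b : ℝ) + 1))) ^ (α - 2) := by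
    refine (one_add_mul_le_pow (a := 1 / (b : ℝ)) ?_ _).trans (by gcongr)
    have : 0 ≤ 1 / (b : ℝ) := by positivity
    linarith
  have hmul : (1 + ((α - 2 : ℕ) : ℝ) * (1 / (b : ℝ))) * 5
      ≤ (1 + 1 / (b : ℝ) + 1 / ((b : ℝ) * ((b : ℝ) + 1))) ^ (α - 2)
        * (3 + 2 / (b : ℝ) + (2 * (b : ℝ) + 1) / ((b : ℝ) - 1)) := by
    gcongr
  refine le_trans ?_ hmul
  -- For `b ≤ 5` the sines are bounded by `1`, and `5 (1 + (α - 2) / b) ≥ α + 3` absorbs the `ρ`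
  -- terms. For `b ≥ 5` one has `sin (π / b) ≤ π / 5 < 3 / 4`, and the geometric series is at most
  -- `4`.
  rcases le_total b 5 with h | h
  · have h' : (b : ℝ) ≤ 5 := by exact_mod_cast h
    have hsum : ∑ j ∈ Finset.range ρ, Real.sin (Real.pi / b) ^ j ≤ ρ := by
      refine (Finset.sum_le_card_nsmul _ _ 1 fun j _ =>
        pow_le_one₀ hs.le (Real.sin_le_one _)).trans (by simp)
    have hρ' : (ρ : ℝ) ≤ ((α - 2 : ℕ) : ℝ) + 2 := by
      exact_mod_cast (by omega : ρ ≤ (α - 2) + 2)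
    have hinv : 1 ≤ 1 / (b : ℝ) * 5 := by
      rw [one_div_mul_eq_div, le_div_iff₀ (by linarith)]; linarith
    have h0 : (0 : ℝ) ≤ ((α - 2 : ℕ) : ℝ) := Nat.cast_nonneg _
    nlinarith
  · have h' : (5 : ℝ) ≤ b := by exact_mod_cast h
    have hsin : Real.sin (Real.pi / b) ≤ 3 / 4 := by
      refine (Real.sin_le (by positivity)).trans ?_
      rw [div_le_div_iff₀ (by linarith) (by norm_num)]
      nlinarith [Real.pi_lt_d2]
    have hsum : ∑ j ∈ Finset.range ρ, Real.sin (Real.pi / b) ^ j ≤ 4 := by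
      calc ∑ j ∈ Finset.range ρ, Real.sin (Real.pi / b) ^ j
          ≤ ∑ j ∈ Finset.range ρ, (3 / 4 : ℝ) ^ j := by gcongr
        _ = (1 - (3 / 4 : ℝ) ^ ρ) * 4 := by
          rw [geom_sum_eq (by norm_num)]; ring
        _ ≤ 4 := by
          have : (0 : ℝ) ≤ (3 / 4) ^ ρ := by positivity
          linarith
    have : 0 ≤ ((α - 2 : ℕ) : ℝ) * (1 / (b : ℝ)) := by positivity
    linarith

lemma chainBound_le_walshConst {α b ρ : ℕ} (hb : 2 ≤ b) (hα : 2 ≤ α) (hρ : 1 ≤ ρ) (hρα : ρ ≤ α) :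
    chainBound b ρ 1 0 ≤ walshConst α b := by
  have hs := sin_pi_div_pos hb
  have e : chainBound b ρ 1 0
      = sinConst b ^ ρ * (1 + ∑ j ∈ Finset.range ρ, Real.sin (Real.pi / b) ^ j) := by
    rw [chainBound, oscBound_eq hb]; ring
  have h0 : 0 ≤ 1 + ∑ j ∈ Finset.range ρ, Real.sin (Real.pi / b) ^ j := by positivity
  rw [e, walshConst, mul_assoc]
  have h1 := le_fold_max hρ hρα (t := 2 * Real.sin (Real.pi / b)) (by positivity)
  refine mul_le_mul h1 (one_add_sum_sin_pow_le hb hα hρα) h0 (le_trans ?_ h1)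
  positivity

lemma walshConst_pos {α b : ℕ} (hb : 2 ≤ b) (hα : 2 ≤ α) : 0 < walshConst α b := by
  refine lt_of_lt_of_le ?_ (chainBound_le_walshConst hb hα le_rfl (by omega))
  have := sinConst_pos hb
  have := oscBound_nonneg hb 1
  unfold chainBound
  positivity

lemma chain_prim_walsh_walshConst {α b : ℕ} [NeZero b] (hb : 2 ≤ b) (hα : 2 ≤ α) {k : ℕ}
    (hk : k ≠ 0) :
    Chain (α - 1) (prim (walsh b k)) (walshConst α b * (1 / (b : ℝ)) ^ mu α b k) := by
  have h := chain_prim_walsh hb hk (α - 1)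
  rw [Nat.sub_add_cancel (by omega : 1 ≤ α)] at h
  refine h.mono ?_
  rw [mul_comm]
  gcongr
  refine chainBound_le_walshConst hb hα ?_ (min_le_left _ _)
  obtain ⟨κ, K', a', hκ0, hκ, hK', rfl⟩ := exists_peel hb hk
  rw [card_digitPositions_peel hb hκ0 hκ hK']
  omega

/-! ### Smooth approximation of bounded measurable functions -/

/-- Smooth functions on the line with compact support in the open unit interval. -/
def IsTest (f : ℝ → ℂ) : Prop :=
  ContDiff ℝ ∞ f ∧ ∃ δ : ℝ, 0 < δ ∧ ∀ x, x ∉ Set.Icc δ (1 - δ) → f x = 0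

/-- A smooth approximate identity on the line. -/
def mollifier (n : ℕ) : ContDiffBump (0 : ℝ) where
  rIn := 1 / ((n : ℝ) + 1)
  rOut := 2 * (1 / ((n : ℝ) + 1))
  rIn_pos := by positivity
  rIn_lt_rOut := by
    have : 0 < 1 / ((n : ℝ) + 1) := by positivity
    linarith

/-- Smooth cut-off functions exhausting the open unit interval. -/
def cutoff (n : ℕ) : ContDiffBump (1 / 2 : ℝ) where
  rIn := 1 / 2 - 2 * (1 / ((n : ℝ) + 5))
  rOut := 1 / 2 - 1 / ((n : ℝ) + 5)
  -- The shift by `5` keeps the inner radius positive already at `n = 0`.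
  rIn_pos := by
    have : 1 / ((n : ℝ) + 5) < 1 / 4 :=
      one_div_lt_one_div_of_lt (by norm_num) (by linarith [Nat.cast_nonneg (α := ℝ) n])
    linarith
  rIn_lt_rOut := by
    have : 0 < 1 / ((n : ℝ) + 5) := by positivity
    linarith

lemma cutoff_eq_zero (n : ℕ) {x : ℝ} (hx : x ∉ Set.Icc (1 / ((n : ℝ) + 5)) (1 - 1 / ((n : ℝ) + 5))) :
    cutoff n x = 0 := by
  apply (cutoff n).zero_of_le_dist
  rw [Real.dist_eq]
  by_contra h
  rw [not_le, abs_lt] at h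
  apply hx
  have hr : (cutoff n).rOut = 1 / 2 - 1 / ((n : ℝ) + 5) := rfl
  rw [hr] at h
  constructor <;> linarith [h.1, h.2]

lemma tendsto_cutoff {x : ℝ} (h0 : 0 < x) (h1 : x < 1) :
    Filter.Tendsto (fun n => cutoff n x) Filter.atTop (nhds 1) := by
  apply tendsto_const_nhds.congr'
  have h : Filter.Tendsto (fun n : ℕ => 1 / ((n : ℝ) + 5)) Filter.atTop (nhds 0) := by
    refine Filter.Tendsto.div_atTop tendsto_const_nhds ?_
    exact Filter.tendsto_atTop_add_const_right _ _ tendsto_natCast_atTop_atTop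
  filter_upwards [h.eventually_lt_const (show 0 < x / 2 by linarith),
    h.eventually_lt_const (show 0 < (1 - x) / 2 by linarith)] with n hn hn'
  symm
  apply (cutoff n).one_of_mem_closedBall
  rw [Metric.mem_closedBall, Real.dist_eq]
  show |x - 1 / 2| ≤ 1 / 2 - 2 * (1 / ((n : ℝ) + 5))
  rw [abs_le]
  constructor <;> linarith

/-- Mollify, then multiply by a cut-off. Averages converge almost everywhere by Lebesgue
differentiation, and neither operation enlarges the sup bound, so dominated convergence applies
later. -/
lemma exists_test_approx {f : ℝ → ℂ} (hf : IsBddMeas f) :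
    ∃ (g : ℕ → ℝ → ℂ) (C : ℝ), (∀ n, IsTest (g n)) ∧ (∀ n x, ‖g n x‖ ≤ C) ∧
      ∀ᵐ x ∂(volume.restrict (Set.Icc (0 : ℝ) 1)),
        Filter.Tendsto (fun n => g n x) Filter.atTop (nhds (f x)) := by
  obtain ⟨hfm, C, hC⟩ := hf
  have hC0 : 0 ≤ C := (norm_nonneg _).trans (hC 0)
  have hloc : LocallyIntegrable f volume := by
    refine (locallyIntegrable_const C).mono hfm.aestronglyMeasurable ?_
    filter_upwards with x
    exact (hC x).trans (le_abs_self C)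
  let k : ℕ → ℝ → ℂ := fun n =>
    MeasureTheory.convolution ((mollifier n).normed volume) f (ContinuousLinearMap.lsmul ℝ ℝ) volume
  have hk : ∀ n, ContDiff ℝ ∞ (k n) := fun n =>
    HasCompactSupport.contDiff_convolution_left _ (mollifier n).hasCompactSupport_normed
      (mollifier n).contDiff_normed hloc
  have hkC : ∀ n x, ‖k n x‖ ≤ C := by
    intro n x
    have := dist_convolution_le (f := (mollifier n).normed volume) (g := f) (x₀ := x) (z₀ := 0)
      (R := (mollifier n).rOut) (μ := volume) hC0 (by rw [ContDiffBump.support_normed_eq])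
      (mollifier n).nonneg_normed ((mollifier n).integral_normed) hfm.aestronglyMeasurable
      (fun y _ => by simpa using hC y)
    simpa [k] using this
  have hlim : ∀ᵐ x, Filter.Tendsto (fun n => k n x) Filter.atTop (nhds (f x)) := by
    refine ContDiffBump.ae_convolution_tendsto_right_of_locallyIntegrable (K := 2) ?_ ?_ hloc
    · have := (tendsto_one_div_add_atTop_nhds_zero_nat (𝕜 := ℝ)).const_mul 2
      simpa [mollifier] using this
    · exact Filter.Eventually.of_forall fun n => le_rfl
  refine ⟨fun n x => (cutoff n x : ℂ) * k n x, C, fun n => ⟨?_, 1 / ((n : ℝ) + 5), by positivity,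
    fun x hx => by simp [cutoff_eq_zero n hx]⟩, fun n x => ?_, ?_⟩
  · exact (Complex.ofRealCLM.contDiff.comp (cutoff n).contDiff).mul (hk n)
  · rw [norm_mul, Complex.norm_real, Real.norm_of_nonneg (cutoff n).nonneg]
    exact (mul_le_of_le_one_left (norm_nonneg _) (cutoff n).le_one).trans (hkC n x)
  · rw [ae_restrict_iff' measurableSet_Icc]
    have h0 : ∀ᵐ t : ℝ, t ≠ 0 := by simp [ae_iff, measure_singleton]
    have h1 : ∀ᵐ t : ℝ, t ≠ 1 := by simp [ae_iff, measure_singleton]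
    filter_upwards [hlim, h0, h1] with x hx hx0 hx1 hmem
    have hc := tendsto_cutoff (lt_of_le_of_ne hmem.1 hx0.symm) (lt_of_le_of_ne hmem.2 hx1)
    simpa using ((Complex.continuous_ofReal.tendsto _).comp hc).mul hx

lemma IsTest.isBddMeas {f : ℝ → ℂ} (hf : IsTest f) : IsBddMeas f := by
  obtain ⟨hc, δ, hδ, h0⟩ := hf
  refine ⟨hc.continuous.measurable, ?_⟩
  obtain ⟨C, hC⟩ := (isCompact_Icc (a := δ) (b := 1 - δ)).exists_bound_of_continuousOn
    hc.continuous.continuousOn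
  refine ⟨max C 0, fun x => ?_⟩
  by_cases hx : x ∈ Set.Icc δ (1 - δ)
  · exact (hC x hx).trans (le_max_left _ _)
  · rw [h0 x hx]; simp

lemma deriv_prim {f : ℝ → ℂ} (hf : Continuous f) : deriv (prim f) = f := by
  funext x
  exact (intervalIntegral.integral_hasDerivAt_right (hf.intervalIntegrable _ _)
    (hf.stronglyMeasurableAtFilter _ _) hf.continuousAt).deriv

lemma differentiable_prim {f : ℝ → ℂ} (hf : Continuous f) : Differentiable ℝ (prim f) := fun _ =>
  (intervalIntegral.integral_hasDerivAt_right (hf.intervalIntegrable _ _)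
    (hf.stronglyMeasurableAtFilter _ _) hf.continuousAt).differentiableAt

/-- The mean-zero condition is what makes the primitive vanish to the right of the support of `f`.
-/
lemma IsTest.prim {f : ℝ → ℂ} (hf : IsTest f) (h1 : prim f 1 = 0) : IsTest (prim f) := by
  obtain ⟨hc, δ, hδ, h0⟩ := hf
  refine ⟨?_, min δ (1 / 2), by positivity, ?_⟩
  · rw [contDiff_infty_iff_deriv, deriv_prim hc.continuous]
    exact ⟨differentiable_prim hc.continuous, hc⟩
  · intro x hx
    have hz : ∀ u v : ℝ, (∀ t ∈ Set.uIoc u v, t ∉ Set.Icc δ (1 - δ)) → ∫ t in u..v, f t = 0 := by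
      intro u v h
      rw [intervalIntegral.integral_zero_ae]
      exact Filter.Eventually.of_forall fun t ht => h0 t (h t ht)
    rw [Set.mem_Icc, not_and_or, not_le, not_le] at hx
    have hmin : min δ (1 / 2) ≤ δ := min_le_left _ _
    have hmin2 : min δ (1 / 2) ≤ 1 / 2 := min_le_right _ _
    rcases hx with hx | hx
    · apply hz
      intro t ht h
      have := ht.2
      rcases le_max_iff.mp this with h' | h'
      · linarith [h.1]
      · linarith [h.1]
    · have e : QMC.prim f x = QMC.prim f 1 - ∫ t in x..1, f t := by
        unfold QMC.prim
        rw [eq_sub_iff_add_eq, intervalIntegral.integral_add_adjacent_intervals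
          (hc.continuous.intervalIntegrable _ _) (hc.continuous.intervalIntegrable _ _)]
      rw [e, h1, zero_sub, neg_eq_zero]
      apply hz
      intro t ht h
      have := ht.1
      rcases min_lt_iff.mp this with h' | h'
      · linarith [h.2]
      · linarith [h.2]

/-- The normalised bump used to correct means. -/
lemma exists_test_mean_one : ∃ η : ℝ → ℂ, IsTest η ∧ prim η 1 = 1 := by
  have hsupp : ∀ x, x ∉ Set.Icc (1 / ((0 : ℕ) + 5 : ℝ)) (1 - 1 / ((0 : ℕ) + 5 : ℝ)) →
      (cutoff 0).normed volume x = 0 := fun x hx => by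
    rw [ContDiffBump.normed_def, cutoff_eq_zero 0 hx, zero_div]
  refine ⟨fun x => ((cutoff 0).normed volume x : ℂ), ⟨?_, 1 / ((0 : ℕ) + 5 : ℝ), by positivity,
    fun x hx => by simpa using hsupp x hx⟩, ?_⟩
  · exact Complex.ofRealCLM.contDiff.comp (cutoff 0).contDiff_normed
  · rw [prim, intervalIntegral.integral_ofReal, intervalIntegral.integral_of_le zero_le_one,
      setIntegral_eq_integral_of_forall_compl_eq_zero, (cutoff 0).integral_normed]
    · simp
    · intro x hx
      apply hsupp
      intro h
      apply hx
      have h5 : (0 : ℝ) < 1 / ((0 : ℕ) + 5 : ℝ) := by positivity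
      exact ⟨by linarith [h.1], by linarith [h.2]⟩

/-- Bounded approximation of a mean zero function and its primitive by test functions. -/
lemma exists_test_approx_mean_zero {f : ℝ → ℂ} (hf : IsBddMeas f) (h0 : prim f 1 = 0) :
    ∃ (g : ℕ → ℝ → ℂ) (C : ℝ), (∀ n, IsTest (g n)) ∧ (∀ n, prim (g n) 1 = 0) ∧
      (∀ n x, ‖g n x‖ ≤ C) ∧
      (∀ᵐ x ∂(volume.restrict (Set.Icc (0 : ℝ) 1)),
        Filter.Tendsto (fun n => g n x) Filter.atTop (nhds (f x))) ∧
      ∀ x ∈ Set.Icc (0 : ℝ) 1,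
        Filter.Tendsto (fun n => prim (g n) x) Filter.atTop (nhds (prim f x)) := by
  obtain ⟨g, C, hg, hgC, hlim⟩ := exists_test_approx hf
  obtain ⟨η, hη, hη1⟩ := exists_test_mean_one
  obtain ⟨D, hD⟩ := hη.isBddMeas.2
  have hgi : ∀ n, IsBddMeas (g n) := fun n => (hg n).isBddMeas
  have hprim : ∀ x ∈ Set.Icc (0 : ℝ) 1,
      Filter.Tendsto (fun n => prim (g n) x) Filter.atTop (nhds (prim f x)) := by
    intro x hx
    refine intervalIntegral.tendsto_integral_filter_of_dominated_convergence (fun _ => C)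
      (Filter.Eventually.of_forall fun n => (hgi n).1.aestronglyMeasurable)
      (Filter.Eventually.of_forall fun n => Filter.Eventually.of_forall fun t _ => hgC n t)
      (by simp) ?_
    rw [ae_restrict_iff' measurableSet_Icc] at hlim
    filter_upwards [hlim] with t ht hmem
    rw [Set.uIoc_of_le hx.1] at hmem
    exact ht ⟨hmem.1.le, hmem.2.trans hx.2⟩
  have hε := hprim 1 (by simp)
  rw [h0] at hε
  have hεn : ∀ n, ‖prim (g n) 1‖ ≤ C := fun n => by
    simpa [prim] using intervalIntegral.norm_integral_le_of_norm_le_const (a := 0) (b := 1) (C := C)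
      fun t _ => hgC n t
  have hsub : ∀ n x, prim (fun t => g n t - prim (g n) 1 * η t) x
      = prim (g n) x - prim (g n) 1 * prim η x := by
    intro n x
    conv_lhs => rw [prim]
    rw [intervalIntegral.integral_sub ((hgi n).intervalIntegrable _ _)
      ((hη.isBddMeas.intervalIntegrable _ _).const_mul _), intervalIntegral.integral_const_mul]
    rfl
  -- The bump `η` of integral one repairs the mean of `g n`. The correction tends to `0` because `f`
  -- itself has mean zero.
  refine ⟨fun n x => g n x - prim (g n) 1 * η x, C + C * D, fun n => ?_, fun n => ?_, fun n x => ?_,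
    ?_, fun x hx => ?_⟩
  · obtain ⟨hc, δ, hδ, hz⟩ := hg n
    obtain ⟨hc', δ', hδ', hz'⟩ := hη
    refine ⟨hc.sub (contDiff_const.mul hc'), min δ δ', lt_min hδ hδ', fun x hx => ?_⟩
    show g n x - prim (g n) 1 * η x = 0
    rw [hz x, hz' x]
    · simp
    · intro h; exact hx ⟨(min_le_right _ _).trans h.1, by linarith [h.2, min_le_right δ δ']⟩
    · intro h; exact hx ⟨(min_le_left _ _).trans h.1, by linarith [h.2, min_le_left δ δ']⟩
  · rw [hsub, hη1]; simp
  · refine (norm_sub_le _ _).trans (add_le_add (hgC n x) ?_)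
    rw [norm_mul]
    exact mul_le_mul (hεn n) (hD x) (norm_nonneg _) ((norm_nonneg _).trans (hεn n))
  · filter_upwards [hlim] with x hx
    simpa using hx.sub (hε.mul_const (η x))
  · simp only [hsub]
    simpa using (hprim x hx).sub (hε.mul_const (prim η x))

/-! ### Integration by parts against tensor products -/

section pairing
variable {s : ℕ}

lemma cube_eq_pi (s : ℕ) : cube s = Set.univ.pi fun _ => Set.Icc (0 : ℝ) 1 := by
  rw [cube, ← Set.pi_univ_Icc]; rfl

lemma restrict_cube (s : ℕ) : (volume : Measure (Fin s → ℝ)).restrict (cube s)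
    = Measure.pi fun _ => volume.restrict (Set.Icc (0 : ℝ) 1) := by
  rw [cube_eq_pi, volume_pi, Measure.restrict_pi_pi]

instance : IsProbabilityMeasure ((volume : Measure ℝ).restrict (Set.Icc (0 : ℝ) 1)) :=
  ⟨by simp⟩

instance (s : ℕ) : IsProbabilityMeasure ((volume : Measure (Fin s → ℝ)).restrict (cube s)) := by
  rw [restrict_cube]; infer_instance

/-- The tensor product of functions of one variable. -/
def tensor (h : Fin s → ℝ → ℂ) (y : Fin s → ℝ) : ℂ := ∏ i, h i (y i)

/-- Integration over the unit cube against a tensor product. -/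
def pairing (G : (Fin s → ℝ) → ℝ) (h : Fin s → ℝ → ℂ) : ℂ :=
  ∫ y in cube s, (G y : ℂ) * tensor h y

lemma measurable_tensor {h : Fin s → ℝ → ℂ} (hh : ∀ i, Measurable (h i)) :
    Measurable (tensor h) :=
  Finset.measurable_prod _ fun i _ => (hh i).comp (measurable_pi_apply i)

lemma norm_tensor_le {h : Fin s → ℝ → ℂ} {C : Fin s → ℝ} (hC : ∀ i x, ‖h i x‖ ≤ C i)
    (y : Fin s → ℝ) : ‖tensor h y‖ ≤ ∏ i, C i := by
  rw [tensor, norm_prod]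
  exact Finset.prod_le_prod (fun i _ => norm_nonneg _) fun i _ => hC i _

lemma integrable_mul_tensor {G : (Fin s → ℝ) → ℝ} (hG : IntegrableOn G (cube s))
    {h : Fin s → ℝ → ℂ} (hh : ∀ i, IsBddMeas (h i)) :
    IntegrableOn (fun y => (G y : ℂ) * tensor h y) (cube s) := by
  choose hm C hC using hh
  exact Integrable.mul_bdd (c := ∏ i, C i) hG.ofReal (measurable_tensor hm).aestronglyMeasurable
    (Filter.Eventually.of_forall fun y => norm_tensor_le hC y)

lemma tendsto_pairing {G : (Fin s → ℝ) → ℝ} (hG : IntegrableOn G (cube s))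
    {g : ℕ → Fin s → ℝ → ℂ} {h : Fin s → ℝ → ℂ} {C : Fin s → ℝ}
    (hm : ∀ n i, Measurable (g n i)) (hC : ∀ n i x, ‖g n i x‖ ≤ C i)
    (hlim : ∀ i, ∀ᵐ x ∂(volume.restrict (Set.Icc (0 : ℝ) 1)),
      Filter.Tendsto (fun n => g n i x) Filter.atTop (nhds (h i x))) :
    Filter.Tendsto (fun n => pairing G (g n)) Filter.atTop (nhds (pairing G h)) := by
  refine tendsto_integral_of_dominated_convergence (fun y => ‖G y‖ * ∏ i, C i)
    (fun n => hG.ofReal.aestronglyMeasurable.mul (measurable_tensor (hm n)).aestronglyMeasurable)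
    (hG.norm.mul_const _) (fun n => Filter.Eventually.of_forall fun y => ?_) ?_
  · rw [norm_mul, Complex.norm_real]
    exact mul_le_mul_of_nonneg_left (norm_tensor_le (hC n) y) (norm_nonneg _)
  · rw [restrict_cube]
    have : ∀ᵐ y ∂(Measure.pi fun _ : Fin s => (volume : Measure ℝ).restrict (Set.Icc (0 : ℝ) 1)),
        ∀ i, Filter.Tendsto (fun n => g n i (y i)) Filter.atTop (nhds (h i (y i))) :=
      Filter.eventually_all.2 fun i => (Measure.tendsto_eval_ae_ae
        (μ := fun _ : Fin s => (volume : Measure ℝ).restrict (Set.Icc (0 : ℝ) 1))).eventually (hlim i)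
    filter_upwards [this] with y hy
    exact (tendsto_finsetProd _ fun i _ => hy i).const_mul _

lemma IsWeakPartial.complex {j : Fin s} {f g : (Fin s → ℝ) → ℝ} (h : IsWeakPartial j f g)
    (hf : IntegrableOn f (cube s)) (hg : IntegrableOn g (cube s))
    {φ : (Fin s → ℝ) → ℂ} (hφ : ContDiff ℝ ∞ φ) (hc : HasCompactSupport φ)
    (hs : tsupport φ ⊆ Set.univ.pi fun _ => Set.Ioo (0 : ℝ) 1) :
    ∫ x in cube s, (f x : ℂ) * fderiv ℝ φ x (Pi.single j 1)
      = - ∫ x in cube s, (g x : ℂ) * φ x := by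
  have hd : ∀ x, DifferentiableAt ℝ φ x := fun x =>
    (hφ.differentiable (by simp)).differentiableAt
  have hcont : Continuous fun x => fderiv ℝ φ x (Pi.single j 1) :=
    (hφ.continuous_fderiv (by simp)).clm_apply continuous_const
  have hcs : HasCompactSupport fun x => fderiv ℝ φ x (Pi.single j 1) :=
    hc.fderiv_apply ℝ _
  obtain ⟨A, hA⟩ := hcont.bounded_above_of_compact_support hcs
  obtain ⟨B, hB⟩ := hφ.continuous.bounded_above_of_compact_support hc
  have hi1 : IntegrableOn (fun x => (f x : ℂ) * fderiv ℝ φ x (Pi.single j 1)) (cube s) :=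
    Integrable.mul_bdd (c := A) hf.ofReal hcont.aestronglyMeasurable (Filter.Eventually.of_forall hA)
  have hi2 : IntegrableOn (fun x => (g x : ℂ) * φ x) (cube s) :=
    Integrable.mul_bdd (c := B) hg.ofReal hφ.continuous.aestronglyMeasurable
      (Filter.Eventually.of_forall hB)
  have key : ∀ L : ℂ →L[ℝ] ℝ, L (∫ x in cube s, (f x : ℂ) * fderiv ℝ φ x (Pi.single j 1))
      = L (- ∫ x in cube s, (g x : ℂ) * φ x) := by
    intro L
    have hL : ∀ (t : ℝ) (z : ℂ), L ((t : ℂ) * z) = t * L z := fun t z => by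
      rw [← Complex.real_smul, map_smul, smul_eq_mul]
    have hz : L 0 = 0 := map_zero L
    have h1 := h (fun x => L (φ x)) (L.contDiff.comp hφ) (hc.comp_left hz)
      ((closure_mono fun x hx => by
        rw [Function.mem_support] at hx ⊢
        intro h'; exact hx (by rw [h', hz])).trans hs)
    rw [map_neg, ← L.integral_comp_comm hi1, ← L.integral_comp_comm hi2]
    simp only [hL]
    rw [← h1]
    congr 1
    funext x
    have : fderiv ℝ (fun x => L (φ x)) x = L.comp (fderiv ℝ φ x) := by
      exact (L.hasFDerivAt.comp x (hd x).hasFDerivAt).fderiv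
    rw [this]; rfl
  exact Complex.ext (key Complex.reCLM) (key Complex.imCLM)

lemma tensor_update (h : Fin s → ℝ → ℂ) (j : Fin s) (f : ℝ → ℂ) (y : Fin s → ℝ) :
    tensor (Function.update h j f) y = f (y j) * ∏ i ∈ Finset.univ.erase j, h i (y i) := by
  rw [tensor, ← Finset.mul_prod_erase _ _ (Finset.mem_univ j), Function.update_self]
  congr 1
  refine Finset.prod_congr rfl fun i hi => ?_
  rw [Function.update_of_ne (Finset.ne_of_mem_erase hi)]

/-- A tensor product of one-variable test functions is an admissible test function for the weak
derivative; its partial derivative differentiates the `j`-th factor only. -/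
lemma pairing_ibp_test {j : Fin s} {f g : (Fin s → ℝ) → ℝ} (hw : IsWeakPartial j f g)
    (hf : IntegrableOn f (cube s)) (hg : IntegrableOn g (cube s))
    {θ : Fin s → ℝ → ℂ} (hθ : ∀ i, IsTest (θ i)) :
    pairing f (Function.update θ j (deriv (θ j))) = - pairing g θ := by
  have hsm : ContDiff ℝ ∞ (tensor θ) :=
    contDiff_prod fun i _ => (hθ i).1.comp (contDiff_apply ℝ ℝ i)
  choose hc δ hδ h0 using hθ
  set K : Set (Fin s → ℝ) := Set.univ.pi fun i => Set.Icc (δ i) (1 - δ i) with hK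
  have hKc : IsCompact K := isCompact_univ_pi fun i => isCompact_Icc
  have hsupp : Function.support (tensor θ) ⊆ K := by
    intro y hy i _
    by_contra h
    exact hy (Finset.prod_eq_zero (Finset.mem_univ i) (h0 i _ h))
  have hts : tsupport (tensor θ) ⊆ Set.univ.pi fun _ => Set.Ioo (0 : ℝ) 1 := by
    refine (closure_minimal hsupp hKc.isClosed).trans ?_
    exact Set.pi_mono fun i _ => Set.Icc_subset_Ioo (hδ i) (by linarith [hδ i])
  have h := hw.complex hf hg hsm (HasCompactSupport.of_support_subset_isCompact hKc hsupp) hts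
  rw [pairing, pairing, ← h]
  congr 1
  funext y
  congr 1
  rw [← ((hsm.differentiable (by simp)).differentiableAt).lineDeriv_eq_fderiv, lineDeriv,
    tensor_update]
  have e : (fun t : ℝ => tensor θ (y + t • Pi.single j 1))
      = fun t => θ j (y j + t) * ∏ i ∈ Finset.univ.erase j, θ i (y i) := by
    funext t
    rw [tensor, ← Finset.mul_prod_erase _ _ (Finset.mem_univ j)]
    congr 1
    · simp
    · refine Finset.prod_congr rfl fun i hi => ?_
      simp [Finset.ne_of_mem_erase hi]
  rw [e, deriv_mul_const_field]
  congr 1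
  rw [deriv_comp_const_add, add_zero]

/-- Integration by parts in one coordinate against bounded measurable tensor products. -/
lemma pairing_ibp {j : Fin s} {f g : (Fin s → ℝ) → ℝ} (hw : IsWeakPartial j f g)
    (hf : IntegrableOn f (cube s)) (hg : IntegrableOn g (cube s))
    {h : Fin s → ℝ → ℂ} (hh : ∀ i, IsBddMeas (h i)) {w : ℝ → ℂ} (hwm : IsBddMeas w)
    (h0 : prim w 1 = 0) :
    pairing f (Function.update h j w) = - pairing g (Function.update h j (prim w)) := by
  choose θ C hθ hC hlim using fun i => exists_test_approx (hh i)
  obtain ⟨ω', D, hω, hω0, hD, hωlim, hωprim⟩ := exists_test_approx_mean_zero hwm h0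
  have hωm : ∀ n, IsBddMeas (ω' n) := fun n => (hω n).isBddMeas
  have hP : ∀ n, IsTest (prim (ω' n)) := fun n => (hω n).prim (hω0 n)
  have hupd : ∀ (n : ℕ), pairing f (Function.update (fun i => θ i n) j (ω' n))
      = - pairing g (Function.update (fun i => θ i n) j (prim (ω' n))) := by
    intro n
    rw [← pairing_ibp_test hw hf hg (θ := Function.update (fun i => θ i n) j (prim (ω' n)))]
    · rw [Function.update_idem, Function.update_self, deriv_prim (hω n).1.continuous]
    · intro i
      rcases eq_or_ne i j with rfl | hij
      · rw [Function.update_self]; exact hP n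
      · rw [Function.update_of_ne hij]; exact hθ i n
  have hPD : ∀ n x, ‖prim (ω' n) x‖ ≤ D := by
    intro n x
    have hD0 : 0 ≤ D := (norm_nonneg _).trans (hD n 0)
    by_cases hx : x ∈ Set.Icc (0 : ℝ) 1
    · have := norm_prim_sub_le (hωm n) (hD n) 0 x
      rw [prim_zero, sub_zero, sub_zero, abs_of_nonneg hx.1] at this
      exact this.trans (mul_le_of_le_one_right hD0 hx.2)
    · obtain ⟨-, δ, hδ, hz⟩ := hP n
      rw [hz x fun h' => hx ⟨by linarith [h'.1], by linarith [h'.2]⟩]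
      simpa using hD0
  have lim1 : Filter.Tendsto (fun n => pairing f (Function.update (fun i => θ i n) j (ω' n)))
      Filter.atTop (nhds (pairing f (Function.update h j w))) := by
    refine tendsto_pairing hf (C := Function.update C j D) (fun n i => ?_) (fun n i x => ?_)
      fun i => ?_ <;> rcases eq_or_ne i j with rfl | hij
    · rw [Function.update_self]; exact (hωm n).1
    · rw [Function.update_of_ne hij]; exact (hθ i n).isBddMeas.1
    · simp only [Function.update_self]; exact hD n x
    · simp only [Function.update_of_ne hij]; exact hC i n x
    · simpa only [Function.update_self] using hωlim
    · simpa only [Function.update_of_ne hij] using hlim i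
  have lim2 : Filter.Tendsto (fun n => pairing g (Function.update (fun i => θ i n) j (prim (ω' n))))
      Filter.atTop (nhds (pairing g (Function.update h j (prim w)))) := by
    refine tendsto_pairing hg (C := Function.update C j D) (fun n i => ?_) (fun n i x => ?_)
      fun i => ?_ <;> rcases eq_or_ne i j with rfl | hij
    · rw [Function.update_self]; exact (hP n).isBddMeas.1
    · rw [Function.update_of_ne hij]; exact (hθ i n).isBddMeas.1
    · simp only [Function.update_self]; exact hPD n x
    · simp only [Function.update_of_ne hij]; exact hC i n x
    · simp only [Function.update_self]
      rw [ae_restrict_iff' measurableSet_Icc]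
      exact Filter.Eventually.of_forall hωprim
    · simpa only [Function.update_of_ne hij] using hlim i
  refine tendsto_nhds_unique lim1 ?_
  simp only [hupd]
  exact lim2.neg

end pairing

/-! ### Bounds for integrals against Walsh functions -/

section coefficient
variable {s : ℕ}

lemma measurable_piecewise_prod (v : Finset (Fin s)) :
    Measurable fun p : (Fin s → ℝ) × (Fin s → ℝ) => v.piecewise p.1 p.2 := by
  refine measurable_pi_lambda _ fun i => ?_
  by_cases hi : i ∈ v
  · simpa [Finset.piecewise, hi] using measurable_fst.eval (a := i)
  · simpa [Finset.piecewise, hi] using measurable_snd.eval (a := i)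

/-- Mixing coordinates of two independent uniform points gives a uniform point. Fubini between `v`
and its complement becomes Fubini on two full copies of the cube, matching the form of
`integrateOut`. -/
lemma measurePreserving_piecewise (v : Finset (Fin s)) :
    MeasurePreserving (fun p : (Fin s → ℝ) × (Fin s → ℝ) => v.piecewise p.1 p.2)
      ((volume.restrict (cube s)).prod (volume.restrict (cube s))) (volume.restrict (cube s)) := by
  refine ⟨measurable_piecewise_prod v, ?_⟩
  rw [restrict_cube]
  symm
  refine Measure.pi_eq fun S hS => ?_
  have e : (fun p : (Fin s → ℝ) × (Fin s → ℝ) => v.piecewise p.1 p.2) ⁻¹' Set.univ.pi S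
      = (Set.univ.pi fun i => if i ∈ v then S i else Set.univ) ×ˢ
        (Set.univ.pi fun i => if i ∈ v then Set.univ else S i) := by
    ext p
    simp only [Set.mem_preimage, Set.mem_pi, Set.mem_univ, forall_true_left, Set.mem_prod,
      ← forall_and]
    refine forall_congr' fun i => ?_
    by_cases hi : i ∈ v <;> simp [hi]
  rw [Measure.map_apply (measurable_piecewise_prod v) (MeasurableSet.univ_pi hS), e,
    Measure.prod_prod, Measure.pi_pi, Measure.pi_pi, ← Finset.prod_mul_distrib]
  refine Finset.prod_congr rfl fun i _ => ?_
  by_cases hi : i ∈ v <;> simp [hi]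

lemma integrable_comp_piecewise (v : Finset (Fin s)) {G : (Fin s → ℝ) → ℝ}
    (hG : IntegrableOn G (cube s)) :
    Integrable (fun p : (Fin s → ℝ) × (Fin s → ℝ) => G (v.piecewise p.1 p.2))
      ((volume.restrict (cube s)).prod (volume.restrict (cube s))) :=
  (measurePreserving_piecewise v).integrable_comp_of_integrable hG

lemma integrable_integrateOut (v : Finset (Fin s)) {G : (Fin s → ℝ) → ℝ}
    (hG : IntegrableOn G (cube s)) : IntegrableOn (integrateOut v G) (cube s) :=
  (integrable_comp_piecewise v hG).integral_prod_left

lemma pairing_eq_integrateOut (v : Finset (Fin s)) {G : (Fin s → ℝ) → ℝ}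
    (hG : IntegrableOn G (cube s)) {h : Fin s → ℝ → ℂ} (hh : ∀ i, IsBddMeas (h i))
    (h1 : ∀ i ∉ v, h i = fun _ => 1) : pairing G h = pairing (integrateOut v G) h := by
  have hten : ∀ y z : Fin s → ℝ, tensor h (v.piecewise y z) = tensor h y := by
    intro y z
    refine Finset.prod_congr rfl fun i _ => ?_
    by_cases hi : i ∈ v
    · simp [hi]
    · simp [h1 i hi]
  have hp := measurePreserving_piecewise v
  have hi := integrable_mul_tensor hG hh
  have hi' := hp.integrable_comp_of_integrable hi
  rw [pairing, ← hp.map_eq, integral_map hp.measurable.aemeasurable (by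
    rw [hp.map_eq]; exact hi.aestronglyMeasurable)]
  rw [show ∫ p, (G (v.piecewise p.1 p.2) : ℂ) * tensor h (v.piecewise p.1 p.2)
      ∂((volume.restrict (cube s)).prod (volume.restrict (cube s))) = _ from integral_prod _ hi',
    pairing]
  refine integral_congr_ae (Filter.Eventually.of_forall fun y => ?_)
  simp only [hten]
  rw [integral_mul_const]
  congr 1
  exact integral_ofReal

lemma norm_pairing_le (v : Finset (Fin s)) {G : (Fin s → ℝ) → ℝ}
    (hG : IntegrableOn G (cube s)) {h : Fin s → ℝ → ℂ} (hh : ∀ i, IsBddMeas (h i))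
    (h1 : ∀ i ∉ v, h i = fun _ => 1) {d : Fin s → ℝ} (hd : ∀ i ∈ v, ∀ x, ‖h i x‖ ≤ d i) :
    ‖pairing G h‖ ≤ (∏ i ∈ v, d i) * ∫ y in cube s, ‖integrateOut v G y‖ := by
  rw [pairing_eq_integrateOut v hG hh h1, pairing, ← integral_const_mul]
  refine norm_integral_le_of_norm_le ((integrable_integrateOut v hG).norm.const_mul _)
    (Filter.Eventually.of_forall fun y => ?_)
  rw [norm_mul, Complex.norm_real, mul_comm]
  gcongr
  rw [tensor, norm_prod, ← Finset.prod_subset (Finset.subset_univ v)]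
  · exact Finset.prod_le_prod (fun i _ => norm_nonneg _) fun i hi => hd i hi _
  · intro i _ hi
    simp [h1 i hi]

lemma pairing_update_const_add {G : (Fin s → ℝ) → ℝ} (hG : IntegrableOn G (cube s))
    {h : Fin s → ℝ → ℂ} (hh : ∀ i, IsBddMeas (h i)) (j : Fin s) {f w : ℝ → ℂ} {c : ℂ}
    (hf : ∀ x, f x = c + w x) (hw : IsBddMeas w) :
    pairing G (Function.update h j f) = c * pairing G (Function.update h j fun _ => 1)
      + pairing G (Function.update h j w) := by
  have hu : ∀ g : ℝ → ℂ, IsBddMeas g → ∀ i, IsBddMeas (Function.update h j g i) := by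
    intro g hg i
    rcases eq_or_ne i j with rfl | hij
    · rwa [Function.update_self]
    · rw [Function.update_of_ne hij]; exact hh i
  rw [pairing, pairing, pairing, ← integral_const_mul, ← integral_add
    ((integrable_mul_tensor hG (hu _ (isBddMeas_const 1))).const_mul c)
    (integrable_mul_tensor hG (hu _ hw))]
  congr 1
  funext y
  rw [tensor_update, tensor_update, tensor_update, hf]
  ring

/-! ### Repeated integration by parts along chains -/

variable {α : ℕ} {F : (Fin s → ℝ) → ℝ} {D : (Fin s → ℕ) → (Fin s → ℝ) → ℝ}

lemma add_single_eq_update (ν : Fin s → ℕ) (j : Fin s) (t : ℕ) :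
    Function.update ν j t + Pi.single j 1 = Function.update ν j (t + 1) := by
  funext i
  rcases eq_or_ne i j with rfl | hij
  · simp
  · simp [hij]

lemma IsMixedDerivFamily.pairing_ibp (hD : IsMixedDerivFamily α F D) {ν : Fin s → ℕ}
    (hν : ∀ i, ν i ≤ α) (j : Fin s) {t : ℕ} (ht : t < α)
    {h : Fin s → ℝ → ℂ} (hh : ∀ i, IsBddMeas (h i)) {w : ℝ → ℂ} (hw : IsBddMeas w)
    (h0 : prim w 1 = 0) :
    pairing (D (Function.update ν j t)) (Function.update h j w)
      = - pairing (D (Function.update ν j (t + 1))) (Function.update h j (prim w)) := by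
  have hle : ∀ t ≤ α, ∀ i, Function.update ν j t i ≤ α := by
    intro t ht i
    rcases eq_or_ne i j with rfl | hij
    · rwa [Function.update_self]
    · rw [Function.update_of_ne hij]; exact hν i
  refine QMC.pairing_ibp ?_ (hD.integrable _ (hle t ht.le)) (hD.integrable _ (hle _ ht)) hh hw h0
  have := hD.weakPartial _ (hle t ht.le) j (by rwa [Function.update_self])
  rwa [add_single_eq_update] at this

/-- Each link leaves its constant paired with the derivative of the current order and trades the
mean-zero part for its primitive against one order more. After `n` links the order is `α` and the
bounded remainder is left, so every piece is charged to the same `X` with total weight `B`. -/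
lemma Chain.norm_pairing_le (hD : IsMixedDerivFamily α F D) {ν : Fin s → ℕ}
    (hν : ∀ i, ν i ≤ α) (j : Fin s) {h : Fin s → ℝ → ℂ} (hh : ∀ i, IsBddMeas (h i))
    {n t : ℕ} (ht : 1 ≤ t) (hnt : t + n = α) {f : ℝ → ℂ} {B X : ℝ} (hf : Chain n f B)
    (hconst : ∀ t', 1 ≤ t' → t' ≤ α →
      ‖pairing (D (Function.update ν j t')) (Function.update h j fun _ => 1)‖ ≤ X)
    (hfull : ∀ (w : ℝ → ℂ) (d : ℝ), IsBddMeas w → (∀ x, ‖w x‖ ≤ d) →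
      ‖pairing (D (Function.update ν j α)) (Function.update h j w)‖ ≤ d * X) :
    ‖pairing (D (Function.update ν j t)) (Function.update h j f)‖ ≤ B * X := by
  have hle : ∀ t ≤ α, ∀ i, Function.update ν j t i ≤ α := by
    intro t ht i
    rcases eq_or_ne i j with rfl | hij
    · rwa [Function.update_self]
    · rw [Function.update_of_ne hij]; exact hν i
  have hX : 0 ≤ X := (norm_nonneg _).trans (hconst t ht (by omega))
  induction hf generalizing t with
  | zero f w c d B hfw hw hd hB =>
    obtain rfl : t = α := by omega
    rw [pairing_update_const_add (hD.integrable _ (hle t le_rfl)) hh j hfw ⟨hw, d, hd⟩]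
    refine (norm_add_le _ _).trans ?_
    rw [norm_mul]
    have h1 := mul_le_mul_of_nonneg_left (hconst t ht le_rfl) (norm_nonneg c)
    have h2 := hfull w d ⟨hw, d, hd⟩ hd
    nlinarith
  | succ n f w c B' B hfw hw h0 hc hB ih =>
    rw [pairing_update_const_add (hD.integrable _ (hle t (by omega))) hh j hfw hw,
      hD.pairing_ibp hν j (by omega) hh hw h0]
    refine (norm_add_le _ _).trans ?_
    rw [norm_mul, norm_neg]
    have h1 := mul_le_mul_of_nonneg_left (hconst t ht (by omega)) (norm_nonneg c)
    have h2 := ih (t := t + 1) (by omega) (by omega)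
    nlinarith

/-- Induction over the coordinates `R` not yet treated, which still carry order `0` and the factor
`f j`. A treated coordinate either lies in `v`, with order `α` and a bounded factor, or lies outside
with order `τ j` and factor `1`. When `R` is empty a single term of the norm is left. -/
lemma norm_pairing_multiIndex_le (hD : IsMixedDerivFamily α F D) (hα : 1 ≤ α)
    {u : Finset (Fin s)} {X : ℝ}
    (hX : ∀ v ⊆ u, ∀ τ : Fin s → ℕ, (∀ j ∈ u \ v, τ j ∈ Finset.Icc 1 α) → (∀ j ∉ u \ v, τ j = 0) →
      ∫ y in cube s, ‖integrateOut v (D (multiIndex α v τ)) y‖ ≤ X)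
    {f : Fin s → ℝ → ℂ} {B : Fin s → ℝ} (hfm : ∀ j ∈ u, IsBddMeas (f j))
    (hf0 : ∀ j ∈ u, prim (f j) 1 = 0) (hfc : ∀ j ∈ u, Chain (α - 1) (prim (f j)) (B j))
    (R v : Finset (Fin s)) (τ : Fin s → ℕ) (hRv : Disjoint v R) (hRu : v ∪ R ⊆ u)
    (hτ : ∀ j ∈ u \ (v ∪ R), τ j ∈ Finset.Icc 1 α) (hτ0 : ∀ j ∉ u \ (v ∪ R), τ j = 0)
    {h : Fin s → ℝ → ℂ} (hh : ∀ i, IsBddMeas (h i)) {d : Fin s → ℝ}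
    (hhR : ∀ j ∈ R, h j = f j) (hh1 : ∀ j ∉ v ∪ R, h j = fun _ => 1)
    (hhv : ∀ j ∈ v, ∀ x, ‖h j x‖ ≤ d j) :
    ‖pairing (D (multiIndex α v τ)) h‖ ≤ (∏ j ∈ R, B j) * ((∏ j ∈ v, d j) * X) := by
  have hle : ∀ (v R : Finset (Fin s)) (τ : Fin s → ℕ), (∀ j ∈ u \ (v ∪ R), τ j ∈ Finset.Icc 1 α) →
      (∀ j ∉ u \ (v ∪ R), τ j = 0) → ∀ j, multiIndex α v τ j ≤ α := by
    intro v R τ hτ hτ0 j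
    unfold multiIndex
    split_ifs
    · exact le_rfl
    · by_cases hj : j ∈ u \ (v ∪ R)
      · exact (Finset.mem_Icc.mp (hτ j hj)).2
      · rw [hτ0 j hj]; exact Nat.zero_le _
  induction R using Finset.induction_on generalizing v τ h d with
  | empty =>
    have hν := hle v ∅ τ hτ hτ0
    rw [Finset.union_empty] at *
    rw [Finset.prod_empty, one_mul]
    refine (norm_pairing_le v (hD.integrable _ hν) hh hh1 hhv).trans ?_
    refine mul_le_mul_of_nonneg_left (hX v hRu τ hτ hτ0) (Finset.prod_nonneg fun j hj => ?_)
    exact (norm_nonneg _).trans (hhv j hj 0)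
  | insert j R hjR ih =>
    have hν := hle v _ τ hτ hτ0
    have hju : j ∈ u := hRu (by simp)
    have hjv : j ∉ v := Finset.disjoint_right.mp hRv (by simp)
    have hvR : Disjoint v R := Finset.disjoint_of_subset_right (Finset.subset_insert _ _) hRv
    have hvRu : v ∪ R ⊆ u :=
      (Finset.union_subset_union_right (Finset.subset_insert _ _)).trans hRu
    have hτj : τ j = 0 := hτ0 j (by simp)
    have hνj : multiIndex α v τ j = 0 := by simp [multiIndex, hjv, hτj]
    have e1 : ∀ t, Function.update (multiIndex α v τ) j t
        = multiIndex α v (Function.update τ j t) := by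
      intro t
      funext i
      rcases eq_or_ne i j with rfl | hij
      · simp [multiIndex, hjv]
      · simp [multiIndex, hij]
    have e2 : Function.update (multiIndex α v τ) j α = multiIndex α (insert j v) τ := by
      funext i
      rcases eq_or_ne i j with rfl | hij
      · simp [multiIndex]
      · simp [multiIndex, hij]
    have hself : h = Function.update h j (f j) := by
      rw [← hhR j (by simp), Function.update_eq_self]
    have hνself : multiIndex α v τ = Function.update (multiIndex α v τ) j 0 := by
      rw [← hνj, Function.update_eq_self]
    rw [hself, hνself, hD.pairing_ibp hν j (by omega) hh (hfm j hju) (hf0 j hju), norm_neg,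
      Finset.prod_insert hjR, mul_assoc]
    have hupd : ∀ w : ℝ → ℂ, IsBddMeas w → ∀ i, IsBddMeas (Function.update h j w i) := by
      intro w hw i
      rcases eq_or_ne i j with rfl | hij
      · rwa [Function.update_self]
      · rw [Function.update_of_ne hij]; exact hh i
    have hmem' : ∀ i, i ≠ j → (i ∈ v ∪ insert j R ↔ i ∈ v ∪ R) := fun i hij => by simp [hij]
    have hmem : ∀ i, i ≠ j → (i ∈ u \ (v ∪ insert j R) ↔ i ∈ u \ (v ∪ R)) := fun i hij => by
      rw [Finset.mem_sdiff, Finset.mem_sdiff, hmem' i hij]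
    have hmemR : ∀ i ∈ R, i ≠ j := fun i hi => ne_of_mem_of_not_mem hi hjR
    have hmemv : ∀ i ∈ v, i ≠ j := fun i hi => ne_of_mem_of_not_mem hi hjv
    refine (hfc j hju).norm_pairing_le hD hν j hh le_rfl (by omega) (fun t ht1 htα => ?_)
      (fun w d' hw hd' => ?_)
    -- A constant was split off in coordinate `j`: it joins `u \ v` with `τ j = t`.
    · rw [e1]
      refine ih v _ hvR hvRu ?_ ?_ (hupd _ (isBddMeas_const 1)) ?_ ?_ ?_
      · intro i hi
        rcases eq_or_ne i j with rfl | hij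
        · rw [Function.update_self]; exact Finset.mem_Icc.mpr ⟨ht1, htα⟩
        · rw [Function.update_of_ne hij]
          exact hτ i ((hmem i hij).mpr hi)
      · intro i hi
        rcases eq_or_ne i j with rfl | hij
        · simp [hju, hjv, hjR] at hi
        · rw [Function.update_of_ne hij]
          exact hτ0 i (mt (hmem i hij).mp hi)
      · intro i hi
        rw [Function.update_of_ne (hmemR i hi)]
        exact hhR i (Finset.mem_insert_of_mem hi)
      · intro i hi
        rcases eq_or_ne i j with rfl | hij
        · rw [Function.update_self]
        · rw [Function.update_of_ne hij]
          exact hh1 i (mt (hmem' i hij).mp hi)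
      · intro i hi
        rw [Function.update_of_ne (hmemv i hi)]
        exact hhv i hi
    -- The final remainder was reached in coordinate `j`: it joins `v`, with order `α` and bound
    -- `d'`.
    · rw [e2]
      have hins : insert j v ∪ R = v ∪ insert j R := by
        rw [Finset.insert_union, Finset.union_insert]
      have h3 := ih (insert j v) τ (Finset.disjoint_insert_left.mpr ⟨hjR, hvR⟩) (by rwa [hins])
        (by rwa [hins]) (by rwa [hins]) (hupd w hw) (d := Function.update d j d') ?_ ?_ ?_
      · rw [Finset.prod_insert hjv, Function.update_self] at h3
        have e3 : ∏ i ∈ v, Function.update d j d' i = ∏ i ∈ v, d i :=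
          Finset.prod_congr rfl fun i hi => Function.update_of_ne (hmemv i hi) _ _
        rw [e3] at h3
        refine h3.trans (le_of_eq ?_)
        ring
      · intro i hi
        rw [Function.update_of_ne (hmemR i hi)]
        exact hhR i (Finset.mem_insert_of_mem hi)
      · intro i hi
        rw [hins] at hi
        have hij : i ≠ j := by
          rintro rfl
          simp at hi
        rw [Function.update_of_ne hij]
        exact hh1 i hi
      · intro i hi x
        rcases eq_or_ne i j with rfl | hij
        · simp only [Function.update_self]; exact hd' x
        · simp only [Function.update_of_ne hij]
          exact hhv i (Finset.mem_of_mem_insert_of_ne hi hij) x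

end coefficient

/-! ### The Walsh kernel -/

section kernel
variable {b : ℕ} [NeZero b]

lemma sum_chi_mul_range (z : ZMod b) :
    ∑ c ∈ Finset.range b, chi ((c : ZMod b) * z) = if z = 0 then (b : ℂ) else 0 := by
  split_ifs with h
  · simp [h]
  · have e : ∀ c : ℕ, chi ((c : ZMod b) * z) = chi z ^ c := by
      intro c
      induction c with
      | zero => simp
      | succ c ih => rw [pow_succ, ← ih, ← chi_add]; congr 1; push_cast; ring
    rw [Finset.sum_congr rfl fun c _ => e c, geom_sum_eq (chi_ne_one h), ← e]
    simp

/-- The Walsh reproducing kernel of level `l`. -/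
def kern (b : ℕ) [NeZero b] (l : ℕ) (x y : ℝ) : ℂ :=
  ∑ k ∈ Finset.range (b ^ l), walsh b k x * (starRingEnd ℂ) (walsh b k y)

lemma sum_range_pow_succ {M : Type*} [AddCommMonoid M] (f : ℕ → M) (l : ℕ) :
    ∑ k ∈ Finset.range (b ^ (l + 1)), f k
      = ∑ κ ∈ Finset.range b, ∑ K ∈ Finset.range (b ^ l), f (κ * b ^ l + K) := by
  have hpos : 0 < b ^ l := pow_pos (NeZero.pos b) l
  rw [← Finset.sum_product']
  refine Finset.sum_nbij' (fun k => (k / b ^ l, k % b ^ l)) (fun p => p.1 * b ^ l + p.2) ?_ ?_ ?_ ?_ ?_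
  · intro k hk
    rw [Finset.mem_range, pow_succ'] at hk
    simp only [Finset.mem_product, Finset.mem_range]
    exact ⟨(Nat.div_lt_iff_lt_mul hpos).mpr hk, Nat.mod_lt _ hpos⟩
  · intro p hp
    simp only [Finset.mem_product, Finset.mem_range] at hp ⊢
    exact peel_lt hp.1 hp.2
  · intro k _
    exact Nat.div_add_mod' k _
  · intro p hp
    simp only [Finset.mem_product, Finset.mem_range] at hp
    ext
    · simp only
      rw [add_comm, Nat.add_mul_div_right _ _ hpos, Nat.div_eq_of_lt hp.2, zero_add]
    · simp only
      rw [add_comm, Nat.add_mul_mod_self_right, Nat.mod_eq_of_lt hp.2]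
  · intro k _
    rw [Nat.div_add_mod' k]

lemma floor_div_base (x : ℝ) (l : ℕ) :
    ⌊x * (b : ℝ) ^ l⌋ = ⌊x * (b : ℝ) ^ (l + 1)⌋ / (b : ℤ) := by
  have hb0 : (b : ℝ) ≠ 0 := by exact_mod_cast NeZero.ne b
  rw [← Int.floor_div_natCast]
  congr 1
  rw [pow_succ]
  field_simp

/-- The sum over the top digit of `k` is a full character sum, equal to `b` or `0` according to
whether the newest digits of `x` and `y` agree. -/
lemma kern_eq (hb : 2 ≤ b) (l : ℕ) {x y : ℝ} (hx : x ∈ Set.Ico (0 : ℝ) 1)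
    (hy : y ∈ Set.Ico (0 : ℝ) 1) :
    kern b l x y = if ⌊x * (b : ℝ) ^ l⌋ = ⌊y * (b : ℝ) ^ l⌋ then (b : ℂ) ^ l else 0 := by
  induction l with
  | zero =>
    have h1 : ⌊x⌋ = 0 := Int.floor_eq_zero_iff.mpr hx
    have h2 : ⌊y⌋ = 0 := Int.floor_eq_zero_iff.mpr hy
    simp [kern, walsh_zero, h1, h2]
  | succ l ih =>
    set p : ℤ := ⌊x * (b : ℝ) ^ (l + 1)⌋ with hp
    set q : ℤ := ⌊y * (b : ℝ) ^ (l + 1)⌋ with hq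
    have e : kern b (l + 1) x y
        = (∑ κ ∈ Finset.range b, chi ((κ : ZMod b) * ((p : ZMod b) - (q : ZMod b)))) * kern b l x y := by
      rw [kern, sum_range_pow_succ, kern, Finset.sum_mul_sum]
      refine Finset.sum_congr rfl fun κ hκ => Finset.sum_congr rfl fun K hK => ?_
      rw [Finset.mem_range] at hκ hK
      rw [walsh_peel hb hκ hK, walsh_peel hb hκ hK, map_mul, conj_chi, mul_sub, sub_eq_add_neg,
        chi_add]
      ring
    rw [e, ih, sum_chi_mul_range, floor_div_base x, floor_div_base y, ← hp, ← hq]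
    have hiff : ((p : ZMod b) - (q : ZMod b) = 0) ↔ p % b = q % b := by
      rw [sub_eq_zero, ZMod.intCast_eq_intCast_iff']
    by_cases hpq : p = q
    · simp [hpq, pow_succ']
    · rw [if_neg hpq]
      by_cases h1 : p % b = q % b
      · have h2 : p / b ≠ q / b := fun h2 => hpq (by
          rw [← Int.mul_ediv_add_emod p b, ← Int.mul_ediv_add_emod q b, h1, h2])
        rw [if_neg h2, mul_zero]
      · rw [if_neg (mt hiff.mp h1), zero_mul]

lemma isBddMeas_kern (hb : 2 ≤ b) (l : ℕ) (y : ℝ) : IsBddMeas fun x => kern b l x y := by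
  refine ⟨Finset.measurable_sum _ fun k _ => (isBddMeas_walsh hb k).1.mul_const _,
    ∑ k ∈ Finset.range (b ^ l), 1, fun x => (norm_sum_le _ _).trans (Finset.sum_le_sum fun k _ => ?_)⟩
  rw [norm_mul, RCLike.norm_conj, norm_walsh, norm_walsh, mul_one]

lemma prim_kern (hb : 2 ≤ b) (l : ℕ) (y : ℝ) : prim (fun x => kern b l x y) 1 = 1 := by
  unfold kern
  rw [prim, intervalIntegral.integral_finsetSum fun k _ =>
    ((isBddMeas_walsh hb k).intervalIntegrable _ _).mul_const _]
  simp only [intervalIntegral.integral_mul_const]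
  rw [Finset.sum_eq_single 0]
  · simp [walsh_zero]
  · intro k _ hk
    have := prim_walsh hb hk
    rw [prim] at this
    rw [this, zero_mul]
  · intro h
    exact absurd (Finset.mem_range.mpr (pow_pos (NeZero.pos b) l)) h

/-- The kernel is nonnegative almost everywhere on `[0,1]`, so its `L_1` norm equals its integral.
-/
lemma integral_norm_kern (hb : 2 ≤ b) (l : ℕ) {y : ℝ} (hy : y ∈ Set.Ico (0 : ℝ) 1) :
    ∫ x in Set.Icc (0 : ℝ) 1, ‖kern b l x y‖ = 1 := by
  have h := prim_kern hb l y
  rw [prim, intervalIntegral.integral_of_le zero_le_one, ← integral_Icc_eq_integral_Ioc] at h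
  have h2 : ∫ x in Set.Icc (0 : ℝ) 1, kern b l x y
      = ∫ x in Set.Icc (0 : ℝ) 1, ((‖kern b l x y‖ : ℝ) : ℂ) := by
    refine setIntegral_congr_ae measurableSet_Icc ?_
    have h1 : ∀ᵐ t : ℝ, t ≠ 1 := by simp [ae_iff, measure_singleton]
    filter_upwards [h1] with x hx hmem
    rw [kern_eq hb l ⟨hmem.1, lt_of_le_of_ne hmem.2 hx⟩ hy]
    split_ifs <;> simp
  rw [h2] at h
  have h3 := integral_ofReal (𝕜 := ℂ) (μ := volume.restrict (Set.Icc (0 : ℝ) 1))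
    (f := fun x => ‖kern b l x y‖)
  exact Complex.ofReal_eq_one.mp (h3.symm.trans h)

/-! ### Convergence of partial Walsh sums -/

variable {s : ℕ}

/-- The multi-indices with entries below `b ^ l`. -/
def box (s b l : ℕ) : Finset (Fin s → ℕ) := Fintype.piFinset fun _ => Finset.range (b ^ l)

/-- The partial Walsh sum of level `l`. -/
def partialSum (b : ℕ) [NeZero b] (l : ℕ) (F : (Fin s → ℝ) → ℝ) (y : Fin s → ℝ) : ℂ :=
  ∑ k ∈ box s b l, pairing F (fun j => walsh b (k j)) *
    (starRingEnd ℂ) (tensor (fun j => walsh b (k j)) y)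

lemma partialSum_eq (hb : 2 ≤ b) (l : ℕ) {F : (Fin s → ℝ) → ℝ} (hF : IntegrableOn F (cube s))
    (y : Fin s → ℝ) :
    partialSum b l F y = pairing F fun j x => kern b l x (y j) := by
  have e : ∀ x : Fin s → ℝ, (F x : ℂ) * tensor (fun j x => kern b l x (y j)) x
      = ∑ k ∈ box s b l, (F x : ℂ) * tensor (fun j => walsh b (k j)) x *
        (starRingEnd ℂ) (tensor (fun j => walsh b (k j)) y) := by
    intro x
    simp only [tensor, kern]
    rw [Finset.prod_univ_sum, Finset.mul_sum]
    refine Finset.sum_congr rfl fun k _ => ?_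
    rw [Finset.prod_mul_distrib, map_prod, mul_assoc]
  have hi : ∀ k ∈ box s b l, Integrable (fun x => (F x : ℂ) * tensor (fun j => walsh b (k j)) x *
      (starRingEnd ℂ) (tensor (fun j => walsh b (k j)) y)) (volume.restrict (cube s)) := by
    intro k _
    exact Integrable.mul_const (integrable_mul_tensor hF fun j => isBddMeas_walsh hb (k j)) _
  rw [partialSum, pairing]
  simp only [e]
  rw [integral_finsetSum _ hi]
  refine Finset.sum_congr rfl fun k _ => ?_
  rw [integral_mul_const, pairing]

lemma integral_norm_tensor_kern (hb : 2 ≤ b) (l : ℕ) {y : Fin s → ℝ}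
    (hy : ∀ j, y j ∈ Set.Ico (0 : ℝ) 1) :
    ∫ x in cube s, ‖tensor (fun j x => kern b l x (y j)) x‖ = 1 := by
  simp only [tensor, norm_prod]
  rw [restrict_cube, integral_fintype_prod_eq_prod (𝕜 := ℝ)
    (f := fun j x => ‖kern b l x (y j)‖)]
  exact Finset.prod_eq_one fun j _ => integral_norm_kern hb l (hy j)

lemma ae_cube_mem_Ico (s : ℕ) :
    ∀ᵐ x ∂((volume : Measure (Fin s → ℝ)).restrict (cube s)), ∀ j, x j ∈ Set.Ico (0 : ℝ) 1 := by
  rw [restrict_cube]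
  refine Filter.eventually_all.2 fun i => (Measure.tendsto_eval_ae_ae
    (μ := fun _ : Fin s => (volume : Measure ℝ).restrict (Set.Icc (0 : ℝ) 1))).eventually
      (p := fun t : ℝ => t ∈ Set.Ico (0 : ℝ) 1) ?_
  rw [ae_restrict_iff' measurableSet_Icc]
  have h1 : ∀ᵐ t : ℝ, t ≠ 1 := by simp [ae_iff, measure_singleton]
  filter_upwards [h1] with t ht hmem
  exact ⟨hmem.1, lt_of_le_of_ne hmem.2 ht⟩

lemma pairing_kern_one (hb : 2 ≤ b) (l : ℕ) (y : Fin s → ℝ) :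
    ∫ x in cube s, tensor (fun j x => kern b l x (y j)) x = 1 := by
  simp only [tensor]
  rw [restrict_cube, integral_fintype_prod_eq_prod (𝕜 := ℂ)
    (f := fun j x => kern b l x (y j))]
  refine Finset.prod_eq_one fun j _ => ?_
  have h := prim_kern hb l (y j)
  rwa [prim, intervalIntegral.integral_of_le zero_le_one, ← integral_Icc_eq_integral_Ioc] at h

/-- The partial Walsh sums of a continuous function converge on `[0,1)^s`. -/
lemma tendsto_partialSum (hb : 2 ≤ b) {F : (Fin s → ℝ) → ℝ} (hF : ContinuousOn F (cube s))
    {y : Fin s → ℝ} (hy : ∀ j, y j ∈ Set.Ico (0 : ℝ) 1) :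
    Filter.Tendsto (fun l => partialSum b l F y) Filter.atTop (nhds (F y : ℂ)) := by
  have hcomp : IsCompact (cube s) := isCompact_Icc
  have hFi : IntegrableOn F (cube s) := hF.integrableOn_compact hcomp
  have hyc : y ∈ cube s := ⟨fun j => (hy j).1, fun j => (hy j).2.le⟩
  have hb1 : (1 : ℝ) < b := by exact_mod_cast (by omega : 1 < b)
  rw [Metric.tendsto_atTop]
  intro ε hε
  obtain ⟨δ, hδ, hFδ⟩ := Metric.continuousOn_iff.mp hF y hyc (ε / 2) (by positivity)
  obtain ⟨L, hL⟩ := exists_pow_lt_of_lt_one hδ (show (b : ℝ)⁻¹ < 1 from inv_lt_one_of_one_lt₀ hb1)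
  refine ⟨L, fun l hl => ?_⟩
  have hlδ : ((b : ℝ) ^ l)⁻¹ < δ := by
    refine lt_of_le_of_lt ?_ hL
    rw [inv_pow]
    gcongr
    exact hb1.le
  have hk : ∀ i, IsBddMeas ((fun j x => kern b l x (y j)) i) := fun i => isBddMeas_kern hb l (y i)
  have hti : IntegrableOn (tensor fun j x => kern b l x (y j)) (cube s) := by
    simpa using integrable_mul_tensor (G := fun _ => (1 : ℝ)) (integrable_const _) hk
  have e : partialSum b l F y - F y
      = ∫ x in cube s, ((F x : ℂ) - F y) * tensor (fun j x => kern b l x (y j)) x := by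
    simp only [sub_mul]
    rw [integral_sub (integrable_mul_tensor hFi hk) (hti.const_mul _), integral_const_mul,
      pairing_kern_one hb l y, mul_one, partialSum_eq hb l hFi, pairing]
  rw [dist_eq_norm, e]
  have hle : ‖∫ x in cube s, ((F x : ℂ) - F y) * tensor (fun j x => kern b l x (y j)) x‖
      ≤ ∫ x in cube s, ε / 2 * ‖tensor (fun j x => kern b l x (y j)) x‖ := by
    refine norm_integral_le_of_norm_le (hti.norm.const_mul _) ?_
    filter_upwards [ae_cube_mem_Ico s] with x hx
    rw [norm_mul]
    by_cases hz : tensor (fun j x => kern b l x (y j)) x = 0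
    · simp [hz]
    gcongr
    rw [← Complex.ofReal_sub, Complex.norm_real]
    refine (hFδ x ⟨fun j => (hx j).1, fun j => (hx j).2.le⟩ ?_).le
    -- Where the kernel does not vanish, `x` and `y` share a `b`-adic box of side `b^{-l}`, and
    -- continuity at `y` controls the integrand.
    refine (dist_pi_lt_iff hδ).mpr fun j => lt_of_le_of_lt ?_ hlδ
    have hj : kern b l (x j) (y j) ≠ 0 := fun h => hz (Finset.prod_eq_zero (Finset.mem_univ j) h)
    rw [kern_eq hb l (hx j) (hy j)] at hj
    have hfl : ⌊x j * (b : ℝ) ^ l⌋ = ⌊y j * (b : ℝ) ^ l⌋ := by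
      by_contra h
      exact hj (if_neg h)
    have habs := Int.abs_sub_lt_one_of_floor_eq_floor hfl
    have hp := pow_cast_pos (b := b) l
    rw [← sub_mul, abs_mul, abs_of_pos hp] at habs
    rw [Real.dist_eq, inv_eq_one_div, le_div_iff₀ hp]
    exact habs.le
  rw [integral_const_mul, integral_norm_tensor_kern hb l hy] at hle
  linarith

end kernel

/-! ### Digits of real numbers -/

section digits
variable {b : ℕ}

lemma ofDigits_eq_head_add_tail (d : ℕ → Fin b) :
    Real.ofDigits d = ((d 0 : ℕ) : ℝ) / b + (b : ℝ)⁻¹ * Real.ofDigits fun i => d (i + 1) := by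
  rw [Real.ofDigits_eq_sum_add_ofDigits d 1]
  simp [Real.ofDigitsTerm, div_eq_mul_inv]

lemma ofDigits_lt_one {d : ℕ → Fin b} {i : ℕ} (h : (d i : ℕ) + 1 < b) : Real.ofDigits d < 1 := by
  have hb : (0 : ℝ) < b := by exact_mod_cast (by omega : 0 < b)
  induction i generalizing d with
  | zero =>
    rw [ofDigits_eq_head_add_tail, inv_mul_eq_div, ← add_div, div_lt_one hb]
    have h1 := Real.ofDigits_le_one fun i => d (i + 1)
    have h2 : ((d 0 : ℕ) : ℝ) + 1 < b := by exact_mod_cast h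
    linarith
  | succ i ih =>
    rw [ofDigits_eq_head_add_tail, inv_mul_eq_div, ← add_div, div_lt_one hb]
    have h1 := ih (d := fun i => d (i + 1)) h
    have h2 : ((d 0 : ℕ) : ℝ) + 1 ≤ b := by exact_mod_cast (d 0).isLt
    linarith

lemma ofDigits_mem_Ico {d : ℕ → Fin b} {i : ℕ} (h : (d i : ℕ) + 1 < b) :
    Real.ofDigits d ∈ Set.Ico (0 : ℝ) 1 := ⟨Real.ofDigits_nonneg d, ofDigits_lt_one h⟩

/-- The integer with the first `n` digits of a digit sequence. -/
def leadingInt (d : ℕ → Fin b) : ℕ → ℕ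
  | 0 => 0
  | n + 1 => b * leadingInt d n + d n

lemma pow_mul_sum_ofDigitsTerm (hb : b ≠ 0) (d : ℕ → Fin b) (n : ℕ) :
    (b : ℝ) ^ n * ∑ i ∈ Finset.range n, Real.ofDigitsTerm d i = leadingInt d n := by
  have hb' : (b : ℝ) ≠ 0 := by exact_mod_cast hb
  induction n with
  | zero => simp [leadingInt]
  | succ n ih =>
    rw [Finset.sum_range_succ, mul_add, pow_succ', mul_assoc, ih, Real.ofDigitsTerm, leadingInt,
      ← pow_succ']
    push_cast
    field_simp

/-- The tail after `n` digits is strictly below `1`, since some later digit is not maximal; no carry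
reaches the leading digits. -/
lemma floor_ofDigits {d : ℕ → Fin b} (hd : ∀ n, ∃ i ≥ n, (d i : ℕ) + 1 < b) (n : ℕ) :
    ⌊Real.ofDigits d * (b : ℝ) ^ n⌋ = (leadingInt d n : ℤ) := by
  obtain ⟨i, hi, hdi⟩ := hd n
  have hb : b ≠ 0 := by omega
  have hb' : (b : ℝ) ≠ 0 := by exact_mod_cast hb
  have h1 : Real.ofDigits (fun i => d (i + n)) ∈ Set.Ico (0 : ℝ) 1 :=
    ofDigits_mem_Ico (i := i - n) (by simpa [Nat.sub_add_cancel hi] using hdi)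
  have e : Real.ofDigits d * (b : ℝ) ^ n
      = ((leadingInt d n : ℤ) : ℝ) + Real.ofDigits fun i => d (i + n) := by
    rw [Real.ofDigits_eq_sum_add_ofDigits d n, Int.cast_natCast, ← pow_mul_sum_ofDigitsTerm hb]
    field_simp
  rw [e, Int.floor_intCast_add, Int.floor_eq_zero_iff.mpr h1, add_zero]

/-- The `i`-th digit of a real number, as an element of `ℤ_b`. -/
def realDigit (b : ℕ) (x : ℝ) (i : ℕ) : ZMod b := ((⌊x * (b : ℝ) ^ (i + 1)⌋ : ℤ) : ZMod b)

lemma realDigit_ofDigits {d : ℕ → Fin b} (hd : ∀ n, ∃ i ≥ n, (d i : ℕ) + 1 < b) (i : ℕ) :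
    realDigit b (Real.ofDigits d) i = ((d i : ℕ) : ZMod b) := by
  rw [realDigit, floor_ofDigits hd, leadingInt]
  simp

variable [NeZero b]

lemma natCast_digits {x : ℝ} (hx : 0 ≤ x) (i : ℕ) :
    (((Real.digits x b i : Fin b) : ℕ) : ZMod b) = realDigit b x i := by
  have h : (0 : ℝ) ≤ x * (b : ℝ) ^ (i + 1) := by positivity
  rw [Real.digits, realDigit, Fin.val_ofNat, ZMod.natCast_mod, ← Int.natCast_floor_eq_floor h]
  simp

lemma digits_not_eventually_last (hb : 2 ≤ b) {x : ℝ} (hx : x ∈ Set.Ico (0 : ℝ) 1) (n : ℕ) :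
    ∃ i ≥ n, ((Real.digits x b i : Fin b) : ℕ) + 1 < b := by
  by_contra! h
  have hb' : (b : ℝ) ≠ 0 := by exact_mod_cast NeZero.ne b
  have h1 := Real.ofDigits_digits (b := b) (by omega) hx
  have h2 : (fun i => Real.digits x b (i + n)) = fun _ => ⟨b - 1, by omega⟩ := by
    funext i
    apply Fin.ext
    have h3 := h (i + n) (by omega)
    have h4 := (Real.digits x b (i + n)).isLt
    show ((Real.digits x b (i + n) : Fin b) : ℕ) = b - 1
    omega
  rw [Real.ofDigits_eq_sum_add_ofDigits _ n, h2, Real.ofDigits_const_last_eq_one' (by omega),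
    mul_one] at h1
  -- If all digits from `n` on were `b - 1`, then `b^n x` would equal its floor plus one.
  have h3 := Real.ofDigits_digits_sum_eq (b := b) hx n
  have h4 := Nat.lt_floor_add_one ((b : ℝ) ^ n * x)
  rw [← h3] at h4
  nth_rewrite 1 [← h1] at h4
  rw [mul_add, mul_inv_cancel₀ (pow_ne_zero _ hb')] at h4
  exact lt_irrefl _ h4

end digits

/-! ### Walsh functions at the points of a shifted digital net -/

section net
variable {b : ℕ} [NeZero b] {s α m : ℕ}

/-- The digits of `y j` vanish eventually, so the digitwise sum ends like `σ j` and is not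
eventually `b - 1`. It is therefore the true expansion of the shifted point, for every `σ` and not
merely almost every one. -/
lemma shift_spec (hb : 2 ≤ b) {y σ : Fin s → ℝ} (j : Fin s) (hy : y j ∈ Set.Ico (0 : ℝ) 1)
    (hσ : σ j ∈ Set.Ico (0 : ℝ) 1) {L : ℕ} (hL : ∀ i ≥ L, Real.digits (y j) b i = 0) :
    digitalShift b y σ j ∈ Set.Ico (0 : ℝ) 1 ∧ ∀ i,
      realDigit b (digitalShift b y σ j) i = realDigit b (y j) i + realDigit b (σ j) i := by
  have hd : ∀ n, ∃ i ≥ n, ((Real.digits (y j) b i + Real.digits (σ j) b i : Fin b) : ℕ) + 1 < b := by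
    intro n
    obtain ⟨i, hi, hdi⟩ := digits_not_eventually_last hb hσ (max n L)
    refine ⟨i, (le_max_left _ _).trans hi, ?_⟩
    rwa [hL i ((le_max_right _ _).trans hi), zero_add]
  obtain ⟨i, -, hi⟩ := hd 0
  refine ⟨ofDigits_mem_Ico hi, fun i => ?_⟩
  rw [digitalShift, realDigit_ofDigits hd, Fin.val_add, ZMod.natCast_mod, Nat.cast_add,
    natCast_digits hy.1, natCast_digits hσ.1]

/-- The digits of the points of a digital net. -/
def netDigits (C : Fin s → Matrix (Fin (α * m)) (Fin m) (ZMod b)) (n : ℕ) (j : Fin s) (i : ℕ) :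
    Fin b :=
  if h : i < α * m then ⟨((C j *ᵥ digitVec b m n) ⟨i, h⟩).val, ZMod.val_lt _⟩ else 0

variable (C : Fin s → Matrix (Fin (α * m)) (Fin m) (ZMod b))

lemma digitalNet_eq_ofDigits (n : ℕ) (j : Fin s) :
    digitalNet b α m C n j = Real.ofDigits (netDigits C n j) := by
  rw [Real.ofDigits, tsum_eq_sum (s := Finset.range (α * m)), Finset.sum_range, digitalNet]
  · refine Finset.sum_congr rfl fun i _ => ?_
    simp [Real.ofDigitsTerm, netDigits, div_eq_mul_inv]
  · intro i hi
    rw [Finset.mem_range] at hi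
    simp [Real.ofDigitsTerm, netDigits, hi]

lemma netDigits_not_eventually_last (hb : 2 ≤ b) (n : ℕ) (j : Fin s) (l : ℕ) :
    ∃ i ≥ l, ((netDigits C n j i : Fin b) : ℕ) + 1 < b := by
  refine ⟨max l (α * m), le_max_left _ _, ?_⟩
  have : ¬ max l (α * m) < α * m := by simp
  rw [netDigits, dif_neg this]
  rw [Fin.val_zero]
  omega

lemma digitalNet_mem_Ico (hb : 2 ≤ b) (n : ℕ) (j : Fin s) :
    digitalNet b α m C n j ∈ Set.Ico (0 : ℝ) 1 := by
  obtain ⟨i, -, hi⟩ := netDigits_not_eventually_last C hb n j 0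
  rw [digitalNet_eq_ofDigits]
  exact ofDigits_mem_Ico hi

lemma realDigit_digitalNet (hb : 2 ≤ b) (n : ℕ) (j : Fin s) (i : ℕ) :
    realDigit b (digitalNet b α m C n j) i
      = if h : i < α * m then (C j *ᵥ digitVec b m n) ⟨i, h⟩ else 0 := by
  rw [digitalNet_eq_ofDigits, realDigit_ofDigits (netDigits_not_eventually_last C hb n j), netDigits]
  split_ifs <;> simp

lemma digits_digitalNet (hb : 2 ≤ b) (n : ℕ) (j : Fin s) {i : ℕ} (hi : α * m ≤ i) :
    Real.digits (digitalNet b α m C n j) b i = 0 := by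
  have h := natCast_digits (b := b) (digitalNet_mem_Ico C hb n j).1 i
  rw [realDigit_digitalNet C hb, dif_neg (not_lt.mpr hi), ZMod.natCast_eq_zero_iff] at h
  apply Fin.ext
  exact Nat.eq_zero_of_dvd_of_lt h (Fin.isLt _)

lemma digitalShift_zero (hb : 2 ≤ b) (n : ℕ) :
    digitalShift b (digitalNet b α m C n) 0 = digitalNet b α m C n := by
  funext j
  have h0 : ∀ i, Real.digits ((0 : Fin s → ℝ) j) b i = 0 := fun i => by simp [Real.digits]
  simp only [digitalShift, h0, add_zero]
  exact Real.ofDigits_digits (by omega) (digitalNet_mem_Ico C hb n j)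

/-- The image of a multi-index under the transposed generating matrices. -/
def dualVec (k : Fin s → ℕ) : Fin m → ZMod b := ∑ j, (C j)ᵀ *ᵥ digitVec b (α * m) (k j)

lemma sum_natDigit_mul_netDigit (hb : 2 ≤ b) (n : ℕ) (j : Fin s) (k : ℕ) :
    ∑ i ∈ Finset.range k, (natDigit b k i : ZMod b) * realDigit b (digitalNet b α m C n j) i
      = digitVec b (α * m) k ⬝ᵥ (C j *ᵥ digitVec b m n) := by
  have hk : k < b ^ max k (α * m) := (Nat.lt_pow_self (by omega : 1 < b)).trans_le
    (Nat.pow_le_pow_right (by omega) (le_max_left _ _))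
  rw [sum_natDigit_mul hb hk, ← Finset.sum_subset (Finset.range_mono (le_max_right k (α * m))),
    Finset.sum_range, dotProduct]
  · refine Finset.sum_congr rfl fun i _ => ?_
    rw [realDigit_digitalNet C hb, dif_pos i.isLt]
    rfl
  · intro i _ hi
    rw [realDigit_digitalNet C hb, dif_neg (by simpa using hi), mul_zero]

/-- Walsh functions are characters in the digits, so the shift factors out. Transposing the matrices
moves them from the digits of `n` to those of `k`. -/
lemma tensor_walsh_shift (hb : 2 ≤ b) {σ : Fin s → ℝ} (hσ : ∀ j, σ j ∈ Set.Ico (0 : ℝ) 1)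
    (k : Fin s → ℕ) (n : ℕ) :
    tensor (fun j => walsh b (k j)) (digitalShift b (digitalNet b α m C n) σ)
      = tensor (fun j => walsh b (k j)) σ * chi (dualVec C k ⬝ᵥ digitVec b m n) := by
  have h : dualVec C k ⬝ᵥ digitVec b m n
      = ∑ j, digitVec b (α * m) (k j) ⬝ᵥ (C j *ᵥ digitVec b m n) := by
    rw [dualVec, sum_dotProduct]
    refine Finset.sum_congr rfl fun j _ => ?_
    rw [Matrix.mulVec_transpose, Matrix.dotProduct_mulVec]
  rw [h, chi_sum, tensor, tensor, ← Finset.prod_mul_distrib]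
  refine Finset.prod_congr rfl fun j _ => ?_
  have hs := (shift_spec hb j (digitalNet_mem_Ico C hb n j) (hσ j)
    (fun i hi => digits_digitalNet C hb n j hi)).2
  have hw : ∀ x : ℝ, walsh b (k j) x
      = chi (∑ i ∈ Finset.range (k j), (natDigit b (k j) i : ZMod b) * realDigit b x i) :=
    fun x => rfl
  rw [hw, hw, ← sum_natDigit_mul_netDigit C hb, ← chi_add, ← Finset.sum_add_distrib]
  congr 1
  refine Finset.sum_congr rfl fun i _ => ?_
  rw [hs, mul_add, add_comm]

/-- As `n` runs below `b^m` its digit vector runs over all of `ℤ_b^m`, and the sum factors over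
coordinates; one with `w i₀ ≠ 0` contributes `0`. -/
lemma sum_chi_dotProduct {w : Fin m → ZMod b} (hw : w ≠ 0) :
    ∑ n ∈ Finset.range (b ^ m), chi (w ⬝ᵥ digitVec b m n) = 0 := by
  obtain ⟨i₀, hi₀⟩ := Function.ne_iff.mp hw
  rw [Pi.zero_apply] at hi₀
  have hdig : ∀ (g : Fin m → Fin b) (i : Fin m),
      natDigit b (finFunctionFinEquiv g : ℕ) i = g i := by
    intro g i
    conv_rhs => rw [← finFunctionFinEquiv.symm_apply_apply g]
    rfl
  rw [Finset.sum_range, ← finFunctionFinEquiv.sum_comp]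
  have e : ∀ g : Fin m → Fin b,
      chi (w ⬝ᵥ digitVec b m (finFunctionFinEquiv g)) = ∏ i, chi (((g i : ℕ) : ZMod b) * w i) := by
    intro g
    rw [dotProduct, chi_sum]
    refine Finset.prod_congr rfl fun i _ => ?_
    rw [digitVec, hdig, mul_comm]
  simp only [e]
  have hp := Finset.prod_univ_sum (fun _ : Fin m => (Finset.univ : Finset (Fin b)))
    (fun i c => chi (((c : ℕ) : ZMod b) * w i))
  rw [Fintype.piFinset_univ] at hp
  rw [← hp]
  refine Finset.prod_eq_zero (Finset.mem_univ i₀) ?_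
  have := sum_chi_mul_range (w i₀)
  rw [if_neg hi₀, Finset.sum_range] at this
  exact this

/-- The average of a Walsh function over a shifted digital net. -/
lemma norm_sum_walsh_shift_le (hb : 2 ≤ b) {σ : Fin s → ℝ} (hσ : ∀ j, σ j ∈ Set.Ico (0 : ℝ) 1)
    (k : Fin s → ℕ) :
    ‖∑ n ∈ Finset.range (b ^ m), (starRingEnd ℂ) (tensor (fun j => walsh b (k j))
      (digitalShift b (digitalNet b α m C n) σ))‖ ≤ if dualVec C k = 0 then (b : ℝ) ^ m else 0 := by
  rw [← map_sum, RCLike.norm_conj]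
  simp only [tensor_walsh_shift C hb hσ]
  split_ifs with h
  · refine (norm_sum_le _ _).trans (le_of_eq ?_)
    simp [h, tensor, norm_walsh]
  · rw [← Finset.mul_sum, sum_chi_dotProduct h, mul_zero, norm_zero]

/-- The error of a shifted digital net is bounded by Walsh coefficients over the dual net. -/
lemma quadratureError_le (hb : 2 ≤ b) {σ : Fin s → ℝ} (hσ : ∀ j, σ j ∈ Set.Ico (0 : ℝ) 1)
    {F : (Fin s → ℝ) → ℝ} (hF : ContinuousOn F (cube s)) {E : ℝ}
    (hE : ∀ l, ∑ k ∈ (box s b l).filter (fun k => k ≠ 0 ∧ dualVec C k = 0),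
      ‖pairing F fun j => walsh b (k j)‖ ≤ E) :
    quadratureError (b ^ m) (fun n => digitalShift b (digitalNet b α m C n) σ) F ≤ E := by
  set P : ℕ → Fin s → ℝ := fun n => digitalShift b (digitalNet b α m C n) σ with hP
  have hPmem : ∀ n j, P n j ∈ Set.Ico (0 : ℝ) 1 := fun n j =>
    (shift_spec hb j (digitalNet_mem_Ico C hb n j) (hσ j)
      (fun i hi => digits_digitalNet C hb n j hi)).1
  have hbm : (0 : ℝ) < (b : ℝ) ^ m := pow_cast_pos m
  set I : ℂ := ∫ x in cube s, (F x : ℂ) with hI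
  have hlim : Filter.Tendsto (fun l => 1 / ((b ^ m : ℕ) : ℂ) *
      ∑ n ∈ Finset.range (b ^ m), partialSum b l F (P n) - I) Filter.atTop
      (nhds (1 / ((b ^ m : ℕ) : ℂ) * ∑ n ∈ Finset.range (b ^ m), (F (P n) : ℂ) - I)) :=
    ((tendsto_finsetSum _ fun n _ => tendsto_partialSum hb hF (hPmem n)).const_mul _).sub_const _
  have hval : quadratureError (b ^ m) P F
      = ‖1 / ((b ^ m : ℕ) : ℂ) * ∑ n ∈ Finset.range (b ^ m), (F (P n) : ℂ) - I‖ := by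
    have hI' : I = ((∫ x in cube s, F x : ℝ) : ℂ) := integral_ofReal
    rw [quadratureError, hI', ← Real.norm_eq_abs, ← Complex.norm_real]
    push_cast
    rfl
  rw [hval]
  refine le_of_tendsto hlim.norm (Filter.Eventually.of_forall fun l => ?_)
  have h0box : (0 : Fin s → ℕ) ∈ box s b l := by
    simp [box, pow_pos (NeZero.pos b) l]
  have hzero : pairing F (fun j => walsh b ((0 : Fin s → ℕ) j)) = I := by
    simp [pairing, tensor, walsh_zero, hI]
  have e : 1 / ((b ^ m : ℕ) : ℂ) * ∑ n ∈ Finset.range (b ^ m), partialSum b l F (P n) - I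
      = ∑ k ∈ (box s b l).erase 0, pairing F (fun j => walsh b (k j)) *
        (1 / ((b ^ m : ℕ) : ℂ) * ∑ n ∈ Finset.range (b ^ m),
          (starRingEnd ℂ) (tensor (fun j => walsh b (k j)) (P n))) := by
    have hbc : ((b ^ m : ℕ) : ℂ) ≠ 0 := by exact_mod_cast (pow_pos (NeZero.pos b) m).ne'
    have e1 : 1 / ((b ^ m : ℕ) : ℂ) * ∑ n ∈ Finset.range (b ^ m), partialSum b l F (P n)
        = ∑ k ∈ box s b l, pairing F (fun j => walsh b (k j)) *
        (1 / ((b ^ m : ℕ) : ℂ) * ∑ n ∈ Finset.range (b ^ m),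
          (starRingEnd ℂ) (tensor (fun j => walsh b (k j)) (P n))) := by
      simp only [partialSum]
      rw [Finset.sum_comm, Finset.mul_sum]
      refine Finset.sum_congr rfl fun k _ => ?_
      rw [← Finset.mul_sum]
      ring
    rw [e1, ← Finset.add_sum_erase _ _ h0box, hzero]
    simp only [tensor, Pi.zero_apply, walsh_zero, Finset.prod_const_one, map_one, Finset.sum_const,
      Finset.card_range, nsmul_eq_mul, mul_one]
    rw [one_div_mul_cancel hbc]
    ring
  rw [e]
  refine le_trans ((norm_sum_le _ _).trans ?_) (hE l)
  have hset : (box s b l).filter (fun k => k ≠ 0 ∧ dualVec C k = 0)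
      = ((box s b l).erase 0).filter fun k => dualVec C k = 0 := by
    ext k
    simp only [Finset.mem_filter, Finset.mem_erase]
    tauto
  rw [hset, Finset.sum_filter]
  refine Finset.sum_le_sum fun k _ => ?_
  have hk := norm_sum_walsh_shift_le C hb hσ k
  rw [norm_mul, norm_mul, norm_div, norm_one, Complex.norm_natCast, Nat.cast_pow]
  split_ifs at hk ⊢ with hd
  · refine mul_le_of_le_one_right (norm_nonneg _) ?_
    rw [one_div_mul_eq_div]
    exact (div_le_one hbm).mpr hk
  · rw [le_antisymm hk (norm_nonneg _)]
    simp

end net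

/-! ### Finiteness of the error criterion -/

section finite
variable {b : ℕ} [NeZero b]

/-- The sum of `b ^ (-μ_α(k))` over `k < b ^ l`. -/
def muSum (α b l : ℕ) : ℝ := ∑ k ∈ Finset.range (b ^ l), (1 / (b : ℝ)) ^ mu α b k

/-- Separates the `k` with a nonzero digit at position `l + 1`: there are `b - 1` choices of it,
each contributing `b^{-(l+1)}` and leaving one position fewer to count. -/
lemma muSum_succ (hb : 2 ≤ b) (α l : ℕ) :
    muSum (α + 1) b (l + 1)
      = ((b : ℝ) - 1) * (1 / (b : ℝ)) ^ (l + 1) * muSum α b l + muSum (α + 1) b l := by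
  rw [muSum, sum_range_pow_succ]
  obtain ⟨c, rfl⟩ : ∃ c, b = c + 1 := ⟨b - 1, by omega⟩
  rw [Finset.sum_range_succ']
  congr 1
  · have e : ∀ κ ∈ Finset.range c, ∑ K ∈ Finset.range ((c + 1) ^ l),
        (1 / ((c + 1 : ℕ) : ℝ)) ^ mu (α + 1) (c + 1) ((κ + 1) * (c + 1) ^ l + K)
        = (1 / ((c + 1 : ℕ) : ℝ)) ^ (l + 1) * muSum α (c + 1) l := by
      intro κ hκ
      rw [Finset.mem_range] at hκ
      rw [muSum, Finset.mul_sum]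
      refine Finset.sum_congr rfl fun K hK => ?_
      rw [mu_peel hb (by omega) (by omega) (Finset.mem_range.mp hK), pow_add]
    rw [Finset.sum_congr rfl e, Finset.sum_const, Finset.card_range, nsmul_eq_mul]
    push_cast
    ring
  · simp [muSum]

omit [NeZero b] in
lemma muSum_nonneg (α l : ℕ) : 0 ≤ muSum α b l := Finset.sum_nonneg fun k _ => by positivity

omit [NeZero b] in
lemma sub_one_mul_pow_le (hb : 2 ≤ b) (l : ℕ) :
    ((b : ℝ) - 1) * (1 / (b : ℝ)) ^ (l + 1) ≤ (1 / (b : ℝ)) ^ l := by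
  have hb' : (2 : ℝ) ≤ b := by exact_mod_cast hb
  rw [pow_succ, mul_left_comm]
  refine mul_le_of_le_one_right (by positivity) ?_
  rw [mul_one_div, div_le_one (by linarith)]
  linarith

omit [NeZero b] in
lemma muSum_le_pow (hb : 2 ≤ b) (α l : ℕ) : muSum α b l ≤ (b : ℝ) ^ l := by
  have hb' : (2 : ℝ) ≤ b := by exact_mod_cast hb
  refine (Finset.sum_le_card_nsmul _ _ 1 fun k _ => ?_).trans (by simp)
  refine pow_le_one₀ (by positivity) ?_
  rw [div_le_one (by linarith)]
  linarith

lemma muSum_le_linear (hb : 2 ≤ b) (α l : ℕ) : muSum (α + 1) b l ≤ 1 + l := by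
  induction l with
  | zero => simp [muSum]
  | succ l ih =>
    have hp := pow_cast_pos (b := b) l
    rw [muSum_succ hb]
    have h1 : ((b : ℝ) - 1) * (1 / (b : ℝ)) ^ (l + 1) * muSum α b l ≤ 1 := by
      calc _ ≤ (1 / (b : ℝ)) ^ l * (b : ℝ) ^ l :=
            mul_le_mul (sub_one_mul_pow_le hb l) (muSum_le_pow hb α l) (muSum_nonneg α l)
              (by positivity)
        _ = 1 := by rw [one_div_pow, one_div_mul_cancel hp.ne']
    push_cast
    linarith

/-- The recursion turns the trivial bound `b^l` into a linear one, and the linear one into `1 +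
∑_{i<l} (1 + i) 2^{-i}`, whose closed form is the right-hand side. -/
lemma muSum_le (hb : 2 ≤ b) (α l : ℕ) :
    muSum (α + 2) b l ≤ 5 - ((l : ℝ) + 2) * 2 * (1 / 2) ^ l := by
  have hb' : (2 : ℝ) ≤ b := by exact_mod_cast hb
  induction l with
  | zero => norm_num [muSum]
  | succ l ih =>
    rw [muSum_succ hb]
    have h1 : ((b : ℝ) - 1) * (1 / (b : ℝ)) ^ (l + 1) * muSum (α + 1) b l
        ≤ (1 / 2) ^ l * (1 + l) := by
      refine mul_le_mul ((sub_one_mul_pow_le hb l).trans ?_) (muSum_le_linear hb α l)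
        (muSum_nonneg _ l) (by positivity)
      gcongr
    rw [pow_succ (1 / 2 : ℝ)]
    push_cast
    linarith

lemma tsum_mu_lt_top (hb : 2 ≤ b) {α : ℕ} (hα : 2 ≤ α) {ι : Type*} [Fintype ι]
    (S : Set (ι → ℕ)) :
    ∑' k : S, ((b : ℝ≥0∞)⁻¹) ^ (∑ j, mu α b ((k : ι → ℕ) j)) < ⊤ := by
  classical
  obtain ⟨β, rfl⟩ := Nat.exists_eq_add_of_le' hα
  have hb0 : (0 : ℝ) < b := by exact_mod_cast (by omega : 0 < b)
  refine lt_of_le_of_lt (ENNReal.tsum_comp_le_tsum_of_injective Subtype.val_injective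
    fun k : ι → ℕ => ((b : ℝ≥0∞)⁻¹) ^ (∑ j, mu (β + 2) b (k j))) ?_
  refine lt_of_le_of_lt (b := ENNReal.ofReal (5 ^ Fintype.card ι)) ?_ ENNReal.ofReal_lt_top
  rw [ENNReal.tsum_eq_iSup_sum]
  refine iSup_le fun A => ?_
  -- A crude level that bounds every component of every index in `A`, so that `A` fits into a box on
  -- which the sum factors.
  set l : ℕ := ∑ k ∈ A, ∑ j, k j with hl
  have hA : A ⊆ Fintype.piFinset fun _ => Finset.range (b ^ l) := by
    intro k hk
    rw [Fintype.mem_piFinset]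
    intro j
    rw [Finset.mem_range]
    refine lt_of_le_of_lt ?_ (Nat.lt_pow_self (by omega : 1 < b))
    exact (Finset.single_le_sum (f := k) (fun _ _ => Nat.zero_le _) (Finset.mem_univ j)).trans
      (Finset.single_le_sum (f := fun k : ι → ℕ => ∑ j, k j) (fun _ _ => Nat.zero_le _) hk)
  have e : ∀ k : ι → ℕ, ((b : ℝ≥0∞)⁻¹) ^ (∑ j, mu (β + 2) b (k j))
      = ENNReal.ofReal (∏ j, (1 / (b : ℝ)) ^ mu (β + 2) b (k j)) := by
    intro k
    rw [Finset.prod_pow_eq_pow_sum, ENNReal.ofReal_pow (by positivity), one_div,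
      ENNReal.ofReal_inv_of_pos hb0, ENNReal.ofReal_natCast]
  simp only [e]
  rw [← ENNReal.ofReal_sum_of_nonneg fun k _ => by positivity]
  refine ENNReal.ofReal_le_ofReal ((Finset.sum_le_sum_of_subset_of_nonneg hA
    fun k _ _ => by positivity).trans ?_)
  rw [← Finset.prod_univ_sum (fun _ => Finset.range (b ^ l))
    (fun _ i => (1 / (b : ℝ)) ^ mu (β + 2) b i), Finset.prod_const, Finset.card_univ]
  refine pow_le_pow_left₀ (muSum_nonneg _ l) ((muSum_le hb β l).trans ?_) _
  have : (0 : ℝ) ≤ ((l : ℝ) + 2) * 2 * (1 / 2) ^ l := by positivity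
  linarith

end finite

/-! ### Properties of `lpSum` -/

section lpSum
variable {ι : Type*}

lemma lpSum_lt_top {p : ℝ≥0∞} {S : Finset ι} {a : ι → ℝ≥0∞} (h : ∀ i ∈ S, a i < ⊤) :
    lpSum p S a < ⊤ := by
  unfold lpSum
  split_ifs
  · exact (Finset.sup_lt_iff ENNReal.zero_lt_top).mpr h
  · refine ENNReal.rpow_lt_top_of_nonneg (by positivity) (ENNReal.sum_lt_top.mpr fun i hi => ?_).ne
    exact ENNReal.rpow_lt_top_of_nonneg (by positivity) (h i hi).ne

lemma le_lpSum {p : ℝ≥0∞} (hp : p ≠ 0) {S : Finset ι} (a : ι → ℝ≥0∞) {i : ι} (hi : i ∈ S) :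
    a i ≤ lpSum p S a := by
  unfold lpSum
  split_ifs with h
  · exact Finset.le_sup hi
  · have hp' : 0 < p.toReal := ENNReal.toReal_pos hp h
    rw [one_div, ENNReal.le_rpow_inv_iff hp']
    exact Finset.single_le_sum (f := fun i => a i ^ p.toReal) (fun _ _ => zero_le) hi

lemma lpSum_mono_set {p : ℝ≥0∞} {S T : Finset ι} (h : S ⊆ T) (a : ι → ℝ≥0∞) :
    lpSum p S a ≤ lpSum p T a := by
  unfold lpSum
  split_ifs
  · exact Finset.sup_mono h
  · gcongr

lemma lpSum_one (S : Finset ι) (a : ι → ℝ≥0∞) : lpSum 1 S a = ∑ i ∈ S, a i := by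
  simp [lpSum]

lemma sum_mul_le_lpSum_one_mul_top (S : Finset ι) (a c : ι → ℝ≥0∞) :
    ∑ i ∈ S, a i * c i ≤ lpSum 1 S a * lpSum ⊤ S c := by
  rw [lpSum_one, Finset.sum_mul]
  gcongr with i hi
  exact le_lpSum ENNReal.top_ne_zero c hi

/-- Hölder's inequality. -/
lemma sum_mul_le_lpSum_mul_lpSum {p q : ℝ≥0∞} (h : 1 / p + 1 / q = 1) (S : Finset ι)
    (a c : ι → ℝ≥0∞) : ∑ i ∈ S, a i * c i ≤ lpSum p S a * lpSum q S c := by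
  rcases eq_or_ne q ⊤ with rfl | hq
  · obtain rfl : p = 1 := by simpa using h
    exact sum_mul_le_lpSum_one_mul_top S a c
  rcases eq_or_ne p ⊤ with rfl | hp
  · obtain rfl : q = 1 := by simpa using h
    simp only [mul_comm (a _)]
    rw [mul_comm]
    exact sum_mul_le_lpSum_one_mul_top S c a
  have hp0 : p ≠ 0 := by rintro rfl; simp at h
  have hq0 : q ≠ 0 := by rintro rfl; simp at h
  have hsum : p.toReal⁻¹ + q.toReal⁻¹ = 1 := by
    rw [one_div, one_div] at h
    rw [← ENNReal.toReal_inv, ← ENNReal.toReal_inv, ← ENNReal.toReal_add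
      (ENNReal.inv_ne_top.mpr hp0) (ENNReal.inv_ne_top.mpr hq0), h, ENNReal.toReal_one]
  have hpr : 0 < p.toReal := ENNReal.toReal_pos hp0 hp
  have hqr : 0 < q.toReal⁻¹ := inv_pos.mpr (ENNReal.toReal_pos hq0 hq)
  have hconj : p.toReal.HolderConjugate q.toReal := by
    refine Real.holderConjugate_iff.mpr ⟨?_, hsum⟩
    rw [← inv_lt_one₀ hpr]
    linarith
  rw [lpSum, lpSum, if_neg hp, if_neg hq]
  exact ENNReal.inner_le_Lp_mul_Lq S a c hconj

end lpSum

/-! ### The error bound -/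

section bound
variable {b s α m : ℕ} {q r r' : ℝ≥0∞} {γ : Finset (Fin s) → ℝ≥0}

/-- The support of a multi-index. -/
def supp (k : Fin s → ℕ) : Finset (Fin s) := Finset.univ.filter fun j => k j ≠ 0

lemma mem_supp {k : Fin s → ℕ} {j : Fin s} : j ∈ supp k ↔ k j ≠ 0 := by simp [supp]

/-- The `ℓ_q` combination of the derivative norms belonging to `u`. -/
def derivNorm (α : ℕ) (q : ℝ≥0∞) (D : (Fin s → ℕ) → (Fin s → ℝ) → ℝ) (u : Finset (Fin s)) :
    ℝ≥0∞ :=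
  lpSum q (derivIndices α u) fun p =>
    eLpNorm (integrateOut p.1 (D (multiIndex α p.1 p.2))) q (volume.restrict (cube s))

lemma multiIndex_le {u v : Finset (Fin s)} {τ : Fin s → ℕ}
    (hτ : ∀ j ∈ u \ v, τ j ∈ Finset.Icc 1 α) (hτ0 : ∀ j ∉ u \ v, τ j = 0) (j : Fin s) :
    multiIndex α v τ j ≤ α := by
  unfold multiIndex
  split_ifs
  · exact le_rfl
  · by_cases hj : j ∈ u \ v
    · exact (Finset.mem_Icc.mp (hτ j hj)).2
    · rw [hτ0 j hj]; exact Nat.zero_le _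

/-- On a probability space the `L_1` norm is at most the `L_q` norm, which is one entry of the `ℓ_q`
combination. -/
lemma integral_norm_integrateOut_le (hq : 1 ≤ q) {F : (Fin s → ℝ) → ℝ}
    {D : (Fin s → ℕ) → (Fin s → ℝ) → ℝ} (hD : IsMixedDerivFamily α F D) {u : Finset (Fin s)}
    (htop : derivNorm α q D u ≠ ⊤) {v : Finset (Fin s)} (hv : v ⊆ u) {τ : Fin s → ℕ}
    (hτ : ∀ j ∈ u \ v, τ j ∈ Finset.Icc 1 α) (hτ0 : ∀ j ∉ u \ v, τ j = 0) :
    ∫ y in cube s, ‖integrateOut v (D (multiIndex α v τ)) y‖ ≤ (derivNorm α q D u).toReal := by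
  have hi := integrable_integrateOut v (hD.integrable _ (multiIndex_le hτ hτ0))
  have hmem : (⟨v, τ⟩ : Σ _ : Finset (Fin s), Fin s → ℕ) ∈ derivIndices α u := by
    rw [derivIndices, Finset.mem_sigma, Finset.mem_powerset, Fintype.mem_piFinset]
    refine ⟨hv, fun j => ?_⟩
    split_ifs with hj
    · exact hτ j hj
    · simpa using hτ0 j hj
  have hle := le_lpSum (p := q) (zero_lt_one.trans_le hq).ne' (fun p :
    (Σ _ : Finset (Fin s), Fin s → ℕ) =>
    eLpNorm (integrateOut p.1 (D (multiIndex α p.1 p.2))) q (volume.restrict (cube s))) hmem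
  have h1 : eLpNorm (integrateOut v (D (multiIndex α v τ))) 1 (volume.restrict (cube s))
      ≤ derivNorm α q D u :=
    (eLpNorm_le_eLpNorm_of_exponent_le hq hi.aestronglyMeasurable).trans hle
  rw [eLpNorm_one_eq_lintegral_enorm] at h1
  rw [integral_norm_eq_lintegral_enorm hi.aestronglyMeasurable]
  exact ENNReal.toReal_mono htop h1

lemma norm_pairing_walsh_le [NeZero b] (hb : 2 ≤ b) (hα : 2 ≤ α) (hq : 1 ≤ q)
    {F : (Fin s → ℝ) → ℝ} {D : (Fin s → ℕ) → (Fin s → ℝ) → ℝ} (hD : IsMixedDerivFamily α F D)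
    (k : Fin s → ℕ) (htop : derivNorm α q D (supp k) ≠ ⊤) :
    ‖pairing F fun j => walsh b (k j)‖
      ≤ (∏ j ∈ supp k, walshConst α b * (1 / (b : ℝ)) ^ mu α b (k j))
        * (derivNorm α q D (supp k)).toReal := by
  have h := norm_pairing_multiIndex_le (u := supp k) hD (by omega)
    (fun v hv τ hτ hτ0 => integral_norm_integrateOut_le hq hD htop hv hτ hτ0)
    (f := fun j => walsh b (k j)) (fun j _ => isBddMeas_walsh hb (k j))
    (fun j hj => prim_walsh hb (mem_supp.mp hj))
    (fun j hj => chain_prim_walsh_walshConst hb hα (mem_supp.mp hj))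
    (supp k) ∅ 0 (by simp) (by simp) (by simp) (by simp)
    (h := fun j => walsh b (k j)) (fun j => isBddMeas_walsh hb (k j)) (d := 0) (fun _ _ => rfl)
    (fun j hj => by
      have hj' : k j = 0 := by simpa [mem_supp] using hj
      funext x
      rw [hj', walsh_zero]) (by simp)
  have e : multiIndex α (∅ : Finset (Fin s)) 0 = 0 := by
    funext j; simp [multiIndex]
  rw [e, hD.zero] at h
  simpa using h

/-- The factor of the error criterion belonging to `u`, without the weight. -/
def dualSum (b α m : ℕ) (C : Fin s → Matrix (Fin (α * m)) (Fin m) (ZMod b))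
    (u : Finset (Fin s)) : ℝ≥0∞ :=
  ENNReal.ofReal (walshConst α b) ^ u.card *
    ∑' k : dualNet b α m C u, ((b : ℝ≥0∞)⁻¹) ^ (∑ j : u, mu α b ((k : u → ℕ) j))

/-! ### Summation over the dual net and the weights -/

variable [NeZero b] (C : Fin s → Matrix (Fin (α * m)) (Fin m) (ZMod b))

omit [NeZero b] in
lemma restrict_mem_dualNet {k : Fin s → ℕ} (hk : dualVec C k = 0) :
    (fun j : supp k => k j) ∈ dualNet b α m C (supp k) := by
  refine ⟨fun j => Nat.one_le_iff_ne_zero.mpr (mem_supp.mp j.2), ?_⟩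
  rw [← hk, dualVec, Finset.sum_coe_sort (supp k) fun j => (C j)ᵀ *ᵥ digitVec b (α * m) (k j)]
  refine Finset.sum_subset (Finset.subset_univ _) fun j _ hj => ?_
  have hj' : k j = 0 := by simpa [mem_supp] using hj
  have h0 : digitVec b (α * m) 0 = 0 := by
    funext i; simp [digitVec, natDigit]
  rw [hj', h0, Matrix.mulVec_zero]

omit [NeZero b] in
lemma ofReal_prod_walshConst (hb : 2 ≤ b) (hα : 2 ≤ α) (k : Fin s → ℕ) (u : Finset (Fin s)) :
    ENNReal.ofReal (∏ j ∈ u, walshConst α b * (1 / (b : ℝ)) ^ mu α b (k j))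
      = ENNReal.ofReal (walshConst α b) ^ u.card *
        ((b : ℝ≥0∞)⁻¹) ^ (∑ j : u, mu α b (k j)) := by
  have hb0 : (0 : ℝ) < b := by exact_mod_cast (by omega : 0 < b)
  have hW := walshConst_pos hb hα
  rw [Finset.prod_mul_distrib, Finset.prod_const, Finset.prod_pow_eq_pow_sum,
    ENNReal.ofReal_mul (by positivity), ENNReal.ofReal_pow hW.le, ENNReal.ofReal_pow (by positivity),
    one_div, ENNReal.ofReal_inv_of_pos hb0, ENNReal.ofReal_natCast,
    Finset.sum_coe_sort u fun j => mu α b (k j)]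

omit [NeZero b] in
-- Restriction to `u` is injective on indices supported in `u` and maps them into the projected dual
-- net.
lemma sum_fiber_le (hb : 2 ≤ b) (hα : 2 ≤ α) (u : Finset (Fin s)) (T : Finset (Fin s → ℕ))
    (hT : ∀ k ∈ T, dualVec C k = 0 ∧ supp k = u) :
    ∑ k ∈ T, ENNReal.ofReal (∏ j ∈ u, walshConst α b * (1 / (b : ℝ)) ^ mu α b (k j))
      ≤ dualSum b α m C u := by
  simp only [ofReal_prod_walshConst hb hα]
  rw [← Finset.mul_sum, dualSum]
  gcongr
  let φ : T → dualNet b α m C u := fun k => ⟨fun j => (k : Fin s → ℕ) j, by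
    obtain ⟨h1, h2⟩ := hT k k.2
    subst h2
    exact restrict_mem_dualNet C h1⟩
  have hφ : Function.Injective φ := by
    intro k k' h
    apply Subtype.ext
    funext j
    by_cases hj : j ∈ u
    · exact congrFun (congrArg Subtype.val h) ⟨j, hj⟩
    · have h1 : j ∉ supp (k : Fin s → ℕ) := by rwa [(hT k k.2).2]
      have h2 : j ∉ supp (k' : Fin s → ℕ) := by rwa [(hT k' k'.2).2]
      rw [mem_supp, not_not] at h1 h2
      rw [h1, h2]
  have h := ENNReal.tsum_comp_le_tsum_of_injective hφ
    fun k : dualNet b α m C u => ((b : ℝ≥0∞)⁻¹) ^ (∑ j : u, mu α b ((k : u → ℕ) j))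
  rw [tsum_fintype] at h
  rw [← Finset.sum_coe_sort T]
  exact h

lemma dualSum_lt_top (hb : 2 ≤ b) (hα : 2 ≤ α) (u : Finset (Fin s)) :
    dualSum b α m C u < ⊤ :=
  ENNReal.mul_lt_top (ENNReal.pow_lt_top ENNReal.ofReal_lt_top) (tsum_mu_lt_top hb hα _)

omit [NeZero b] in
lemma errorCriterion_eq : errorCriterion b α m γ r' C
    = lpSum r' (Finset.univ.filter fun u : Finset (Fin s) => u.Nonempty) fun u =>
      (γ u : ℝ≥0∞) * dualSum b α m C u := by
  unfold errorCriterion dualSum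
  congr 1
  funext u
  ring

lemma errorCriterion_lt_top (hb : 2 ≤ b) (hα : 2 ≤ α) : errorCriterion b α m γ r' C < ⊤ := by
  rw [errorCriterion_eq]
  exact lpSum_lt_top fun u _ => ENNReal.mul_lt_top ENNReal.coe_lt_top (dualSum_lt_top C hb hα u)

lemma inv_mul_derivNorm_le (hr : 1 ≤ r) (D : (Fin s → ℕ) → (Fin s → ℝ) → ℝ)
    (u : Finset (Fin s)) : (γ u : ℝ≥0∞)⁻¹ * derivNorm α q D u ≤ familyNorm α γ q r D :=
  le_lpSum (zero_lt_one.trans_le hr).ne' (fun u : Finset (Fin s) =>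
    (γ u : ℝ≥0∞)⁻¹ * derivNorm α q D u) (Finset.mem_univ u)

lemma derivNorm_ne_top (hr : 1 ≤ r) {D : (Fin s → ℕ) → (Fin s → ℝ) → ℝ}
    (hfin : familyNorm α γ q r D < ⊤) (u : Finset (Fin s)) : derivNorm α q D u ≠ ⊤ := by
  intro h
  have h1 := (inv_mul_derivNorm_le (q := q) (α := α) (γ := γ) hr D u).trans_lt hfin
  rw [h, ENNReal.mul_top (ENNReal.inv_ne_zero.mpr ENNReal.coe_ne_top)] at h1
  exact lt_irrefl _ h1

/-- Only `γ u = 0` needs an argument: then `γ u⁻¹ = ∞`, and a finite norm forces the derivative term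
to vanish. -/
lemma derivNorm_le_weight_mul (hr : 1 ≤ r) {D : (Fin s → ℕ) → (Fin s → ℝ) → ℝ}
    (hfin : familyNorm α γ q r D < ⊤) (u : Finset (Fin s)) :
    derivNorm α q D u ≤ γ u * ((γ u : ℝ≥0∞)⁻¹ * derivNorm α q D u) := by
  rcases eq_or_ne (γ u) 0 with h0 | h0
  · have h1 := (inv_mul_derivNorm_le (q := q) (α := α) (γ := γ) hr D u).trans_lt hfin
    rw [h0, ENNReal.coe_zero, ENNReal.inv_zero] at h1
    have : derivNorm α q D u = 0 := by
      by_contra h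
      rw [ENNReal.top_mul h] at h1
      exact lt_irrefl _ h1
    rw [this]
    exact zero_le
  · rw [← mul_assoc, ENNReal.mul_inv_cancel (by exact_mod_cast h0) ENNReal.coe_ne_top, one_mul]

lemma ofReal_quadratureError_le (hb : 2 ≤ b) (hα : 2 ≤ α) (hq : 1 ≤ q) (hr : 1 ≤ r)
    (hrr' : 1 / r + 1 / r' = 1) {σ : Fin s → ℝ} (hσ : ∀ j, σ j ∈ Set.Ico (0 : ℝ) 1)
    {F : (Fin s → ℝ) → ℝ} (hF : ContinuousOn F (cube s)) {D : (Fin s → ℕ) → (Fin s → ℝ) → ℝ}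
    (hD : IsMixedDerivFamily α F D) (hfin : familyNorm α γ q r D < ⊤) :
    ENNReal.ofReal
        (quadratureError (b ^ m) (fun n => digitalShift b (digitalNet b α m C n) σ) F)
      ≤ errorCriterion b α m γ r' C * familyNorm α γ q r D := by
  set U := Finset.univ.filter fun u : Finset (Fin s) => u.Nonempty with hU
  set E : ℝ≥0∞ := ∑ u ∈ U, dualSum b α m C u * derivNorm α q D u with hE
  have hEtop : E ≠ ⊤ := (ENNReal.sum_lt_top.mpr fun u _ =>
    ENNReal.mul_lt_top (dualSum_lt_top C hb hα u) (derivNorm_ne_top hr hfin u).lt_top).ne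
  have h1 : quadratureError (b ^ m) (fun n => digitalShift b (digitalNet b α m C n) σ) F
      ≤ E.toReal := by
    refine quadratureError_le C hb hσ hF fun l => ?_
    rw [← ENNReal.ofReal_le_iff_le_toReal hEtop, ENNReal.ofReal_sum_of_nonneg fun k _ =>
      norm_nonneg _]
    set K := (box s b l).filter fun k => k ≠ 0 ∧ dualVec C k = 0 with hK
    have hmaps : ∀ k ∈ K, supp k ∈ U := by
      intro k hk
      rw [hK, Finset.mem_filter] at hk
      rw [hU, Finset.mem_filter]
      obtain ⟨j, hj⟩ := Function.ne_iff.mp hk.2.1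
      exact ⟨Finset.mem_univ _, j, mem_supp.mpr hj⟩
    rw [← Finset.sum_fiberwise_of_maps_to hmaps]
    refine Finset.sum_le_sum fun u _ => ?_
    refine le_trans (Finset.sum_le_sum (g := fun k =>
      ENNReal.ofReal (∏ j ∈ u, walshConst α b * (1 / (b : ℝ)) ^ mu α b (k j))
        * derivNorm α q D u) fun k hk => ?_) ?_
    · have hku : supp k = u := (Finset.mem_filter.mp hk).2
      have h := ENNReal.ofReal_le_ofReal (norm_pairing_walsh_le (b := b) hb hα hq hD k
        (derivNorm_ne_top hr hfin _))
      rwa [ENNReal.ofReal_mul' ENNReal.toReal_nonneg,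
        ENNReal.ofReal_toReal (derivNorm_ne_top hr hfin _), hku] at h
    · rw [← Finset.sum_mul]
      gcongr
      refine sum_fiber_le C hb hα u _ fun k hk => ?_
      rw [Finset.mem_filter, hK, Finset.mem_filter] at hk
      exact ⟨hk.1.2.2, hk.2⟩
  refine (ENNReal.ofReal_le_of_le_toReal h1).trans ?_
  calc E ≤ ∑ u ∈ U, (γ u * dualSum b α m C u) * ((γ u : ℝ≥0∞)⁻¹ * derivNorm α q D u) := by
        refine Finset.sum_le_sum fun u _ => ?_
        calc dualSum b α m C u * derivNorm α q D u
            ≤ dualSum b α m C u * (γ u * ((γ u : ℝ≥0∞)⁻¹ * derivNorm α q D u)) := by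
              gcongr
              exact derivNorm_le_weight_mul hr hfin u
          _ = _ := by ring
    _ ≤ lpSum r' U (fun u => γ u * dualSum b α m C u)
          * lpSum r U (fun u => (γ u : ℝ≥0∞)⁻¹ * derivNorm α q D u) :=
        sum_mul_le_lpSum_mul_lpSum (by rw [add_comm]; exact hrr') _ _ _
    _ ≤ errorCriterion b α m γ r' C * familyNorm α γ q r D := by
        rw [errorCriterion_eq]
        gcongr
        exact lpSum_mono_set (Finset.subset_univ _) _

lemma worstCaseError_shift_le (hb : 2 ≤ b) (hα : 2 ≤ α) (hq : 1 ≤ q) (hr : 1 ≤ r)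
    (hrr' : 1 / r + 1 / r' = 1) {σ : Fin s → ℝ} (hσ : ∀ j, σ j ∈ Set.Ico (0 : ℝ) 1) :
    worstCaseError α γ q r (b ^ m) (fun n => digitalShift b (digitalNet b α m C n) σ)
      ≤ errorCriterion b α m γ r' C := by
  refine iSup₂_le fun F hF => ?_
  obtain ⟨⟨hcont, -⟩, hnorm⟩ := hF
  have he := errorCriterion_lt_top (γ := γ) (r' := r') C hb hα
  -- The norm is an infimum over derivative families, so a family of norm below `c` is available
  -- only for `c > 1`. The bound at `1` follows by letting `c` decrease, as the criterion is finite.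
  have key : ∀ c : ℝ≥0∞, 1 < c → c < ⊤ → ENNReal.ofReal
      (quadratureError (b ^ m) (fun n => digitalShift b (digitalNet b α m C n) σ) F)
      ≤ errorCriterion b α m γ r' C * c := by
    intro c hc hctop
    have h := hnorm.trans_lt hc
    rw [sobolevNorm, iInf_lt_iff] at h
    obtain ⟨D, h⟩ := h
    rw [iInf_lt_iff] at h
    obtain ⟨hD, h⟩ := h
    refine (ofReal_quadratureError_le C hb hα hq hr hrr' hσ hcont hD (h.trans hctop)).trans ?_
    gcongr
  have hlim : Filter.Tendsto (fun c => errorCriterion b α m γ r' C * c) (nhdsWithin 1 (Set.Ioi 1))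
      (nhds (errorCriterion b α m γ r' C * 1)) :=
    (ENNReal.Tendsto.const_mul Filter.tendsto_id (Or.inr he.ne)).mono_left nhdsWithin_le_nhds
  rw [mul_one] at hlim
  have : (nhdsWithin (1 : ℝ≥0∞) (Set.Ioi 1)).NeBot :=
    nhdsGT_neBot_of_exists_gt ⟨⊤, ENNReal.one_lt_top⟩
  refine ge_of_tendsto hlim ?_
  filter_upwards [self_mem_nhdsWithin, mem_nhdsWithin_of_mem_nhds (Iio_mem_nhds ENNReal.one_lt_top)]
    with c hc hctop using key c hc hctop

end bound

end QMC

end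

theorem mainTheorem3 (s α b m : ℕ) [Fact b.Prime] (hs : 1 ≤ s) (hα : 1 < α) (hm : 1 ≤ m)
    (q r r' : ℝ≥0∞) (hq : 1 ≤ q) (hr : 1 ≤ r) (hr' : 1 ≤ r') (hrr' : 1 / r + 1 / r' = 1)
    (γ : Finset (Fin s) → ℝ≥0)
    (C : Fin s → Matrix (Fin (α * m)) (Fin m) (ZMod b)) :
    QMC.errorCriterion b α m γ r' C < ⊤ ∧
    QMC.worstCaseError α γ q r (b ^ m) (QMC.digitalNet b α m C)
      ≤ QMC.errorCriterion b α m γ r' C ∧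
    ∀ σ : Fin s → ℝ, (∀ j, σ j ∈ Set.Ico (0 : ℝ) 1) →
      QMC.worstCaseError α γ q r (b ^ m)
          (fun n => QMC.digitalShift b (QMC.digitalNet b α m C n) σ)
        ≤ QMC.errorCriterion b α m γ r' C := by
  have hb : 2 ≤ b := (Fact.out : b.Prime).two_le
  have hmain : ∀ σ : Fin s → ℝ, (∀ j, σ j ∈ Set.Ico (0 : ℝ) 1) →
      QMC.worstCaseError α γ q r (b ^ m)
          (fun n => QMC.digitalShift b (QMC.digitalNet b α m C n) σ)
        ≤ QMC.errorCriterion b α m γ r' C := fun σ hσ =>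
    QMC.worstCaseError_shift_le C hb hα hq hr hrr' hσ
  refine ⟨QMC.errorCriterion_lt_top C hb hα, ?_, hmain⟩
  -- The unshifted net is the case `σ = 0`.
  have h := hmain 0 fun _ => ⟨le_rfl, zero_lt_one⟩
  simp only [QMC.digitalShift_zero C hb] at h
  exact h
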